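/- Let $d\ge 1$, $L,T>0$, $\Omega=(-L/2,L/2)^d$, $Q_T=(0,T)\times\Omega$. Data. (a) $w\in BV(\Omega)$ is even and non-negative, and either (i) $w\in L^\infty(\Omega)$, in which case $\tilde w$ denotes the $L$-periodic extension of $w$, or (ii) $w$ has compact support in $\Omega$, in which case $\tilde w$ denotes its extension by zero. (b) $A:\mathbb R\to\mathbb R$ is locally Lipschitz, odd, and $A(s)s\ge 0$. (c) $f:Q_T\times\mathbb R\to\mathbb R$ satisfies $f(\cdot,\cdot,s)\in BV(Q_T)$ for every $s$, is locally Lipschitz in $s$ uniformly in $(t,x)$, and $|f(\cdot,\cdot,s)|\le C_f(1+|s|)$. (d) $u_0\in L^\infty(\Omega)\cap BV(\Omega)$. Let $u$ be a solution of $$\partial_t u(t,x)=\int_\Omega \tilde w(x-y)\,A\big(u(t,y)-u(t,x)\big)\,dy+f(t,x,u(t,x)),\qquad u(0,x)=u_0(x),$$ that is bounded, Lipschitz continuous in $t$ uniformly in $x$, and bounded in $t\in[0,T]$ with values in $BV(\Omega)$. Let $B$ be a locally Lipschitz function with $|B(s)|\le C_A|s|$ for all $s$ that equals $A$ on $[-(b-a),b-a]$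 for some interval $[a,b]$ containing the values of $u$ (one takes $B=A$ if $A$ has linear growth; $u$ solves the same problem with $B$ in place of $A$). Scheme. For $N,m,L_Q\ge 1$ put $\tau=T/N$, $t_n=n\tau$, $h=L/(2m)$; let $\Omega_j$ be the open cube of side $h$ centred at $(j-\tfrac12\mathbf 1)h$, for $j\in \mathbf J=\{-m+1,\dots,m\}^d$. The periodized averages $u_{0h}[j]$, $w_h[j]$, $f_{nj}(s)$ are the means of $u_0$, of $w$ and (over $[t_n,t_{n+1})$ in time) of $f(\cdot,\cdot,s)$ over the union of $\Omega_j$ and all cells opposed to it, that is, all $\Omega_k$, $k\in\mathbf J$, such that for each $i$ either $k_i=j_i$ or $k_i,j_i\in\{-m+1,m\}$. Let $[C_m,C_M]$ contain the values of $u$, $q=(C_M-C_m)/L_Q$, $q_i=C_M-iq$ for $0\le i\le L_Q$, and let $\mathcal Q(\rho)$ be a nearest $q_i$ to $\rho$ (ties broken arbitrarily). Let $\mathcal F_d$ be the $d$-dimensional discrete Fourier transform of length $2m$ per direction in case (i), and of length $4m$ in case (ii) (the mesh of $(-L,L)^d$), mesh functions being set to zero outside $\mathbf J$. Put $u^0[j]=u_{0h}[j]$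 and $$u^{n+1}[j]=u^n[j]+\tau\Big(h^d\,\mathcal F_d^{-1}\big(\mathcal F_d(w_h)\,\mathcal F_d(B(u^n-q_i))\big)[j]+f_{nj}(u^n[j])\Big),\qquad q_i=\mathcal Q(u^n[j]),$$ and $u_{\tau h}(t,x)=u^n[j]$ for $(t,x)\in[t_n,t_{n+1})\times\Omega_j$. Then there is a constant $C>0$, independent of $N,m,L_Q,C_m,C_M$ and of the tie-breaking (hence of $\tau,h,q$), such that $$\|u-u_{\tau h}\|_{L^\infty(0,T;L^1(\Omega))}\le C(\tau+h+q).$$ -/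

import Mathlib

open MeasureTheory Set

namespace NonlocalFFT

noncomputable section

/-! ### Functions of bounded variation -/

/-- The divergence of a vector field, as the trace of its derivative. -/
def divergence {E : Type*} [NormedAddCommGroup E] [NormedSpace ℝ E] (φ : E → E) (x : E) : ℝ :=
  LinearMap.trace ℝ E (fderiv ℝ φ x).toLinearMap

/-- The total variation of `v` in the open set `U` is at most `M`: the bound
`∫_U v div φ ≤ M` holds for all `φ ∈ C_c^1(U; E)` with `|φ| ≤ 1`. (The value of the variation
depends on the norm of the finite-dimensional space `E`, its finiteness does not.) -/
def VariationLE {E : Type*} [NormedAddCommGroup E] [NormedSpace ℝ E] [MeasureSpace E]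
    (U : Set E) (v : E → ℝ) (M : ℝ) : Prop :=
  ∀ φ : E → E, ContDiff ℝ 1 φ → HasCompactSupport φ → tsupport φ ⊆ U → (∀ x, ‖φ x‖ ≤ 1) →
    ∫ x in U, v x * divergence φ x ≤ M

/-- `v ∈ BV(U)`. -/
def IsBV {E : Type*} [NormedAddCommGroup E] [NormedSpace ℝ E] [MeasureSpace E]
    (U : Set E) (v : E → ℝ) : Prop :=
  IntegrableOn v U ∧ ∃ M : ℝ, VariationLE U v M

/-! ### The continuous problem -/

/-- The open cube `(-L/2, L/2)^d`. -/
def cube (d : ℕ) (L : ℝ) : Set (Fin d → ℝ) := {x | ∀ i, -(L / 2) < x i ∧ x i < L / 2}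

/-- The two ways in which a kernel given on the cube is extended to differences of its points. -/
inductive Extension where
  /-- extension by periodicity, for bounded kernels -/
  | periodic
  /-- extension by zero, for compactly supported kernels -/
  | zero

/-- The data of the problem: side length `L` of the cube, final time `T`, kind of extension of the
kernel, spatial kernel `w` (only its values on the cube matter), range kernel `A`, reaction
`f t x s` and initial datum `u₀`. -/
structure Data (d : ℕ) where
  L : ℝ
  T : ℝ
  ext : Extension
  w : (Fin d → ℝ) → ℝ
  A : ℝ → ℝ
  f : ℝ → (Fin d → ℝ) → ℝ → ℝ
  u₀ : (Fin d → ℝ) → ℝ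

variable {d : ℕ}

/-- The spatial domain. -/
def Data.Ω (D : Data d) : Set (Fin d → ℝ) := cube d D.L

/-- The space-time domain `(0, T) × Ω`. -/
def Data.QT (D : Data d) : Set (ℝ × (Fin d → ℝ)) := Ioo 0 D.T ×ˢ D.Ω

/-- The extension of the kernel from the cube, by periodicity or by zero. -/
def Data.wExt (D : Data d) : (Fin d → ℝ) → ℝ :=
  match D.ext with
  | Extension.periodic => fun z => D.w fun i => z i - D.L * round (z i / D.L)
  | Extension.zero => D.Ω.indicator D.w

/-- The standing assumptions on the data. -/
structure Data.Admissible (D : Data d) : Prop where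
  L_pos : 0 < D.L
  T_pos : 0 < D.T
  w_bv : IsBV D.Ω D.w
  w_nonneg : ∀ᵐ x ∂volume.restrict D.Ω, 0 ≤ D.w x
  w_even : ∀ᵐ x ∂volume.restrict D.Ω, D.w (-x) = D.w x
  w_bounded : D.ext = Extension.periodic → ∃ M : ℝ, ∀ᵐ x ∂volume.restrict D.Ω, |D.w x| ≤ M
  w_compact : D.ext = Extension.zero → ∃ K : Set (Fin d → ℝ), IsCompact K ∧ K ⊆ D.Ω ∧
    ∀ᵐ x ∂volume.restrict (D.Ω \ K), D.w x = 0
  A_odd : ∀ s, D.A (-s) = -D.A s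
  A_sign : ∀ s, 0 ≤ D.A s * s
  A_lip : LocallyLipschitz D.A
  f_bv : ∀ s, IsBV D.QT fun z => D.f z.1 z.2 s
  f_lip : ∀ R : ℝ, ∃ K : ℝ, ∀ᵐ z ∂volume.restrict D.QT, ∀ s s' : ℝ, |s| ≤ R → |s'| ≤ R →
    |D.f z.1 z.2 s - D.f z.1 z.2 s'| ≤ K * |s - s'|
  f_growth : ∃ Cf : ℝ, 0 < Cf ∧ ∀ s, ∀ᵐ z ∂volume.restrict D.QT,
    |D.f z.1 z.2 s| ≤ Cf * (1 + |s|)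
  u₀_bv : IsBV D.Ω D.u₀
  u₀_bounded : ∃ M : ℝ, ∀ᵐ x ∂volume.restrict D.Ω, |D.u₀ x| ≤ M

/-- The nonlocal diffusion operator `v ↦ ∫_Ω w(x - y) A(v(y) - v(x)) dy`. -/
def Data.nonlocalOp (D : Data d) (v : (Fin d → ℝ) → ℝ) (x : Fin d → ℝ) : ℝ :=
  ∫ y in D.Ω, D.wExt (x - y) * D.A (v y - v x)

/-- `u` solves `∂_t u = 𝒜(u) + f(t, x, u)`, `u(0) = u₀`, in the class of functions that are bounded,
Lipschitz continuous in time uniformly in space, and bounded in time with values in `BV(Ω)`. -/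
structure Data.IsSolution (D : Data d) (u : ℝ → (Fin d → ℝ) → ℝ) : Prop where
  measurable : AEStronglyMeasurable (fun z : ℝ × (Fin d → ℝ) => u z.1 z.2) (volume.restrict D.QT)
  bounded_lip : ∃ K : NNReal, ∀ᵐ x ∂volume.restrict D.Ω,
    (∀ t ∈ Icc 0 D.T, |u t x| ≤ K) ∧ LipschitzOnWith K (fun t => u t x) (Icc 0 D.T)
  bv : ∃ M : ℝ, ∀ t ∈ Icc 0 D.T, IntegrableOn (u t) D.Ω ∧ VariationLE D.Ω (u t) M
  initial : ∀ᵐ x ∂volume.restrict D.Ω, u 0 x = D.u₀ x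
  equation : ∀ᵐ x ∂volume.restrict D.Ω, ∀ᵐ t ∂volume.restrict (Ioo 0 D.T),
    HasDerivAt (fun s => u s x) (D.nonlocalOp (u t) x + D.f t x (u t x)) t

/-- `B` is a range kernel that may be used in the scheme: a locally Lipschitz function of at most
linear growth that coincides with `A` on the differences of the values of the solution `u`, so that
`u` solves the same problem with `B` in place of `A`. If `A` itself satisfies `|A(s)| ≤ CA |s|`,
then `B = A` is admitted. -/
structure Data.IsSchemeKernel (D : Data d) (u : ℝ → (Fin d → ℝ) → ℝ) (B : ℝ → ℝ) : Prop where
  lip : LocallyLipschitz B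
  growth : ∃ CA : ℝ, ∀ s, |B s| ≤ CA * |s|
  agrees : ∃ a b : ℝ, (∀ t ∈ Icc 0 D.T, ∀ᵐ x ∂volume.restrict D.Ω, u t x ∈ Icc a b) ∧
    ∀ s, |s| ≤ b - a → B s = D.A s

/-! ### Mesh and periodized averages -/

/-- The multi-indices `j` with `-p < j_i ≤ p`; they represent all residues modulo `2p`. With
`h = L / (2m)`, the cells with index in `grid m` partition the cube `(-L/2, L/2)^d`, those with
index in `grid (2m)` the cube `(-L, L)^d`. -/
def grid (d p : ℕ) : Finset (Fin d → ℤ) := Fintype.piFinset fun _ => Finset.Ioc (-(p : ℤ)) p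

/-- The open cell of side `h` centred at `x_j = (j - 1/2) h`. -/
def cell (h : ℝ) (j : Fin d → ℤ) : Set (Fin d → ℝ) :=
  {x | ∀ i, |x i - ((j i : ℝ) - 1 / 2) * h| < h / 2}

/-- The mean value over a cell. -/
def cellAvg (h : ℝ) (v : (Fin d → ℝ) → ℝ) (j : Fin d → ℤ) : ℝ :=
  1 / h ^ d * ∫ x in cell h j, v x

/-- The first and the last index in a coordinate direction. -/
def IsEnd (m : ℕ) (a : ℤ) : Prop := a = 1 - (m : ℤ) ∨ a = m

open Classical in
/-- The indices of the cells opposed to cell `j`, with `j` itself: `{j}` for an interior cell, two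
cells for a cell on a single face, `2^r` cells if `j` lies on `r` faces of different directions. -/
def opposed (m : ℕ) (j : Fin d → ℤ) : Finset (Fin d → ℤ) :=
  (grid d m).filter fun k => ∀ i, k i = j i ∨ (IsEnd m (k i) ∧ IsEnd m (j i))

/-- Averaging of the values of a mesh function on opposed cells. -/
def periodize (m : ℕ) (g : (Fin d → ℤ) → ℝ) (j : Fin d → ℤ) : ℝ :=
  (∑ k ∈ opposed m j, g k) / (opposed m j).card

/-! ### Discrete Fourier transform -/

/-- The `d`-dimensional discrete Fourier transform of length `2p` in each direction. -/
def dft (p : ℕ) (g : (Fin d → ℤ) → ℂ) (k : Fin d → ℤ) : ℂ :=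
  ∑ j ∈ grid d p, Complex.exp (-(2 * Real.pi * Complex.I * (∑ i, (j i * k i : ℂ)) / (2 * p))) * g j

/-- The inverse discrete Fourier transform. -/
def idft (p : ℕ) (g : (Fin d → ℤ) → ℂ) (j : Fin d → ℤ) : ℂ :=
  ((2 * p : ℂ) ^ d)⁻¹ *
    ∑ k ∈ grid d p, Complex.exp (2 * Real.pi * Complex.I * (∑ i, (j i * k i : ℂ)) / (2 * p)) * g k

open Classical in
/-- A mesh function on the cells of `(-L/2, L/2)^d`, set to zero on all other indices. -/
def pad (m : ℕ) (g : (Fin d → ℤ) → ℝ) (j : Fin d → ℤ) : ℂ :=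
  if j ∈ grid d m then (g j : ℂ) else 0

/-- Half of the length of the discrete Fourier transforms. If the kernel is extended periodically,
they act on the mesh of `(-L/2, L/2)^d`; if it is extended by zero, on the mesh of `(-L, L)^d`. -/
def Extension.halfPeriod (e : Extension) (m : ℕ) : ℕ :=
  match e with
  | Extension.periodic => m
  | Extension.zero => 2 * m

/-! ### The discrete scheme -/

/-- The discretization parameters: `N` time steps, `2m` cells per direction, and `Lq` subintervals
of the range interval `[Cmin, Cmax]`. -/
structure Params where
  N : ℕ
  m : ℕ
  Lq : ℕ
  Cmin : ℝ
  Cmax : ℝ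

/-- Time step. -/
def Data.τ (D : Data d) (P : Params) : ℝ := D.T / P.N

/-- Mesh size. -/
def Data.h (D : Data d) (P : Params) : ℝ := D.L / (2 * P.m)

/-- Range step. -/
def Params.q (P : Params) : ℝ := (P.Cmax - P.Cmin) / P.Lq

/-- The quantization levels. -/
def Params.level (P : Params) (i : ℕ) : ℝ := P.Cmax - i * P.q

/-- `ι` assigns to each real number the index of a nearest quantization level. -/
def Params.IsNearest (P : Params) (ι : ℝ → ℕ) : Prop :=
  ∀ ρ : ℝ, ι ρ ≤ P.Lq ∧ ∀ i ≤ P.Lq, |ρ - P.level (ι ρ)| ≤ |ρ - P.level i|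

/-- The periodized cell averages of the kernel. -/
def Data.wh (D : Data d) (P : Params) : (Fin d → ℤ) → ℝ :=
  periodize P.m (cellAvg (D.h P) D.w)

/-- The periodized cell averages of the initial datum. -/
def Data.u₀h (D : Data d) (P : Params) : (Fin d → ℤ) → ℝ :=
  periodize P.m (cellAvg (D.h P) D.u₀)

/-- The periodized space-time averages of the reaction on `[t_n, t_{n+1}) × Ω_j`. -/
def Data.fh (D : Data d) (P : Params) (n : ℕ) (j : Fin d → ℤ) (s : ℝ) : ℝ :=
  periodize P.m (fun k => 1 / (D.τ P * D.h P ^ d) *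
    ∫ z in Ico (n * D.τ P) ((n + 1) * D.τ P) ×ˢ cell (D.h P) k, D.f z.1 z.2 s) j

/-- The slice of level `i`: the discrete circular convolution (weighted by the cell volume) of
the averaged kernel with `H^i(v) = B(v - q_i)`, evaluated by discrete Fourier transforms. -/
def Data.slice (D : Data d) (B : ℝ → ℝ) (P : Params) (i : ℕ) (v : (Fin d → ℤ) → ℝ)
    (j : Fin d → ℤ) : ℝ :=
  D.h P ^ d * (idft (D.ext.halfPeriod P.m) (fun k =>
    dft (D.ext.halfPeriod P.m) (pad P.m (D.wh P)) k *
      dft (D.ext.halfPeriod P.m) (pad P.m fun l => B (v l - P.level i)) k) j).re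

/-- The scheme `u^n[j]` with range kernel `B`; only indices `j ∈ grid d m` are relevant. -/
def Data.scheme (D : Data d) (B : ℝ → ℝ) (P : Params) (ι : ℝ → ℕ) : ℕ → (Fin d → ℤ) → ℝ
  | 0 => D.u₀h P
  | n + 1 => fun j =>
      let v := D.scheme B P ι n
      v j + D.τ P * (D.slice B P (ι (v j)) v j + D.fh P n j (v j))

/-- The piecewise constant interpolator: equal to `u^n[j]` on `[t_n, t_{n+1}) × Ω_j`. -/
def Data.approx (D : Data d) (B : ℝ → ℝ) (P : Params) (ι : ℝ → ℕ) (t : ℝ)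
    (x : Fin d → ℝ) : ℝ :=
  D.scheme B P ι ⌊t / D.τ P⌋₊ fun i => ⌈x i / D.h P⌉

end

end NonlocalFFT

namespace NonlocalFFT

noncomputable section

/-! ### Translations of functions of bounded variation -/

section BV

variable {E : Type*} [NormedAddCommGroup E] [NormedSpace ℝ E] [FiniteDimensional ℝ E]

/-! The error at time `t_n` is measured by `Data.meshError`, the sum over the cells of the absolute
difference between the integral of `u(t_n)` over the cell and `h ^ d` times the discrete value.
Since `u` is Lipschitz in time and bounded in BV, this quantity controls the `L¹`-distance at all
times of the step up to `O(τ + h)` (`Data.IsSolution.integral_abs_sub_le`). It therefore suffices to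
integrate the equation over a time step and a cell, subtract the scheme, and show that the mesh
error `E_n` satisfies `E_{n+1} ≤ E_n + τ (a E_n + c (τ + h + q))`; the discrete Gronwall inequality
then finishes the proof.

Four sources of error enter the recursion.

Kernel. By the discrete convolution theorem a slice is a circular convolution with the padded mesh
kernel (`Data.slice_eq`). Duality with vector fields shows that translations of a BV function are
Lipschitz in `L¹` (`VariationLE.integral_translate_le`). Hence replacing `x - y` by a difference of
cell indices costs `O(h)` after summation over the cells containing `x`, uniformly in `y`
(`Data.Admissible.exists_sum_abs_setIntegral_sub_wPad_le`). Across the faces of the cube the BV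
bound says nothing: there a bounded kernel is estimated on a boundary layer of volume `O(h)`, while
a compactly supported one vanishes near the faces.

Range kernel. `B` is Lipschitz on bounded sets, and a bound on the integrals of the kernel in each
variable turns the pointwise Lipschitz estimate into an `L¹` estimate
(`Data.sum_abs_nonlocal_sub_le`).

Quantization. Using `q_i` instead of the discrete value `U j` costs their distance. `U j` may lie
outside the range interval, but the cell mean of `u` lies inside, so the distance is at most that of
`U j` to the cell mean plus `q / 2`. Summation gives `E_n + O(q)`
(`Data.IsSolution.sum_abs_sub_level_le`).

Periodized averages. They change values on boundary cells only, which again fill a volume `O(h)`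
(`Data.sum_bdry_le`).

All constants require the discrete values to stay in a fixed compact set. Linear growth of `B` and
`f` gives the bound `X (1 + q)` (`Data.Admissible.exists_scheme_bound`). This suffices if `q ≤ 1`;
if `q > 1`, the same bound makes the error trivially `O(q)`. -/

lemma divergence_smul_const {Φ : E → ℝ} {x : E} (hΦ : DifferentiableAt ℝ Φ x) (a : E) :
    divergence (fun y => Φ y • a) x = fderiv ℝ Φ x a := by
  have h : fderiv ℝ (fun y => Φ y • a) x = (fderiv ℝ Φ x).smulRight a :=
    (hΦ.hasFDerivAt.smul_const a).fderiv
  rw [divergence, h]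
  exact LinearMap.trace_smulRight (fderiv ℝ Φ x).toLinearMap a

/-- A smooth Urysohn function of a compact set in an open set. -/
lemma exists_contDiff_cutoff {K U : Set E} (hK : IsCompact K) (hU : IsOpen U) (hKU : K ⊆ U) :
    ∃ ψ : E → ℝ, ContDiff ℝ 1 ψ ∧ HasCompactSupport ψ ∧ tsupport ψ ⊆ U ∧
      (∀ x ∈ K, ψ x = 1) ∧ ∀ x, 0 ≤ ψ x ∧ ψ x ≤ 1 := by
  obtain ⟨K₁, hK₁, hKK₁, hK₁U⟩ := exists_compact_between hK hU hKU
  obtain ⟨f, hf0, hf1, hf⟩ := exists_contMDiffMap_zero_one_of_isClosed (n := 1)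
    (modelWithCornersSelf ℝ E) (s := (interior K₁)ᶜ) (t := K) isOpen_interior.isClosed_compl
    hK.isClosed (disjoint_left.2 fun x hx hxK => hx (hKK₁ hxK))
  have hsupp : Function.support f ⊆ K₁ := fun x hx => by
    by_contra h
    exact hx (hf0 fun h' => h (interior_subset h'))
  have hts : tsupport f ⊆ K₁ := closure_minimal hsupp hK₁.isClosed
  exact ⟨f, f.contMDiff.contDiff, HasCompactSupport.of_support_subset_isCompact hK₁ hsupp,
    hts.trans hK₁U, fun x hx => hf1 hx, fun x => hf x⟩

/-- The average of a test function along a segment. -/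
lemma contDiff_segmentAverage {ψ : E → ℝ} (hψ : ContDiff ℝ 1 ψ) (hc : HasCompactSupport ψ) (a : E) :
    ContDiff ℝ 1 (fun x => ∫ s in (0 : ℝ)..1, ψ (x - s • a)) ∧
    ∀ x, fderiv ℝ (fun x => ∫ s in (0 : ℝ)..1, ψ (x - s • a)) x a = ψ x - ψ (x - a) := by
  have hcont : Continuous (fderiv ℝ ψ) := hψ.continuous_fderiv one_ne_zero
  obtain ⟨C, hC⟩ := (hc.fderiv (𝕜 := ℝ)).exists_bound_of_continuous hcont
  have hD : ∀ x, HasFDerivAt (fun x => ∫ s in (0 : ℝ)..1, ψ (x - s • a))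
      (∫ s in (0 : ℝ)..1, fderiv ℝ ψ (x - s • a)) x := fun x => by
    refine intervalIntegral.hasFDerivAt_integral_of_dominated_of_fderiv_le (s := univ)
      (F := fun x s => ψ (x - s • a)) (F' := fun x s => fderiv ℝ ψ (x - s • a))
      (bound := fun _ => C) Filter.univ_mem ?_ ?_ ?_ ?_ ?_ ?_
    · refine Filter.Eventually.of_forall fun y => Continuous.aestronglyMeasurable ?_
      exact hψ.continuous.comp (by fun_prop)
    · exact (hψ.continuous.comp (by fun_prop)).intervalIntegrable _ _
    · exact (hcont.comp (by fun_prop : Continuous fun s : ℝ => x - s • a)).aestronglyMeasurable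
    · exact Filter.Eventually.of_forall fun s _ y _ => hC _
    · exact intervalIntegrable_const
    · refine Filter.Eventually.of_forall fun s _ y _ => ?_
      exact (hψ.differentiable one_ne_zero (y - s • a)).hasFDerivAt.comp y
        ((hasFDerivAt_id y).sub_const (s • a))
  have hcD : Continuous fun x => ∫ s in (0 : ℝ)..1, fderiv ℝ ψ (x - s • a) :=
    intervalIntegral.continuous_parametric_intervalIntegral_of_continuous'
      (by exact hcont.comp (by fun_prop)) 0 1
  have hfd : fderiv ℝ (fun x => ∫ s in (0 : ℝ)..1, ψ (x - s • a)) =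
      fun x => ∫ s in (0 : ℝ)..1, fderiv ℝ ψ (x - s • a) := funext fun x => (hD x).fderiv
  refine ⟨contDiff_one_iff_fderiv.2 ⟨fun x => (hD x).differentiableAt, hfd ▸ hcD⟩, fun x => ?_⟩
  rw [hfd]
  -- The derivative of the average in direction `a` is the integral of `-d/ds ψ (x - s • a)`, so it
  -- telescopes to `ψ x - ψ (x - a)`.
  have hline : ∀ s : ℝ, HasDerivAt (fun s : ℝ => ψ (x - s • a)) (-(fderiv ℝ ψ (x - s • a) a)) s :=
    fun s => by
      have h1 : HasDerivAt (fun s : ℝ => x - s • a) (-((1 : ℝ) • a)) s :=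
        ((hasDerivAt_id s).smul_const a).const_sub x
      have : HasDerivAt (fun s : ℝ => ψ (x - s • a)) (fderiv ℝ ψ (x - s • a) (-((1 : ℝ) • a))) s :=
        (hψ.differentiable one_ne_zero (x - s • a)).hasFDerivAt.comp_hasDerivAt s h1
      simpa using this
  have hcl : Continuous fun s : ℝ => fderiv ℝ ψ (x - s • a) := hcont.comp (by fun_prop)
  have hftc := intervalIntegral.integral_eq_sub_of_hasDerivAt (a := 0) (b := 1)
    (fun s _ => hline s) ((hcl.clm_apply continuous_const).neg.intervalIntegrable _ _)
  rw [ContinuousLinearMap.intervalIntegral_apply (hcl.intervalIntegrable _ _)]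
  rw [intervalIntegral.integral_neg] at hftc
  simp only [one_smul, zero_smul, sub_zero] at hftc
  linarith

variable [MeasurableSpace E] [BorelSpace E]

/-- The `L¹`-norm on an open set is bounded by duality with test functions. -/
lemma integral_abs_le_of_forall_contDiff {μ : Measure E} {U : Set E} (hU : IsOpen U) {g : E → ℝ}
    (hg : IntegrableOn g U μ) {M : ℝ}
    (h : ∀ ψ : E → ℝ, ContDiff ℝ 1 ψ → HasCompactSupport ψ → tsupport ψ ⊆ U → (∀ x, |ψ x| ≤ 1) →
      ∫ x in U, g x * ψ x ∂μ ≤ M) :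
    ∫ x in U, |g x| ∂μ ≤ M := by
  wlog hm : Measurable g generalizing g
  · have hgm := hg.aestronglyMeasurable.aemeasurable
    have hae := hgm.ae_eq_mk
    have := this (g := hgm.mk g) (hg.congr hae) (fun ψ h1 h2 h3 h4 => by
      refine le_of_eq_of_le (integral_congr_ae ?_) (h ψ h1 h2 h3 h4)
      filter_upwards [hae] with x hx using by rw [hx]) hgm.measurable_mk
    refine le_of_eq_of_le (integral_congr_ae ?_) this
    filter_upwards [hae] with x hx using by rw [hx]
  refine le_of_forall_pos_le_add fun ε hε => ?_
  -- Inner regularity is applied to the finite measure `|g| μ` on `U`, so that the parts of `{g >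
  -- 0}` and `{g < 0}` missed by compact sets carry little of the integral of `|g|`.
  set ν : Measure E := (μ.restrict U).withDensity fun x => ‖g x‖ₑ with hν
  have : IsFiniteMeasure ν := isFiniteMeasure_withDensity hg.2.ne
  have hP : MeasurableSet (U ∩ {x | 0 < g x}) :=
    hU.measurableSet.inter (measurableSet_lt measurable_const hm)
  have hP' : MeasurableSet (U ∩ {x | g x < 0}) :=
    hU.measurableSet.inter (measurableSet_lt hm measurable_const)
  have hε' : ENNReal.ofReal (ε / 4) ≠ 0 := by simpa using by positivity
  obtain ⟨K, hKP, hK, hKν⟩ := hP.exists_isCompact_sdiff_lt (μ := ν) (measure_ne_top _ _) hε'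
  obtain ⟨K', hKP', hK', hKν'⟩ := hP'.exists_isCompact_sdiff_lt (μ := ν) (measure_ne_top _ _) hε'
  have hdisj : Disjoint K K' := disjoint_left.2 fun x hx hx' =>
    lt_asymm (show 0 < g x from (hKP hx).2) (hKP' hx').2
  -- Each cutoff is supported away from the other compact set; thus `ψ - χ` is exactly the sign of
  -- `g` on `K ∪ K'`.
  obtain ⟨ψ, hψ, hψc, hψs, hψ1, hψb⟩ := exists_contDiff_cutoff hK (U := U \ K')
    (hU.sdiff hK'.isClosed) fun x hx => ⟨(hKP hx).1, disjoint_left.1 hdisj hx⟩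
  obtain ⟨χ, hχ, hχc, hχs, hχ1, hχb⟩ := exists_contDiff_cutoff hK' (U := U \ K)
    (hU.sdiff hK.isClosed) fun x hx => ⟨(hKP' hx).1, disjoint_right.1 hdisj hx⟩
  have hψ0 : ∀ x ∈ K', ψ x = 0 := fun x hx => by
    by_contra h0
    exact (hψs (subset_tsupport _ h0)).2 hx
  have hχ0 : ∀ x ∈ K, χ x = 0 := fun x hx => by
    by_contra h0
    exact (hχs (subset_tsupport _ h0)).2 hx
  have hb : ∀ x, |ψ x - χ x| ≤ 1 := fun x => by
    rw [abs_le]; constructor <;> linarith [(hψb x).1, (hψb x).2, (hχb x).1, (hχb x).2]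
  have hle := h (fun x => ψ x - χ x) (hψ.sub hχ) (hψc.sub hχc)
    ((tsupport_sub _ _).trans (union_subset (hψs.trans sdiff_subset) (hχs.trans sdiff_subset))) hb
  set S := (U ∩ {x | 0 < g x}) \ K ∪ (U ∩ {x | g x < 0}) \ K' with hS
  have hSm : MeasurableSet S :=
    (hP.diff hK.measurableSet).union (hP'.diff hK'.measurableSet)
  have hSν : ν S ≤ ENNReal.ofReal (ε / 2) := by
    refine (measure_union_le _ _).trans ((add_le_add hKν.le hKν'.le).trans ?_)
    rw [← ENNReal.ofReal_add (by positivity) (by positivity)]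
    exact ENNReal.ofReal_le_ofReal (by linarith)
  have hSi : ∫ x in U, S.indicator (fun x => |g x|) x ∂μ ≤ ε / 2 := by
    rw [integral_indicator hSm]
    rw [withDensity_apply _ hSm] at hSν
    rw [← ENNReal.ofReal_le_ofReal_iff (by positivity), ofReal_integral_eq_lintegral_ofReal]
    · refine le_of_eq_of_le ?_ hSν
      simp only [Real.enorm_eq_ofReal_abs]
    · exact hg.abs.integrableOn
    · exact Filter.Eventually.of_forall fun x => abs_nonneg _
  have hint : IntegrableOn (fun x => g x * (ψ x - χ x)) U μ := by
    refine Integrable.mul_bdd (c := 1) hg ?_ ?_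
    · exact (hψ.continuous.sub hχ.continuous).aestronglyMeasurable
    · exact Filter.Eventually.of_forall hb
  -- Off `S` the test function is the sign of `g` or `g` vanishes; on `S` the loss is at most `2
  -- |g|`, which integrates to at most `ε`.
  have hmain : ∫ x in U, |g x| ∂μ ≤
      ∫ x in U, (g x * (ψ x - χ x) + 2 * S.indicator (fun x => |g x|) x) ∂μ := by
    refine setIntegral_mono_on hg.abs (hint.add ((hg.abs.indicator hSm).const_mul 2))
      hU.measurableSet fun x hx => ?_
    by_cases hxS : x ∈ S
    · rw [indicator_of_mem hxS]
      have : |g x * (ψ x - χ x)| ≤ |g x| := by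
        rw [abs_mul]; exact mul_le_of_le_one_right (abs_nonneg _) (hb x)
      linarith [neg_le_of_abs_le this]
    · rw [indicator_of_notMem hxS]
      rcases lt_trichotomy (g x) 0 with hx0 | hx0 | hx0
      · have : x ∈ K' := by
          by_contra hn
          exact hxS (Or.inr ⟨⟨hx, hx0⟩, hn⟩)
        rw [hχ1 x this, hψ0 x this, abs_of_neg hx0]; linarith
      · simp [hx0]
      · have : x ∈ K := by
          by_contra hn
          exact hxS (Or.inl ⟨⟨hx, hx0⟩, hn⟩)
        rw [hψ1 x this, hχ0 x this, abs_of_pos hx0]; linarith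
  rw [integral_add hint ((hg.abs.indicator hSm).const_mul 2), integral_const_mul] at hmain
  linarith

/-- Translations of a function of bounded variation are Lipschitz continuous in `L¹`. -/
lemma VariationLE.integral_translate_le {E : Type*} [NormedAddCommGroup E] [NormedSpace ℝ E]
    [FiniteDimensional ℝ E] [MeasureSpace E] [BorelSpace E]
    [(volume : Measure E).IsAddHaarMeasure] {U : Set E} (hU : IsOpen U)
    (hconv : Convex ℝ U) {v : E → ℝ} (hv : IntegrableOn v U) {M : ℝ} (hM : VariationLE U v M)
    (a : E) : ∫ x in U ∩ {x | x + a ∈ U}, |v (x + a) - v x| ≤ M * ‖a‖ := by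
  rcases eq_or_ne a 0 with rfl | ha
  · simp
  have hapos : 0 < ‖a‖ := norm_pos_iff.2 ha
  have hVo : IsOpen {x | x + a ∈ U} := hU.preimage (continuous_add_const a)
  set V := U ∩ {x | x + a ∈ U} with hV
  have hva : IntegrableOn (fun x => v (x + a)) {x | x + a ∈ U} :=
    ((measurePreserving_add_right volume a).integrableOn_comp_preimage
      (measurableEmbedding_addRight a)).2 hv
  refine integral_abs_le_of_forall_contDiff (U := V) (g := fun x => v (x + a) - v x)
    (hU.inter hVo) ((hva.mono_set inter_subset_right).sub (hv.mono_set inter_subset_left))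
    fun ψ hψ hc hs hb => ?_
  obtain ⟨hΦ, hΦa⟩ := contDiff_segmentAverage hψ hc a
  set Φ : E → ℝ := fun x => ∫ s in (0 : ℝ)..1, ψ (x - s • a) with hΦdef
  -- `K` is the set swept out by the support of `ψ` along the segment from `0` to `a`. It contains
  -- the support of `Φ`, and convexity keeps it in `U` because both `x` and `x + a` lie in `U` for
  -- `x` in the support of `ψ`.
  have hK : IsCompact ((fun p : E × ℝ => p.1 + p.2 • a) '' (tsupport ψ ×ˢ Icc (0 : ℝ) 1)) :=
    (hc.isCompact.prod isCompact_Icc).image (by fun_prop)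
  set K := (fun p : E × ℝ => p.1 + p.2 • a) '' (tsupport ψ ×ˢ Icc (0 : ℝ) 1) with hKdef
  have hKU : K ⊆ U := by
    rintro _ ⟨⟨x, s⟩, ⟨hx, hs0, hs1⟩, rfl⟩
    have hxV := hs hx
    have := hconv hxV.1 hxV.2 (sub_nonneg.2 hs1) hs0 (by ring)
    convert this using 1
    simp only
    module
  have hΦK : ∀ x ∉ K, Φ x = 0 := fun x hx => by
    rw [hΦdef]
    refine intervalIntegral.integral_zero_ae (Filter.Eventually.of_forall fun s hs' => ?_)
    by_contra h0
    rw [uIoc_of_le zero_le_one] at hs'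
    exact hx ⟨(x - s • a, s), ⟨subset_tsupport _ h0, hs'.1.le, hs'.2⟩, by simp⟩
  have hΦb : ∀ x, |Φ x| ≤ 1 := fun x => by
    have := intervalIntegral.norm_integral_le_of_norm_le_const (a := 0) (b := 1) (C := 1)
      (f := fun s : ℝ => ψ (x - s • a)) fun s _ => hb _
    simpa using this
  have hφs : Function.support (fun x => (-(‖a‖⁻¹ * Φ x)) • a) ⊆ K := fun x hx => by
    by_contra h
    exact hx (by simp [hΦK x h])
  -- The field `-Φ a / ‖a‖` has norm at most one, and its divergence is the difference quotient `(ψ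
  -- (x - a) - ψ x) / ‖a‖`. After the change of variables `h1` this is the required pairing.
  have hφ := hM (fun x => (-(‖a‖⁻¹ * Φ x)) • a) ((contDiff_const.mul hΦ).neg.smul contDiff_const)
    (HasCompactSupport.of_support_subset_isCompact hK hφs)
    ((closure_minimal hφs hK.isClosed).trans hKU) fun x => by
      rw [norm_smul, norm_neg, norm_mul, norm_inv, norm_norm, Real.norm_eq_abs, mul_comm,
        ← mul_assoc, mul_inv_cancel₀ hapos.ne', one_mul]
      exact hΦb x
  have hdiv : ∀ x, divergence (fun x => (-(‖a‖⁻¹ * Φ x)) • a) x =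
      ‖a‖⁻¹ * (ψ (x - a) - ψ x) := fun x => by
    have hd : DifferentiableAt ℝ Φ x := hΦ.differentiable one_ne_zero x
    have hd' : HasFDerivAt (fun x => -(‖a‖⁻¹ * Φ x)) (-(‖a‖⁻¹ • fderiv ℝ Φ x)) x :=
      (hd.hasFDerivAt.const_mul _).neg
    rw [divergence_smul_const hd'.differentiableAt, hd'.fderiv]
    simp only [neg_apply, smul_apply, smul_eq_mul, hΦa x]
    ring
  have hψV : ∀ x ∉ V, ψ x = 0 := fun x hx => by
    by_contra h0
    exact hx (hs (subset_tsupport _ h0))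
  have hbd : ∀ {g : E → E}, Continuous g → ∀ {S : Set E} {w : E → ℝ}, IntegrableOn w S →
      IntegrableOn (fun x => w x * ψ (g x)) S := fun hg S w hw =>
    Integrable.mul_bdd (c := 1) hw (hψ.continuous.comp hg).aestronglyMeasurable
      (Filter.Eventually.of_forall fun x => hb _)
  have h1 : ∫ x in V, v (x + a) * ψ x = ∫ x in U, v x * ψ (x - a) := by
    have : ∫ x in V, v (x + a) * ψ x = ∫ x in {x | x + a ∈ U}, v (x + a) * ψ (x + a - a) := by
      simp only [add_sub_cancel_right]
      refine (setIntegral_eq_of_subset_of_forall_sdiff_eq_zero hVo.measurableSet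
        inter_subset_right fun x hx => ?_).symm
      rw [hψV x hx.2, mul_zero]
    rw [this]
    exact (measurePreserving_add_right volume a).setIntegral_preimage_emb
      (measurableEmbedding_addRight a) (fun x => v x * ψ (x - a)) U
  have h2 : ∫ x in V, v x * ψ x = ∫ x in U, v x * ψ x :=
    (setIntegral_eq_of_subset_of_forall_sdiff_eq_zero hU.measurableSet
        inter_subset_left fun x hx => by rw [hψV x hx.2, mul_zero]).symm
  have h3 : ∫ x in V, (v (x + a) - v x) * ψ x = ∫ x in U, v x * (ψ (x - a) - ψ x) := by
    simp only [sub_mul, mul_sub]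
    rw [integral_sub (hbd (g := fun x => x) continuous_id (hva.mono_set inter_subset_right))
      (hbd (g := fun x => x) continuous_id (hv.mono_set inter_subset_left)),
      integral_sub (hbd (by fun_prop) hv) (hbd (g := fun x => x) continuous_id hv), ← h1, ← h2]
  have h4 : ∫ x in U, v x * divergence (fun x => (-(‖a‖⁻¹ * Φ x)) • a) x =
      ‖a‖⁻¹ * ∫ x in U, v x * (ψ (x - a) - ψ x) := by
    rw [← integral_const_mul]
    exact integral_congr_ae (Filter.Eventually.of_forall fun x => by simp only [hdiv]; ring)
  rw [h4, inv_mul_le_iff₀ hapos] at hφ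
  rw [h3]
  linarith

end BV

/-! ### The discrete convolution theorem -/

section DFT

variable {d : ℕ}

/-- The representative of `a` modulo `2p` in `(-p, p]`. -/
def wrap (p : ℕ) (a : ℤ) : ℤ := (a + p - 1) % (2 * p) - p + 1

lemma wrap_mem {p : ℕ} (hp : 1 ≤ p) (a : ℤ) : wrap p a ∈ Finset.Ioc (-(p : ℤ)) p := by
  have h1 := Int.emod_nonneg (a + p - 1) (b := 2 * p) (by lia)
  have h2 := Int.emod_lt_of_pos (a + p - 1) (b := 2 * p) (by lia)
  rw [Finset.mem_Ioc, wrap]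
  constructor <;> lia

lemma dvd_sub_wrap (p : ℕ) (a : ℤ) : (2 * p : ℤ) ∣ a - wrap p a := by
  have := Int.dvd_self_sub_emod (x := a + p - 1) (m := 2 * p)
  rw [wrap]
  convert this using 1
  ring

lemma eq_of_dvd_sub {p : ℕ} {a b : ℤ} (ha : a ∈ Finset.Ioc (-(p : ℤ)) p)
    (hb : b ∈ Finset.Ioc (-(p : ℤ)) p) (h : (2 * p : ℤ) ∣ a - b) : a = b := by
  rw [Finset.mem_Ioc] at ha hb
  by_contra hne
  have h1 := Int.le_of_dvd (abs_pos.2 (sub_ne_zero.2 hne)) ((dvd_abs _ _).2 h)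
  have h2 : |a - b| < 2 * p := by rw [abs_lt]; constructor <;> lia
  lia

lemma eq_wrap_iff {p : ℕ} (hp : 1 ≤ p) {a b : ℤ} (hb : b ∈ Finset.Ioc (-(p : ℤ)) p) :
    b = wrap p a ↔ (2 * p : ℤ) ∣ a - b := by
  refine ⟨fun h => h ▸ dvd_sub_wrap p a, fun h => eq_of_dvd_sub hb (wrap_mem hp a) ?_⟩
  have := dvd_sub (dvd_sub_wrap p a) h
  rwa [sub_sub_sub_cancel_left] at this

/-- The representative of a multi-index in `grid d p`. -/
def wrapIdx (p : ℕ) (l : Fin d → ℤ) : Fin d → ℤ := fun i => wrap p (l i)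

lemma mem_grid {p : ℕ} {j : Fin d → ℤ} : j ∈ grid d p ↔ ∀ i, j i ∈ Finset.Ioc (-(p : ℤ)) p :=
  Fintype.mem_piFinset

lemma wrapIdx_mem {p : ℕ} (hp : 1 ≤ p) (l : Fin d → ℤ) : wrapIdx p l ∈ grid d p :=
  mem_grid.2 fun i => wrap_mem hp (l i)

lemma card_grid (p : ℕ) : (grid d p).card = (2 * p) ^ d := by
  rw [grid, Fintype.card_piFinset]
  simp only [Int.card_Ioc, Finset.prod_const, Finset.card_univ, Fintype.card_fin]
  congr 1
  lia

lemma grid_mono {m p : ℕ} (h : m ≤ p) : grid d m ⊆ grid d p := fun j hj => mem_grid.2 fun i => by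
  have := mem_grid.1 hj i
  rw [Finset.mem_Ioc] at this ⊢
  constructor <;> lia

/-- The character `t ↦ exp (2 π i t / (2p))`. -/
def root (p : ℕ) (t : ℤ) : ℂ := Complex.exp (2 * Real.pi * Complex.I * t / (2 * p))

lemma root_add (p : ℕ) (s t : ℤ) : root p (s + t) = root p s * root p t := by
  rw [root, root, root, ← Complex.exp_add]
  push_cast
  ring_nf

lemma root_eq_one_iff {p : ℕ} (hp : 1 ≤ p) (t : ℤ) : root p t = 1 ↔ (2 * p : ℤ) ∣ t := by
  have hp' : (2 * p : ℂ) ≠ 0 := by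
    have : (p : ℂ) ≠ 0 := by exact_mod_cast (by lia : p ≠ 0)
    simp [this]
  rw [root, Complex.exp_eq_one_iff]
  refine exists_congr fun n => ?_
  rw [div_eq_iff hp', ← @Int.cast_inj ℂ]
  have h2 : (2 * Real.pi * Complex.I : ℂ) ≠ 0 := Complex.two_pi_I_ne_zero
  push_cast
  constructor
  · intro h
    refine mul_left_cancel₀ h2 ?_
    rw [h]; ring
  · intro h
    rw [h]; ring

lemma root_nat_mul (p : ℕ) (n : ℕ) (t : ℤ) : root p (n * t) = root p t ^ n := by
  rw [root, root, ← Complex.exp_nat_mul]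
  push_cast
  ring_nf

/-- Shifting the index to `0, …, 2p - 1` gives a geometric sum with ratio `root p t`, a `2p`-th root
of unity; it vanishes unless the ratio is one. -/
lemma sum_root {p : ℕ} (hp : 1 ≤ p) (t : ℤ) :
    ∑ k ∈ Finset.Ioc (-(p : ℤ)) p, root p (k * t) = if (2 * p : ℤ) ∣ t then (2 * p : ℂ) else 0 := by
  have hre : ∑ k ∈ Finset.Ioc (-(p : ℤ)) p, root p (k * t) =
      ∑ n ∈ Finset.range (2 * p), root p ((1 - p) * t) * root p t ^ n := by
    refine Finset.sum_bij' (fun k _ => (k + p - 1).toNat) (fun n _ => (n : ℤ) - p + 1) ?_ ?_ ?_ ?_ ?_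
    · intro k hk; rw [Finset.mem_Ioc] at hk; rw [Finset.mem_range]; lia
    · intro n hn; rw [Finset.mem_range] at hn; rw [Finset.mem_Ioc]; lia
    · intro k hk; rw [Finset.mem_Ioc] at hk; lia
    · intro n hn; lia
    · intro k hk
      rw [Finset.mem_Ioc] at hk
      rw [← root_nat_mul, ← root_add]
      congr 1
      have : ((k + p - 1).toNat : ℤ) = k + p - 1 := Int.toNat_of_nonneg (by lia)
      rw [this]; ring
  rw [hre, ← Finset.mul_sum]
  split_ifs with h
  · have h1 := (root_eq_one_iff hp t).2 h
    have h2 := (root_eq_one_iff hp ((1 - p) * t)).2 (h.mul_left _)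
    simp [h1, h2]
  · have h1 : root p t ≠ 1 := fun h' => h ((root_eq_one_iff hp t).1 h')
    have h2 : root p ((2 * p : ℕ) * t) = 1 :=
      (root_eq_one_iff hp _).2 (by push_cast; exact dvd_mul_right _ _)
    rw [geom_sum_eq h1, ← root_nat_mul, h2]
    simp

lemma root_sum (p : ℕ) (l : Fin d → ℤ) : root p (∑ i, l i) = ∏ i, root p (l i) := by
  simp only [root, ← Complex.exp_sum]
  push_cast
  rw [Finset.mul_sum, Finset.sum_div]

lemma sum_grid_root {p : ℕ} (hp : 1 ≤ p) (l : Fin d → ℤ) :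
    ∑ k ∈ grid d p, root p (∑ i, k i * l i) =
      if ∀ i, (2 * p : ℤ) ∣ l i then ((2 * p : ℂ)) ^ d else 0 := by
  simp only [root_sum]
  rw [grid, ← Finset.prod_univ_sum (fun _ => Finset.Ioc (-(p : ℤ)) p) fun i k => root p (k * l i)]
  simp only [sum_root hp]
  split_ifs with h
  · simp [h]
  · push Not at h
    obtain ⟨i, hi⟩ := h
    exact Finset.prod_eq_zero (Finset.mem_univ i) (by simp [hi])

lemma dft_eq (p : ℕ) (g : (Fin d → ℤ) → ℂ) (k : Fin d → ℤ) :
    dft p g k = ∑ j ∈ grid d p, root p (∑ i, k i * -j i) * g j := by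
  refine Finset.sum_congr rfl fun j _ => ?_
  rw [root]
  congr 2
  push_cast
  simp only [mul_comm (k _ : ℂ), neg_mul, Finset.sum_neg_distrib, mul_neg, neg_div]

lemma idft_eq (p : ℕ) (g : (Fin d → ℤ) → ℂ) (j : Fin d → ℤ) :
    idft p g j = ((2 * p : ℂ) ^ d)⁻¹ * ∑ k ∈ grid d p, root p (∑ i, k i * j i) * g k := by
  rw [idft]
  congr 1
  refine Finset.sum_congr rfl fun k _ => ?_
  rw [root]
  congr 2
  push_cast
  simp only [mul_comm (k _ : ℂ)]

/-- The inverse transform of a product of transforms is the circular convolution. -/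
lemma idft_mul_dft {p : ℕ} (hp : 1 ≤ p) (g g' : (Fin d → ℤ) → ℂ) (j : Fin d → ℤ) :
    idft p (fun k => dft p g k * dft p g' k) j =
      ∑ b ∈ grid d p, g (wrapIdx p (j - b)) * g' b := by
  have hp' : ((2 * p : ℂ)) ^ d ≠ 0 := by
    have : (p : ℂ) ≠ 0 := by exact_mod_cast (by lia : p ≠ 0)
    simp [this]
  have key : ∀ k : Fin d → ℤ, root p (∑ i, k i * j i) * (dft p g k * dft p g' k) =
      ∑ b ∈ grid d p, ∑ a ∈ grid d p, root p (∑ i, k i * (j - b - a) i) * (g a * g' b) := by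
    intro k
    rw [dft_eq, dft_eq, Finset.sum_mul_sum, Finset.mul_sum]
    simp only [Finset.mul_sum]
    rw [Finset.sum_comm]
    refine Finset.sum_congr rfl fun b _ => Finset.sum_congr rfl fun a _ => ?_
    have : ∑ i, k i * (j - b - a) i =
        ∑ i, k i * j i + (∑ i, k i * -a i + ∑ i, k i * -b i) := by
      rw [← Finset.sum_add_distrib, ← Finset.sum_add_distrib]
      refine Finset.sum_congr rfl fun i _ => ?_
      simp only [Pi.sub_apply]
      ring
    rw [this, root_add, root_add]
    ring
  rw [idft_eq, Finset.sum_congr rfl fun k _ => key k, Finset.sum_comm, Finset.mul_sum]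
  refine Finset.sum_congr rfl fun b _ => ?_
  rw [Finset.sum_comm]
  simp only [← Finset.sum_mul, sum_grid_root hp]
  -- By orthogonality of the characters only the `a` congruent to `j - b` modulo `2p` survives, and
  -- the grid contains exactly one such index.
  rw [Finset.sum_eq_single (wrapIdx p (j - b))]
  · rw [if_pos fun i => by exact dvd_sub_wrap p ((j - b) i)]
    field_simp
  · intro a ha hne
    rw [if_neg, zero_mul]
    intro h
    exact hne (funext fun i => (eq_wrap_iff hp (mem_grid.1 ha i)).2 (h i))
  · intro h
    exact absurd (wrapIdx_mem hp _) h

open Classical in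
/-- The averaged kernel, set to zero outside the grid. -/
def Data.wPad (D : Data d) (P : Params) (l : Fin d → ℤ) : ℝ :=
  if l ∈ grid d P.m then D.wh P l else 0

lemma Extension.le_halfPeriod (e : Extension) (m : ℕ) : m ≤ e.halfPeriod m := by
  cases e <;> simp only [Extension.halfPeriod] <;> lia

/-- Both factors are real and padded by zero, so the circular convolution of length `2p` reduces to
a real sum over the original mesh, with the wrap-around confined to the argument of the kernel. From
here on no Fourier transform is needed. -/
lemma Data.slice_eq (D : Data d) (B : ℝ → ℝ) {P : Params} (hm : 1 ≤ P.m) (i : ℕ)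
    (v : (Fin d → ℤ) → ℝ) (j : Fin d → ℤ) :
    D.slice B P i v j = D.h P ^ d * ∑ k ∈ grid d P.m,
      D.wPad P (wrapIdx (D.ext.halfPeriod P.m) (j - k)) * B (v k - P.level i) := by
  have hle := D.ext.le_halfPeriod P.m
  rw [Data.slice, idft_mul_dft (hm.trans hle)]
  congr 1
  rw [← Finset.sum_subset (grid_mono hle), Complex.re_sum]
  · refine Finset.sum_congr rfl fun k hk => ?_
    rw [pad, pad, if_pos hk, Data.wPad]
    split_ifs <;> simp
  · intro k _ hk
    rw [pad, pad, if_neg hk, mul_zero]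

end DFT

/-! ### Cells -/

section Mesh

variable {d : ℕ}

lemma mem_cell {h : ℝ} {j : Fin d → ℤ} {x : Fin d → ℝ} :
    x ∈ cell h j ↔ ∀ i, ((j i : ℝ) - 1) * h < x i ∧ x i < j i * h := by
  refine forall_congr' fun i => ?_
  rw [abs_lt]
  constructor <;> rintro ⟨h1, h2⟩ <;> constructor <;> linarith

lemma cell_eq_pi (h : ℝ) (j : Fin d → ℤ) :
    cell h j = Set.pi univ fun i => Ioo (((j i : ℝ) - 1) * h) (j i * h) := by
  ext x
  simp [mem_cell, Set.mem_pi]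

lemma isOpen_cell (h : ℝ) (j : Fin d → ℤ) : IsOpen (cell h j) := by
  rw [cell_eq_pi]
  exact isOpen_set_pi finite_univ fun _ _ => isOpen_Ioo

lemma measurableSet_cell (h : ℝ) (j : Fin d → ℤ) : MeasurableSet (cell h j) :=
  (isOpen_cell h j).measurableSet

lemma volume_cell {h : ℝ} (hh : 0 < h) (j : Fin d → ℤ) :
    volume (cell h j) = ENNReal.ofReal (h ^ d) := by
  rw [cell_eq_pi, Real.volume_pi_Ioo]
  have : ∀ i, (j i : ℝ) * h - (j i - 1) * h = h := fun i => by ring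
  simp only [this, Finset.prod_const, Finset.card_univ, Fintype.card_fin]
  rw [ENNReal.ofReal_pow hh.le]

lemma volume_real_cell {h : ℝ} (hh : 0 < h) (j : Fin d → ℤ) :
    volume.real (cell h j) = h ^ d := by
  rw [Measure.real, volume_cell hh, ENNReal.toReal_ofReal (by positivity)]

lemma volume_cell_lt_top {h : ℝ} (hh : 0 < h) (j : Fin d → ℤ) : volume (cell h j) < ⊤ := by
  rw [volume_cell hh]; exact ENNReal.ofReal_lt_top

lemma ceil_of_mem_cell {h : ℝ} (hh : 0 < h) {j : Fin d → ℤ} {x : Fin d → ℝ} (hx : x ∈ cell h j) :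
    (fun i => ⌈x i / h⌉) = j := by
  funext i
  obtain ⟨h1, h2⟩ := mem_cell.1 hx i
  rw [Int.ceil_eq_iff, lt_div_iff₀ hh, div_le_iff₀ hh]
  exact ⟨h1, h2.le⟩

lemma disjoint_cell {h : ℝ} (hh : 0 < h) {j k : Fin d → ℤ} (hjk : j ≠ k) :
    Disjoint (cell h j) (cell h k) :=
  disjoint_left.2 fun _ hx hx' => hjk ((ceil_of_mem_cell hh hx).symm.trans (ceil_of_mem_cell hh hx'))

lemma isOpen_cube (d : ℕ) (L : ℝ) : IsOpen (cube d L) := by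
  have : cube d L = Set.pi univ fun _ => Ioo (-(L / 2)) (L / 2) := by
    ext x; simp [cube, Set.mem_pi]
  rw [this]
  exact isOpen_set_pi finite_univ fun _ _ => isOpen_Ioo

lemma convex_cube (d : ℕ) (L : ℝ) : Convex ℝ (cube d L) := by
  have : cube d L = Set.pi univ fun _ => Ioo (-(L / 2)) (L / 2) := by
    ext x; simp [cube, Set.mem_pi]
  rw [this]
  exact convex_pi fun _ _ => convex_Ioo _ _

lemma volume_cube (d : ℕ) (L : ℝ) : volume (cube d L) = ENNReal.ofReal L ^ d := by
  have : cube d L = Set.pi univ fun _ => Ioo (-(L / 2)) (L / 2) := by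
    ext x; simp [cube, Set.mem_pi]
  rw [this, Real.volume_pi_Ioo]
  simp

lemma cell_subset_cube {h : ℝ} (hh : 0 < h) {p : ℕ} {j : Fin d → ℤ} (hj : j ∈ grid d p) :
    cell h j ⊆ cube d (2 * p * h) := fun x hx i => by
  obtain ⟨h1, h2⟩ := mem_cell.1 hx i
  obtain ⟨h3, h4⟩ := Finset.mem_Ioc.1 (mem_grid.1 hj i)
  have h5 : -(p : ℝ) ≤ j i - 1 := by exact_mod_cast (by lia : -(p : ℤ) ≤ j i - 1)
  have h6 : (j i : ℝ) ≤ p := by exact_mod_cast h4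
  constructor
  · nlinarith
  · nlinarith

lemma ceil_mem_grid {h : ℝ} (hh : 0 < h) {p : ℕ} {x : Fin d → ℝ} (hx : x ∈ cube d (2 * p * h)) :
    (fun i => ⌈x i / h⌉) ∈ grid d p := mem_grid.2 fun i => by
  obtain ⟨h1, h2⟩ := hx i
  rw [Finset.mem_Ioc]
  constructor
  · rw [Int.lt_ceil, lt_div_iff₀ hh]; push_cast; linarith
  · rw [Int.ceil_le, div_le_iff₀ hh]; push_cast; linarith

lemma ae_mem_cell_ceil {h : ℝ} (hh : 0 < h) :
    ∀ᵐ x : Fin d → ℝ, x ∈ cell h fun i => ⌈x i / h⌉ := by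
  have : ∀ᵐ x : Fin d → ℝ, ∀ i, ∀ n : ℤ, x i ≠ n * h := by
    rw [ae_all_iff]; intro i
    rw [ae_all_iff]; intro n
    rw [ae_iff]
    simp only [ne_eq, not_not]
    exact Measure.pi_hyperplane (fun _ : Fin d => (volume : Measure ℝ)) i (n * h)
  filter_upwards [this] with x hx
  rw [mem_cell]
  intro i
  have h1 := Int.ceil_lt_add_one (x i / h)
  have h2 := (div_le_iff₀ hh).1 (Int.le_ceil (x i / h))
  refine ⟨?_, lt_of_le_of_ne h2 (hx i _)⟩
  rw [← sub_lt_iff_lt_add, lt_div_iff₀ hh] at h1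
  exact h1

lemma cube_ae_eq {h : ℝ} (hh : 0 < h) (p : ℕ) :
    (cube d (2 * p * h) : Set (Fin d → ℝ)) =ᵐ[volume] ⋃ j ∈ grid d p, cell h j := by
  filter_upwards [ae_mem_cell_ceil hh] with x hx
  refine propext ⟨fun hx' => ?_, fun hx' => ?_⟩
  · exact mem_biUnion (t := fun j => cell h j) (ceil_mem_grid hh hx') hx
  · obtain ⟨j, hj, hxj⟩ := mem_iUnion₂.1 hx'
    exact cell_subset_cube hh hj hxj

lemma setIntegral_cube {h : ℝ} (hh : 0 < h) (p : ℕ) {g : (Fin d → ℝ) → ℝ}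
    (hg : IntegrableOn g (cube d (2 * p * h))) :
    ∫ x in cube d (2 * p * h), g x = ∑ j ∈ grid d p, ∫ x in cell h j, g x := by
  rw [setIntegral_congr_set (cube_ae_eq hh p), integral_biUnion_finset]
  · exact fun j _ => measurableSet_cell h j
  · exact fun j _ k _ hjk => disjoint_cell hh hjk
  · exact fun j hj => hg.mono_set (cell_subset_cube hh hj)

lemma setLIntegral_cube {h : ℝ} (hh : 0 < h) (p : ℕ) (g : (Fin d → ℝ) → ENNReal) :
    ∫⁻ x in cube d (2 * p * h), g x = ∑ j ∈ grid d p, ∫⁻ x in cell h j, g x := by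
  rw [setLIntegral_congr (cube_ae_eq hh p), lintegral_biUnion_finset]
  · exact fun j _ k _ hjk => disjoint_cell hh hjk
  · exact fun j _ => measurableSet_cell h j

lemma setIntegral_cell_translate (h : ℝ) (j l : Fin d → ℤ) (g : (Fin d → ℝ) → ℝ) :
    ∫ x in cell h j, g x = ∫ x in cell h l, g (x + fun i => ((j i : ℝ) - l i) * h) := by
  have := (measurePreserving_add_right (volume : Measure (Fin d → ℝ))
    (fun i => ((j i : ℝ) - l i) * h)).setIntegral_preimage_emb
    (measurableEmbedding_addRight _) g (cell h j)
  rw [← this]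
  congr 2
  ext x
  rw [mem_preimage, mem_cell, mem_cell]
  refine forall_congr' fun i => ?_
  simp only [Pi.add_apply]
  constructor <;> rintro ⟨h1, h2⟩ <;> constructor <;> linarith

lemma cellAvg_mul {h : ℝ} (hh : 0 < h) (v : (Fin d → ℝ) → ℝ) (j : Fin d → ℤ) :
    h ^ d * cellAvg h v j = ∫ x in cell h j, v x := by
  rw [cellAvg]
  field_simp

/-! ### The cells at the boundary -/

lemma mem_opposed {m : ℕ} {j k : Fin d → ℤ} :
    k ∈ opposed m j ↔ k ∈ grid d m ∧ ∀ i, k i = j i ∨ (IsEnd m (k i) ∧ IsEnd m (j i)) := by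
  simp only [opposed, Finset.mem_filter]

lemma self_mem_opposed {m : ℕ} {j : Fin d → ℤ} (hj : j ∈ grid d m) : j ∈ opposed m j :=
  mem_opposed.2 ⟨hj, fun _ => Or.inl rfl⟩

lemma mem_opposed_comm {m : ℕ} {j k : Fin d → ℤ} (hj : j ∈ grid d m) (hk : k ∈ grid d m) :
    k ∈ opposed m j ↔ j ∈ opposed m k := by
  rw [mem_opposed, mem_opposed]
  simp only [hj, hk, true_and]
  exact forall_congr' fun i => or_congr eq_comm and_comm

lemma opposed_eq {m : ℕ} {j k : Fin d → ℤ} (hk : k ∈ opposed m j) : opposed m k = opposed m j := by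
  ext l
  rw [mem_opposed, mem_opposed]
  have hk' := (mem_opposed.1 hk).2
  refine and_congr_right fun _ => forall_congr' fun i => ?_
  rcases hk' i with h | ⟨h1, h2⟩
  · rw [h]
  · constructor
    · rintro (h | ⟨h3, -⟩)
      · exact Or.inr ⟨h ▸ h1, h2⟩
      · exact Or.inr ⟨h3, h2⟩
    · rintro (h | ⟨h3, -⟩)
      · exact Or.inr ⟨h ▸ h2, h1⟩
      · exact Or.inr ⟨h3, h1⟩

/-- Being opposed is an equivalence relation on the grid, and averaging over the classes preserves
sums. This bounds the discrete `L¹`-norm of the periodized kernel by that of its cell averages. -/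
lemma sum_periodize (m : ℕ) (g : (Fin d → ℤ) → ℝ) :
    ∑ j ∈ grid d m, periodize m g j = ∑ j ∈ grid d m, g j := by
  classical
  have h1 : ∀ j ∈ grid d m, periodize m g j =
      ∑ k ∈ grid d m, if k ∈ opposed m j then g k / (opposed m k).card else 0 := fun j hj => by
    rw [periodize, Finset.sum_div, ← Finset.sum_filter]
    have : (grid d m).filter (fun k => k ∈ opposed m j) = opposed m j := by
      ext k
      rw [Finset.mem_filter]
      exact ⟨fun h => h.2, fun h => ⟨(mem_opposed.1 h).1, h⟩⟩
    rw [this]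
    exact Finset.sum_congr rfl fun k hk => by rw [opposed_eq hk]
  rw [Finset.sum_congr rfl h1, Finset.sum_comm]
  refine Finset.sum_congr rfl fun k hk => ?_
  rw [← Finset.sum_filter, Finset.sum_const, nsmul_eq_mul]
  have : (grid d m).filter (fun j => k ∈ opposed m j) = opposed m k := by
    ext j
    rw [Finset.mem_filter]
    exact ⟨fun h => (mem_opposed_comm h.1 hk).1 h.2,
      fun h => ⟨(mem_opposed.1 h).1, (mem_opposed_comm (mem_opposed.1 h).1 hk).2 h⟩⟩
  rw [this]
  have hc : ((opposed m k).card : ℝ) ≠ 0 := by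
    exact_mod_cast (Finset.card_pos.2 ⟨k, self_mem_opposed hk⟩).ne'
  field_simp

lemma abs_periodize_le (m : ℕ) (g : (Fin d → ℤ) → ℝ) (j : Fin d → ℤ) :
    |periodize m g j| ≤ periodize m (fun k => |g k|) j := by
  rw [periodize, periodize, abs_div, abs_of_nonneg (Nat.cast_nonneg (α := ℝ) _)]
  gcongr
  exact Finset.abs_sum_le_sum_abs _ _

lemma abs_periodize_le_of_forall {m : ℕ} {g : (Fin d → ℤ) → ℝ} {R : ℝ}
    (hg : ∀ k ∈ grid d m, |g k| ≤ R) {j : Fin d → ℤ} (hj : j ∈ grid d m) :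
    |periodize m g j| ≤ R := by
  refine (abs_periodize_le m g j).trans ?_
  have hc : (0 : ℝ) < (opposed m j).card := by
    exact_mod_cast Finset.card_pos.2 ⟨j, self_mem_opposed hj⟩
  rw [periodize, div_le_iff₀ hc, mul_comm, ← nsmul_eq_mul]
  exact Finset.sum_le_card_nsmul _ _ _ fun k hk => hg k (mem_opposed.1 hk).1

/-- The cell `j` touches the boundary of the cube. -/
def IsBdry (m : ℕ) (j : Fin d → ℤ) : Prop := ∃ i, IsEnd m (j i)

/-- The class of an interior cell is a singleton. Every error caused by periodization is thus a sum
over boundary cells. -/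
lemma periodize_of_not_isBdry {m : ℕ} {g : (Fin d → ℤ) → ℝ} {j : Fin d → ℤ} (hj : j ∈ grid d m)
    (hb : ¬ IsBdry m j) : periodize m g j = g j := by
  have : opposed m j = {j} := by
    ext k
    rw [mem_opposed, Finset.mem_singleton]
    refine ⟨fun h => funext fun i => (h.2 i).resolve_right fun h' => hb ⟨i, h'.2⟩, ?_⟩
    rintro rfl
    exact ⟨hj, fun _ => Or.inl rfl⟩
  simp [periodize, this]

open Classical in
/-- The indices of the cells at the boundary. -/
def bdry (d m : ℕ) : Finset (Fin d → ℤ) := (grid d m).filter (IsBdry m)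

/-- For each of the `d` directions, the coordinate in that direction takes one of two end values and
each of the others one of `2m` values. -/
lemma card_bdry_le (d m : ℕ) : (bdry d m).card ≤ d * (2 * (2 * m) ^ (d - 1)) := by
  classical
  have hsub : bdry d m ⊆ Finset.univ.biUnion fun i : Fin d => Fintype.piFinset fun i' =>
      if i' = i then ({1 - (m : ℤ), (m : ℤ)} : Finset ℤ) else Finset.Ioc (-(m : ℤ)) m := by
    intro j hj
    rw [bdry, Finset.mem_filter] at hj
    obtain ⟨hj, i, hi⟩ := hj
    rw [Finset.mem_biUnion]
    refine ⟨i, Finset.mem_univ i, Fintype.mem_piFinset.2 fun i' => ?_⟩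
    split_ifs with h
    · subst h
      simpa [IsEnd] using hi
    · exact mem_grid.1 hj i'
  refine (Finset.card_le_card hsub).trans (Finset.card_biUnion_le.trans ?_)
  refine (Finset.sum_le_card_nsmul _ _ (2 * (2 * m) ^ (d - 1)) fun i _ => ?_).trans (by simp)
  rw [Fintype.card_piFinset, ← Finset.mul_prod_erase _ _ (Finset.mem_univ i), if_pos rfl]
  refine Nat.mul_le_mul Finset.card_le_two (le_of_eq ?_)
  rw [Finset.prod_congr rfl (g := fun _ => 2 * m) fun i' hi' => ?_]
  · simp [Finset.card_erase_of_mem]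
  · rw [if_neg (Finset.ne_of_mem_erase hi'), Int.card_Ioc]
    lia

/-- The boundary layer has volume `O(h)`, with a constant depending only on the side length `2mh`
and on `d`. -/
lemma card_bdry_mul_le (hd : 1 ≤ d) (m : ℕ) {h : ℝ} (hh : 0 ≤ h) :
    ((bdry d m).card : ℝ) * h ^ d ≤ 2 * d * (2 * m * h) ^ (d - 1) * h := by
  have h1 : ((bdry d m).card : ℝ) ≤ d * (2 * (2 * m) ^ (d - 1)) := by
    exact_mod_cast card_bdry_le d m
  obtain ⟨e, rfl⟩ : ∃ e, d = e + 1 := ⟨d - 1, by lia⟩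
  calc _ ≤ ((e + 1 : ℕ) * (2 * (2 * m) ^ (e + 1 - 1)) : ℝ) * h ^ (e + 1) := by gcongr
    _ = _ := by
      simp only [Nat.add_sub_cancel, mul_pow, pow_succ]
      ring

lemma add_mem_cube_of_not_isBdry {m : ℕ} {h : ℝ} (hh : 0 < h) {j : Fin d → ℤ} (hj : j ∈ grid d m)
    (hb : ¬ IsBdry m j) {x v : Fin d → ℝ} (hx : x ∈ cell h j) (hv : ‖v‖ ≤ h) :
    x + v ∈ cube d (2 * m * h) := fun i => by
  obtain ⟨h1, h2⟩ := mem_cell.1 hx i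
  obtain ⟨h3, h4⟩ := Finset.mem_Ioc.1 (mem_grid.1 hj i)
  have h7 := abs_le.1 ((norm_le_pi_norm v i).trans hv)
  have h8 : j i ≠ 1 - (m : ℤ) := fun h' => hb ⟨i, Or.inl h'⟩
  have h9 : j i ≠ (m : ℤ) := fun h' => hb ⟨i, Or.inr h'⟩
  have h5 : -(m : ℝ) ≤ j i - 2 := by exact_mod_cast (by lia : -(m : ℤ) ≤ j i - 2)
  have h6 : (j i : ℝ) ≤ m - 1 := by exact_mod_cast (by lia : (j i : ℤ) ≤ m - 1)
  simp only [Pi.add_apply]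
  constructor
  · nlinarith
  · nlinarith

end Mesh

/-! ### Oscillation of functions of bounded variation on cells -/

section Oscillation

variable {d : ℕ}

lemma VariationLE.congr {E : Type*} [NormedAddCommGroup E] [NormedSpace ℝ E] [MeasureSpace E]
    {U : Set E} {v v' : E → ℝ} {M : ℝ} (h : VariationLE U v M)
    (hv : v =ᵐ[volume.restrict U] v') : VariationLE U v' M := fun φ h1 h2 h3 h4 => by
  refine le_of_eq_of_le (integral_congr_ae ?_) (h φ h1 h2 h3 h4)
  filter_upwards [hv] with x hx using by rw [hx]

lemma VariationLE.nonneg {E : Type*} [NormedAddCommGroup E] [NormedSpace ℝ E] [MeasureSpace E]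
    {U : Set E} {v : E → ℝ} {M : ℝ} (h : VariationLE U v M) : 0 ≤ M := by
  have := h (fun _ => 0) contDiff_const HasCompactSupport.zero (by simp) (by simp)
  have h0 : ∀ x : E, divergence (fun _ : E => (0 : E)) x = 0 := fun x => by
    simp [divergence]
  simpa [h0] using this

lemma VariationLE.lintegral_translate_le {L : ℝ} {v : (Fin d → ℝ) → ℝ}
    (hv : IntegrableOn v (cube d L)) {M : ℝ} (hM : VariationLE (cube d L) v M) (a : Fin d → ℝ) :
    ∫⁻ x in cube d L ∩ {x | x + a ∈ cube d L}, ‖v (x + a) - v x‖ₑ ≤ ENNReal.ofReal (M * ‖a‖) := by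
  have hva : IntegrableOn (fun x => v (x + a)) {x | x + a ∈ cube d L} :=
    ((measurePreserving_add_right volume a).integrableOn_comp_preimage
      (measurableEmbedding_addRight a)).2 hv
  have hi : IntegrableOn (fun x => v (x + a) - v x) (cube d L ∩ {x | x + a ∈ cube d L}) :=
    (hva.mono_set inter_subset_right).sub (hv.mono_set inter_subset_left)
  have := hM.integral_translate_le (isOpen_cube d L) (convex_cube d L) hv a
  refine le_trans (le_of_eq ?_) (ENNReal.ofReal_le_ofReal this)
  rw [ofReal_integral_eq_lintegral_ofReal hi.abs
    (Filter.Eventually.of_forall fun x => abs_nonneg _)]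
  simp only [Real.enorm_eq_ofReal_abs]

/-- Two points of one cell differ by a vector `a` with `‖a‖ < h` in the supremum norm. Substituting
`y = x + a` and exchanging the integrals leaves, for each `a`, the translation estimate on the whole
cube; the factor `(2h)^d` is the volume of the ball of such `a`. -/
lemma sum_lintegral_cell_cell_le (hd : 1 ≤ d) {h : ℝ} (hh : 0 < h) (m : ℕ)
    {v : (Fin d → ℝ) → ℝ} (hm : Measurable v) (hv : IntegrableOn v (cube d (2 * m * h))) {M : ℝ}
    (hM : VariationLE (cube d (2 * m * h)) v M) :
    ∑ j ∈ grid d m, ∫⁻ x in cell h j, ∫⁻ y in cell h j, ‖v y - v x‖ₑ ≤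
      ENNReal.ofReal ((2 * h) ^ d * (M * h)) := by
  set Q : Set (Fin d → ℝ) := cube d (2 * m * h) with hQ
  set A : Set (Fin d → ℝ) := Metric.ball 0 h with hA
  have hQm : MeasurableSet Q := (isOpen_cube d _).measurableSet
  have hAm : MeasurableSet A := Metric.isOpen_ball.measurableSet
  have h1 : ∀ j ∈ grid d m, ∀ x ∈ cell h j, ∫⁻ y in cell h j, ‖v y - v x‖ₑ ≤
      ∫⁻ a in A, ({x | x + a ∈ Q}).indicator (fun x => ‖v (x + a) - v x‖ₑ) x := by
    intro j hj x hx
    rw [← lintegral_indicator (measurableSet_cell h j), ← lintegral_add_left_eq_self _ x,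
      ← lintegral_indicator hAm]
    refine lintegral_mono fun a => ?_
    by_cases ha : x + a ∈ cell h j
    · have haA : a ∈ A := by
        rw [hA, mem_ball_zero_iff, pi_norm_lt_iff hh]
        intro i
        obtain ⟨h1, h2⟩ := mem_cell.1 hx i
        obtain ⟨h3, h4⟩ := mem_cell.1 ha i
        simp only [Pi.add_apply] at h3 h4
        rw [Real.norm_eq_abs, abs_lt]
        constructor <;> linarith
      rw [indicator_of_mem ha, indicator_of_mem haA, indicator_of_mem]
      exact cell_subset_cube hh hj ha
    · rw [indicator_of_notMem ha]
      exact zero_le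
  have hmeas : Measurable (Function.uncurry fun (x a : Fin d → ℝ) =>
      ({x | x + a ∈ Q}).indicator (fun x => ‖v (x + a) - v x‖ₑ) x) := by
    have h2 : MeasurableSet {p : (Fin d → ℝ) × (Fin d → ℝ) | p.1 + p.2 ∈ Q} :=
      (measurable_fst.add measurable_snd) hQm
    have h3 : Measurable fun p : (Fin d → ℝ) × (Fin d → ℝ) => ‖v (p.1 + p.2) - v p.1‖ₑ :=
      ((hm.comp (measurable_fst.add measurable_snd)).sub (hm.comp measurable_fst)).enorm
    exact h3.indicator h2
  calc _ ≤ ∑ j ∈ grid d m, ∫⁻ x in cell h j,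
        ∫⁻ a in A, ({x | x + a ∈ Q}).indicator (fun x => ‖v (x + a) - v x‖ₑ) x :=
      Finset.sum_le_sum fun j hj => setLIntegral_mono' (measurableSet_cell h j) (h1 j hj)
    _ = ∫⁻ x in Q, ∫⁻ a in A, ({x | x + a ∈ Q}).indicator (fun x => ‖v (x + a) - v x‖ₑ) x :=
      (setLIntegral_cube hh m _).symm
    _ = ∫⁻ a in A, ∫⁻ x in Q, ({x | x + a ∈ Q}).indicator (fun x => ‖v (x + a) - v x‖ₑ) x :=
      lintegral_lintegral_swap hmeas.aemeasurable
    _ ≤ ∫⁻ _ in A, ENNReal.ofReal (M * h) := by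
      refine setLIntegral_mono' hAm fun a ha => ?_
      have hQa : MeasurableSet {x | x + a ∈ Q} := (measurable_add_const a) hQm
      rw [lintegral_indicator hQa, Measure.restrict_restrict hQa, inter_comm]
      refine (hM.lintegral_translate_le hv a).trans (ENNReal.ofReal_le_ofReal ?_)
      exact mul_le_mul_of_nonneg_left (mem_ball_zero_iff.1 ha).le hM.nonneg
    _ = _ := by
      have : Nonempty (Fin d) := ⟨⟨0, hd⟩⟩
      rw [setLIntegral_const, hA, Real.volume_pi_ball _ hh, Fintype.card_fin,
        ← ENNReal.ofReal_mul (mul_nonneg hM.nonneg hh.le), mul_comm]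

/-- The distance of a function of bounded variation to its cell averages in `L¹`. -/
lemma VariationLE.sum_integral_sub_cellAvg_le (hd : 1 ≤ d) {h : ℝ} (hh : 0 < h) (m : ℕ)
    {v : (Fin d → ℝ) → ℝ} (hv : IntegrableOn v (cube d (2 * m * h))) {M : ℝ}
    (hM : VariationLE (cube d (2 * m * h)) v M) :
    ∑ j ∈ grid d m, ∫ x in cell h j, |v x - cellAvg h v j| ≤ 2 ^ d * M * h := by
  -- Hypotheses and conclusion depend only on the almost everywhere class of `v`; a measurable
  -- representative is needed for Tonelli's theorem in the double integral over cells.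
  wlog hm : Measurable v generalizing v
  · have hvm := hv.aestronglyMeasurable.aemeasurable
    have hae := hvm.ae_eq_mk
    have := this (hv.congr hae) (hM.congr hae) hvm.measurable_mk
    refine le_of_eq_of_le (Finset.sum_congr rfl fun j hj => ?_) this
    have hj' := ae_restrict_of_ae_restrict_of_subset (cell_subset_cube hh hj) hae
    have havg : cellAvg h v j = cellAvg h (hvm.mk v) j := by
      rw [cellAvg, cellAvg, integral_congr_ae hj']
    refine integral_congr_ae ?_
    filter_upwards [hj'] with x hx using by rw [hx, havg]
  have hpos : (0 : ℝ) < h ^ d := by positivity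
  have hcell : ∀ j ∈ grid d m, IntegrableOn v (cell h j) := fun j hj =>
    hv.mono_set (cell_subset_cube hh hj)
  have hconst : ∀ (j : Fin d → ℤ) (c : ℝ), IntegrableOn (fun _ => c) (cell h j) := fun j c =>
    integrableOn_const (volume_cell_lt_top hh j).ne
  have key : ∀ j ∈ grid d m, ENNReal.ofReal (h ^ d * ∫ x in cell h j, |v x - cellAvg h v j|) ≤
      ∫⁻ x in cell h j, ∫⁻ y in cell h j, ‖v y - v x‖ₑ := by
    intro j hj
    have hI : IntegrableOn (fun x => h ^ d * |v x - cellAvg h v j|) (cell h j) :=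
      ((hcell j hj).sub (hconst j _)).abs.const_mul _
    rw [← integral_const_mul, ofReal_integral_eq_lintegral_ofReal hI
      (Filter.Eventually.of_forall fun x => by positivity)]
    refine lintegral_mono fun x => ?_
    -- Multiplication by the cell volume writes the deviation from the mean as the integral of `v y
    -- - v x` over the cell. Cancelling `h ^ d` in the end turns `(2h)^d` into `2 ^ d`.
    have : h ^ d * |v x - cellAvg h v j| = |∫ y in cell h j, (v y - v x)| := by
      rw [integral_sub (hcell j hj) (hconst j _), ← cellAvg_mul hh, setIntegral_const,
        volume_real_cell hh, smul_eq_mul, ← mul_sub, abs_mul, abs_of_pos hpos, abs_sub_comm]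
    simp only [this]
    rw [← Real.enorm_eq_ofReal_abs]
    exact enorm_integral_le_lintegral_enorm _
  have hsum := (Finset.sum_le_sum key).trans (sum_lintegral_cell_cell_le hd hh m hm hv hM)
  rw [← ENNReal.ofReal_sum_of_nonneg fun j _ => mul_nonneg hpos.le
      (integral_nonneg fun x => abs_nonneg _), ENNReal.ofReal_le_ofReal_iff
      (mul_nonneg (by positivity) (mul_nonneg hM.nonneg hh.le)), ← Finset.mul_sum, mul_pow] at hsum
  have : h ^ d * ∑ j ∈ grid d m, ∫ x in cell h j, |v x - cellAvg h v j| ≤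
      h ^ d * (2 ^ d * M * h) := by linarith
  exact le_of_mul_le_mul_left this hpos

end Oscillation

/-! ### The extended kernel -/

section Kernel

variable {d : ℕ} {D : Data d}

lemma Data.wExt_of_mem (D : Data d) (hL : 0 < D.L) {z : Fin d → ℝ} (hz : z ∈ D.Ω) :
    D.wExt z = D.w z := by
  cases he : D.ext
  · simp only [Data.wExt, he]
    congr 1
    funext i
    obtain ⟨h1, h2⟩ := hz i
    have : round (z i / D.L) = 0 := by
      rw [round_eq_zero_iff, mem_Ico, le_div_iff₀ hL, div_lt_iff₀ hL]
      constructor <;> linarith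
    simp [this]
  · simp only [Data.wExt, he]
    exact indicator_of_mem hz _

lemma Data.wExt_add_period (D : Data d) (hL : 0 < D.L) (he : D.ext = Extension.periodic)
    (z : Fin d → ℝ) (n : Fin d → ℤ) : D.wExt (z + fun i => (n i : ℝ) * D.L) = D.wExt z := by
  simp only [Data.wExt, he]
  congr 1
  funext i
  have : (z i + n i * D.L) / D.L = z i / D.L + n i := by field_simp
  simp only [Pi.add_apply, this, round_add_intCast]
  push_cast
  ring

/-- Reduction to the cube modulo its side length. -/
def reduce (L : ℝ) (z : Fin d → ℝ) : Fin d → ℝ := fun i => z i - L * round (z i / L)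

lemma measurable_reduce (L : ℝ) : Measurable (reduce L : (Fin d → ℝ) → Fin d → ℝ) := by
  refine measurable_pi_lambda _ fun i => ?_
  simp only [reduce, round_eq]
  have h1 : Measurable fun z : Fin d → ℝ => z i := measurable_pi_apply i
  have h2 : Measurable fun z : Fin d → ℝ => ((⌊z i / L + 1 / 2⌋ : ℤ) : ℝ) :=
    measurable_from_top.comp ((h1.div_const L).add_const _).floor
  exact h1.sub (h2.const_mul L)

/-- The exceptional set is covered by countably many translates of a null set, together with the
hyperplanes `z i ∈ L ℤ - L / 2`, on which the reduced point falls on a face of the open cube. -/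
lemma ae_reduce {L : ℝ} (hL : 0 < L) {p : (Fin d → ℝ) → Prop}
    (hp : ∀ᵐ x ∂volume.restrict (cube d L), p x) : ∀ᵐ z : Fin d → ℝ, p (reduce L z) := by
  rw [ae_restrict_iff' (isOpen_cube d L).measurableSet] at hp
  have h1 : ∀ᵐ z : Fin d → ℝ, ∀ n : Fin d → ℤ,
      (z - fun i => L * n i) ∈ cube d L → p (z - fun i => L * n i) := by
    rw [ae_all_iff]
    exact fun n => (measurePreserving_sub_right (volume : Measure (Fin d → ℝ))
      (fun i => L * n i)).quasiMeasurePreserving.ae hp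
  have h2 : ∀ᵐ z : Fin d → ℝ, ∀ i, ∀ n : ℤ, z i ≠ L * n - L / 2 := by
    rw [ae_all_iff]; intro i
    rw [ae_all_iff]; intro n
    rw [ae_iff]
    simp only [ne_eq, not_not]
    exact Measure.pi_hyperplane (fun _ : Fin d => (volume : Measure ℝ)) i _
  filter_upwards [h1, h2] with z hz1 hz2
  refine hz1 (fun i => round (z i / L)) fun i => ?_
  simp only [Pi.sub_apply]
  have h3 := abs_le.1 (abs_sub_round (z i / L))
  have h4 : z i = z i / L * L := by field_simp
  have h5 := hz2 i (round (z i / L))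
  constructor
  · refine lt_of_le_of_ne ?_ fun h => h5 (by linarith)
    nlinarith [h3.1]
  · have h6 : z i / L < round (z i / L) + 1 / 2 := by
      have := Int.lt_floor_add_one (z i / L + 1 / 2)
      rw [round_eq]
      linarith
    nlinarith

lemma quasiMeasurePreserving_reduce {L : ℝ} (hL : 0 < L) :
    Measure.QuasiMeasurePreserving (reduce L : (Fin d → ℝ) → Fin d → ℝ) volume
      (volume.restrict (cube d L)) := by
  refine ⟨measurable_reduce L, Measure.AbsolutelyContinuous.mk fun s hs h0 => ?_⟩
  rw [Measure.map_apply (measurable_reduce L) hs]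
  have := ae_reduce hL (p := fun x => x ∉ s) (measure_eq_zero_iff_ae_notMem.1 h0)
  exact measure_eq_zero_iff_ae_notMem.2 this

lemma Data.measurableSet_Ω (D : Data d) : MeasurableSet D.Ω :=
  (isOpen_cube d D.L).measurableSet

lemma Data.volume_Ω_lt_top (D : Data d) : volume D.Ω < ⊤ := by
  rw [Data.Ω, volume_cube]
  exact ENNReal.pow_lt_top ENNReal.ofReal_lt_top

lemma Data.Admissible.aestronglyMeasurable_wExt (hD : D.Admissible) :
    AEStronglyMeasurable D.wExt volume := by
  have hw := hD.w_bv.1.aestronglyMeasurable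
  cases he : D.ext with
  | periodic =>
    have : D.wExt = D.w ∘ reduce D.L := by
      simp only [Data.wExt, he]; rfl
    rw [this]
    exact hw.comp_quasiMeasurePreserving (quasiMeasurePreserving_reduce hD.L_pos)
  | zero =>
    have : D.wExt = D.Ω.indicator D.w := by simp only [Data.wExt, he]
    rw [this]
    exact (aestronglyMeasurable_indicator_iff (D.measurableSet_Ω)).2 hw

lemma Data.Admissible.wExt_bounded (hD : D.Admissible) (he : D.ext = Extension.periodic) :
    ∃ M : ℝ, 0 ≤ M ∧ ∀ᵐ z, |D.wExt z| ≤ M := by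
  obtain ⟨M, hM⟩ := hD.w_bounded he
  refine ⟨max M 0, le_max_right _ _, ?_⟩
  have : D.wExt = D.w ∘ reduce D.L := by
    simp only [Data.wExt, he]; rfl
  rw [this]
  filter_upwards [ae_reduce hD.L_pos hM] with z hz using hz.trans (le_max_left _ _)

lemma Data.Admissible.integrable_wExt (hD : D.Admissible) (he : D.ext = Extension.zero) :
    Integrable D.wExt := by
  have : D.wExt = D.Ω.indicator D.w := by simp only [Data.wExt, he]
  rw [this]
  exact (integrable_indicator_iff (D.measurableSet_Ω)).2 hD.w_bv.1

lemma Data.Admissible.integrableOn_wExt_add (hD : D.Admissible) (a : Fin d → ℝ)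
    {s : Set (Fin d → ℝ)} (hs : volume s < ⊤) : IntegrableOn (fun z => D.wExt (z + a)) s := by
  have hmp := measurePreserving_add_right (volume : Measure (Fin d → ℝ)) a
  cases he : D.ext with
  | periodic =>
    obtain ⟨M, -, hM⟩ := hD.wExt_bounded he
    have := isFiniteMeasure_restrict.2 hs.ne
    refine Integrable.of_bound (C := M)
      (hD.aestronglyMeasurable_wExt.comp_measurePreserving hmp).restrict ?_
    exact ae_restrict_of_ae (hmp.quasiMeasurePreserving.ae hM)
  | zero => exact (hmp.integrable_comp_of_integrable (hD.integrable_wExt he)).integrableOn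

/-- The integrals of the kernel over the cube with respect to either variable are bounded. -/
lemma Data.Admissible.exists_lintegral_wExt_le (hD : D.Admissible) : ∃ W : ℝ, 0 ≤ W ∧
    (∀ x, ∫⁻ y in D.Ω, ‖D.wExt (x - y)‖ₑ ≤ ENNReal.ofReal W) ∧
    ∀ y, ∫⁻ x in D.Ω, ‖D.wExt (x - y)‖ₑ ≤ ENNReal.ofReal W := by
  cases he : D.ext with
  | periodic =>
    obtain ⟨M, hM0, hM⟩ := hD.wExt_bounded he
    have hv : ENNReal.ofReal (M * (volume D.Ω).toReal) = ENNReal.ofReal M * volume D.Ω := by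
      rw [ENNReal.ofReal_mul hM0, ENNReal.ofReal_toReal D.volume_Ω_lt_top.ne]
    have hb : ∀ {φ : (Fin d → ℝ) → Fin d → ℝ}, Measure.QuasiMeasurePreserving φ volume volume →
        ∫⁻ y in D.Ω, ‖D.wExt (φ y)‖ₑ ≤ ENNReal.ofReal (M * (volume D.Ω).toReal) := fun hφ => by
      rw [hv, ← setLIntegral_const]
      refine lintegral_mono_ae (ae_restrict_of_ae ?_)
      filter_upwards [hφ.ae hM] with y hy
      rw [Real.enorm_eq_ofReal_abs]
      exact ENNReal.ofReal_le_ofReal hy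
    exact ⟨M * (volume D.Ω).toReal, by positivity,
      fun x => hb (Measure.measurePreserving_sub_left volume x).quasiMeasurePreserving,
      fun y => hb (measurePreserving_sub_right volume y).quasiMeasurePreserving⟩
  | zero =>
    have hw := hD.integrable_wExt he
    have hv : ENNReal.ofReal (∫ z, |D.wExt z|) = ∫⁻ z, ‖D.wExt z‖ₑ := by
      rw [ofReal_integral_eq_lintegral_ofReal hw.abs
        (Filter.Eventually.of_forall fun x => abs_nonneg _)]
      simp only [Real.enorm_eq_ofReal_abs]
    refine ⟨∫ z, |D.wExt z|, integral_nonneg fun _ => abs_nonneg _, fun x => ?_, fun y => ?_⟩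
    · exact hv ▸ (setLIntegral_le_lintegral _ _).trans_eq
        (lintegral_sub_left_eq_self (fun z => ‖D.wExt z‖ₑ) x)
    · exact hv ▸ (setLIntegral_le_lintegral _ _).trans_eq
        (lintegral_sub_right_eq_self (fun z => ‖D.wExt z‖ₑ) y)

lemma Data.h_pos (hL : 0 < D.L) {P : Params} (hm : 1 ≤ P.m) : 0 < D.h P := by
  have : (0 : ℝ) < P.m := by exact_mod_cast hm
  rw [Data.h]; positivity

lemma Data.two_mul_h (D : Data d) {P : Params} (hm : 1 ≤ P.m) : 2 * P.m * D.h P = D.L := by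
  have : (P.m : ℝ) ≠ 0 := by exact_mod_cast (by lia : P.m ≠ 0)
  rw [Data.h]; field_simp

lemma Data.Ω_eq (D : Data d) {P : Params} (hm : 1 ≤ P.m) : D.Ω = cube d (2 * P.m * D.h P) := by
  rw [D.two_mul_h hm]; rfl

/-- A compactly supported kernel has positive distance to the boundary of the cube. -/
lemma Data.Admissible.exists_margin (hD : D.Admissible) (he : D.ext = Extension.zero) :
    ∃ δ : ℝ, 0 < δ ∧ ∃ K : Set (Fin d → ℝ), (∀ᵐ z, D.wExt z ≠ 0 → z ∈ K) ∧ K ⊆ D.Ω ∧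
      ∀ z v, z ∈ K → ‖v‖ ≤ δ → z + v ∈ D.Ω := by
  obtain ⟨K, hK, hKΩ, hK0⟩ := hD.w_compact he
  obtain ⟨δ, hδ, hδK⟩ := hK.exists_cthickening_subset_open (isOpen_cube d D.L) hKΩ
  refine ⟨δ, hδ, K, ?_, hKΩ, fun z v hz hv => hδK ?_⟩
  · rw [ae_restrict_iff' ((D.measurableSet_Ω).diff hK.measurableSet)] at hK0
    filter_upwards [hK0] with z hz hne
    have hzΩ : z ∈ D.Ω := by
      by_contra h
      simp only [Data.wExt, he, indicator_of_notMem h, ne_eq, not_true_eq_false] at hne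
    rw [D.wExt_of_mem hD.L_pos hzΩ] at hne
    by_contra h
    exact hne (hz ⟨hzΩ, h⟩)
  · refine Metric.mem_cthickening_of_dist_le (z + v) z δ K hz ?_
    simpa using hv

/-- Translation estimate for the extended kernel. -/
lemma Data.Admissible.exists_sum_lintegral_wExt_translate_le (hd : 1 ≤ d) (hD : D.Admissible) :
    ∃ C : ℝ, 0 ≤ C ∧ ∀ P : Params, 1 ≤ P.m → ∀ v : Fin d → ℝ, ‖v‖ ≤ D.h P →
      ∑ l ∈ grid d (D.ext.halfPeriod P.m), ∫⁻ z in cell (D.h P) l, ‖D.wExt (z + v) - D.wExt z‖ₑ ≤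
        ENNReal.ofReal (C * D.h P) := by
  obtain ⟨M, hM⟩ := hD.w_bv.2
  have hM0 := hM.nonneg
  have hL := hD.L_pos
  have hΩm := D.measurableSet_Ω
  have hvm : ∀ v : Fin d → ℝ, MeasurableSet {z | z + v ∈ D.Ω} := fun v =>
    (measurable_add_const v) hΩm
  have hinner : ∀ v : Fin d → ℝ, ∀ h : ℝ, ‖v‖ ≤ h →
      ∫⁻ z in D.Ω, ({z | z + v ∈ D.Ω}).indicator (fun z => ‖D.wExt (z + v) - D.wExt z‖ₑ) z ≤
        ENNReal.ofReal (M * h) := fun v h hv => by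
    rw [lintegral_indicator (hvm v), Measure.restrict_restrict (hvm v), inter_comm]
    refine le_trans (le_of_eq ?_) ((hM.lintegral_translate_le hD.w_bv.1 v).trans
      (ENNReal.ofReal_le_ofReal (mul_le_mul_of_nonneg_left hv hM0)))
    refine setLIntegral_congr_fun (hΩm.inter (hvm v)) fun z hz => ?_
    simp only [D.wExt_of_mem hL hz.1, D.wExt_of_mem hL hz.2]
  cases he : D.ext with
  | periodic =>
    obtain ⟨B, hB0, hB⟩ := hD.wExt_bounded he
    -- `M` bounds the part where `z` and `z + v` both lie in the cube. The shift can leave the cube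
    -- only from a boundary cell, where the periodic extension may jump; there the integrand is at
    -- most `2B`.
    refine ⟨M + 2 * B * (2 * d * D.L ^ (d - 1)), by positivity, fun P hm v hv => ?_⟩
    have hh := D.h_pos hL hm
    have hcell : ∀ l ∈ grid d P.m, ∫⁻ z in cell (D.h P) l, ‖D.wExt (z + v) - D.wExt z‖ₑ ≤
        (∫⁻ z in cell (D.h P) l,
          ({z | z + v ∈ D.Ω}).indicator (fun z => ‖D.wExt (z + v) - D.wExt z‖ₑ) z) +
        if l ∈ bdry d P.m then ENNReal.ofReal (2 * B * D.h P ^ d) else 0 := by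
      intro l hl
      split_ifs with hb
      · refine le_add_of_le_right ?_
        rw [ENNReal.ofReal_mul (by positivity), ← volume_cell hh l, ← setLIntegral_const]
        refine lintegral_mono_ae (ae_restrict_of_ae ?_)
        filter_upwards [hB, (measurePreserving_add_right (volume : Measure (Fin d → ℝ))
          v).quasiMeasurePreserving.ae hB] with z hz1 hz2
        rw [Real.enorm_eq_ofReal_abs]
        refine ENNReal.ofReal_le_ofReal ((abs_sub _ _).trans ?_)
        linarith
      · rw [add_zero]
        refine setLIntegral_mono' (measurableSet_cell _ _) fun z hz => ?_
        have hzv : z + v ∈ D.Ω := by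
          rw [D.Ω_eq hm]
          refine add_mem_cube_of_not_isBdry hh hl (fun h => hb ?_) hz hv
          classical
          exact Finset.mem_filter.2 ⟨hl, h⟩
        rw [indicator_of_mem (by exact hzv)]
    refine (Finset.sum_le_sum hcell).trans ?_
    rw [Finset.sum_add_distrib, ← setLIntegral_cube hh, ← D.Ω_eq hm, ← Finset.sum_filter,
      Finset.sum_const, nsmul_eq_mul, add_mul, ENNReal.ofReal_add (by positivity) (by positivity)]
    refine add_le_add (hinner v _ hv) ?_
    rw [← ENNReal.ofReal_natCast, ← ENNReal.ofReal_mul (by positivity)]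
    refine ENNReal.ofReal_le_ofReal ?_
    have hc := card_bdry_mul_le hd P.m hh.le
    rw [D.two_mul_h hm] at hc
    have hc' : ((((grid d P.m).filter fun l => l ∈ bdry d P.m).card : ℕ) : ℝ) ≤
        (bdry d P.m).card := by
      exact_mod_cast Finset.card_le_card fun l hl => (Finset.mem_filter.1 hl).2
    calc _ ≤ ((bdry d P.m).card : ℝ) * (2 * B * D.h P ^ d) := by gcongr
      _ = 2 * B * ((bdry d P.m).card * D.h P ^ d) := by ring
      _ ≤ 2 * B * (2 * d * D.L ^ (d - 1) * D.h P) := by gcongr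
      _ = _ := by ring
  | zero =>
    obtain ⟨δ, hδ, K, hK0, hKΩ, hKv⟩ := hD.exists_margin he
    have hwi := hD.integrable_wExt he
    set I := ∫ z, |D.wExt z| with hI
    have hI0 : 0 ≤ I := integral_nonneg fun _ => abs_nonneg _
    have hv' : ENNReal.ofReal I = ∫⁻ z, ‖D.wExt z‖ₑ := by
      rw [hI, ofReal_integral_eq_lintegral_ofReal hwi.abs
        (Filter.Eventually.of_forall fun x => abs_nonneg _)]
      simp only [Real.enorm_eq_ofReal_abs]
    -- If `h ≤ δ`, the margin of the support ensures that only `z` with both `z` and `z + v` in the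
    -- cube contribute, and the BV bound `M h` applies. If `h > δ`, the trivial bound `2 I` is at
    -- most `(2 I / δ) h`.
    refine ⟨M + 2 * I / δ, by positivity, fun P hm v hv => ?_⟩
    have hh := D.h_pos hL hm
    rw [← setLIntegral_cube hh]
    refine (setLIntegral_le_lintegral _ _).trans ?_
    rcases le_or_gt (D.h P) δ with hδh | hδh
    · refine le_trans ?_ ((hinner v _ hv).trans (ENNReal.ofReal_le_ofReal ?_))
      · rw [← lintegral_indicator hΩm]
        refine lintegral_mono_ae ?_
        filter_upwards [hK0, (measurePreserving_add_right (volume : Measure (Fin d → ℝ))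
          v).quasiMeasurePreserving.ae hK0] with z hz1 hz2
        by_cases hz : z ∈ D.Ω ∧ z + v ∈ D.Ω
        · rw [indicator_of_mem hz.1, indicator_of_mem (by exact hz.2)]
        · have h1 : D.wExt z = 0 := by
            by_contra h
            exact hz ⟨hKΩ (hz1 h), hKv z v (hz1 h) (hv.trans hδh)⟩
          have h2 : D.wExt (z + v) = 0 := by
            by_contra h
            refine hz ⟨?_, hKΩ (hz2 h)⟩
            have := hKv (z + v) (-v) (hz2 h) (by rw [norm_neg]; exact hv.trans hδh)
            simpa using this
          simp [h1, h2]
      · have : 0 ≤ 2 * I / δ * D.h P := by positivity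
        linarith
    · calc _ ≤ ∫⁻ z, (‖D.wExt (z + v)‖ₑ + ‖D.wExt z‖ₑ) := lintegral_mono fun z => enorm_sub_le
        _ = ENNReal.ofReal I + ENNReal.ofReal I := by
          rw [lintegral_add_right' _ hD.aestronglyMeasurable_wExt.enorm, hv',
            lintegral_add_right_eq_self (fun z => ‖D.wExt z‖ₑ) v]
        _ ≤ _ := by
          rw [← ENNReal.ofReal_add hI0 hI0]
          refine ENNReal.ofReal_le_ofReal ?_
          have h1 : I + I ≤ 2 * I / δ * D.h P := by
            rw [div_mul_eq_mul_div, le_div_iff₀ hδ]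
            nlinarith
          have h2 : 0 ≤ M * D.h P := by positivity
          linarith

end Kernel

/-! ### Consistency of the periodized mesh kernel -/

section DiscreteKernel

variable {d : ℕ} {D : Data d}

lemma mem_bdry {m : ℕ} {j : Fin d → ℤ} : j ∈ bdry d m ↔ j ∈ grid d m ∧ IsBdry m j := by
  simp only [bdry, Finset.mem_filter]

lemma isBdry_of_mem_opposed {m : ℕ} {j k : Fin d → ℤ} (hk : k ∈ opposed m j) (hj : IsBdry m j) :
    IsBdry m k := by
  obtain ⟨i, hi⟩ := hj
  rcases (mem_opposed.1 hk).2 i with h | h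
  · exact ⟨i, h ▸ hi⟩
  · exact ⟨i, h.1⟩

lemma Data.cell_subset_Ω (D : Data d) (hL : 0 < D.L) {P : Params} (hm : 1 ≤ P.m)
    {j : Fin d → ℤ} (hj : j ∈ grid d P.m) : cell (D.h P) j ⊆ D.Ω := by
  rw [D.Ω_eq hm]; exact cell_subset_cube (D.h_pos hL hm) hj

lemma abs_cellAvg_le {h : ℝ} (hh : 0 < h) {v : (Fin d → ℝ) → ℝ} {j : Fin d → ℤ} {R : ℝ}
    (hv : ∀ᵐ x ∂volume.restrict (cell h j), |v x| ≤ R) : |cellAvg h v j| ≤ R := by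
  have hpos : (0 : ℝ) < h ^ d := by positivity
  have := norm_setIntegral_le_of_norm_le_const_ae (f := v) (C := R)
    (volume_cell_lt_top hh j) hv
  rw [volume_real_cell hh, Real.norm_eq_abs, ← cellAvg_mul hh, abs_mul, abs_of_pos hpos,
    mul_comm] at this
  exact le_of_mul_le_mul_right this hpos

lemma Data.h_pow_mul_sum_abs_cellAvg_le (hD : D.Admissible) {P : Params} (hm : 1 ≤ P.m) :
    D.h P ^ d * ∑ l ∈ grid d P.m, |cellAvg (D.h P) D.w l| ≤ ∫ x in D.Ω, |D.w x| := by
  have hh := D.h_pos hD.L_pos hm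
  have hw := hD.w_bv.1.abs
  rw [D.Ω_eq hm] at hw
  rw [D.Ω_eq hm, setIntegral_cube hh _ hw, Finset.mul_sum]
  refine Finset.sum_le_sum fun l _ => ?_
  have : D.h P ^ d * |cellAvg (D.h P) D.w l| = |∫ x in cell (D.h P) l, D.w x| := by
    rw [← cellAvg_mul hh, abs_mul, abs_of_pos (by positivity : 0 < D.h P ^ d)]
  rw [this]
  exact abs_integral_le_integral_abs

lemma Data.h_pow_mul_sum_abs_wh_le (hD : D.Admissible) {P : Params} (hm : 1 ≤ P.m) :
    D.h P ^ d * ∑ l ∈ grid d P.m, |D.wh P l| ≤ ∫ x in D.Ω, |D.w x| := by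
  refine le_trans ?_ (D.h_pow_mul_sum_abs_cellAvg_le hD hm)
  have hh := D.h_pos hD.L_pos hm
  gcongr ?_ * ?_
  rw [← sum_periodize P.m fun l => |cellAvg (D.h P) D.w l|]
  exact Finset.sum_le_sum fun l _ => abs_periodize_le _ _ _

/-- A sum over the boundary cells of terms of the size of the cell volume is of order `h`. -/
lemma Data.sum_bdry_le (hd : 1 ≤ d) (hL : 0 < D.L) {P : Params} (hm : 1 ≤ P.m)
    {e : (Fin d → ℤ) → ℝ} {R : ℝ} (hR : 0 ≤ R) (h0 : ∀ j ∈ grid d P.m, ¬ IsBdry P.m j → e j = 0)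
    (h1 : ∀ j ∈ grid d P.m, e j ≤ R * D.h P ^ d) :
    ∑ j ∈ grid d P.m, e j ≤ 2 * d * D.L ^ (d - 1) * R * D.h P := by
  classical
  have hh := D.h_pos hL hm
  have hc := card_bdry_mul_le hd P.m hh.le
  rw [D.two_mul_h hm] at hc
  have hsub : bdry d P.m ⊆ grid d P.m := fun j hj => (mem_bdry.1 hj).1
  rw [← Finset.sum_subset hsub fun j hj hjb => h0 j hj fun h => hjb (mem_bdry.2 ⟨hj, h⟩)]
  calc _ ≤ (bdry d P.m).card • (R * D.h P ^ d) :=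
        Finset.sum_le_card_nsmul _ _ _ fun j hj => h1 j (hsub hj)
    _ = R * ((bdry d P.m).card * D.h P ^ d) := by rw [nsmul_eq_mul]; ring
    _ ≤ R * (2 * d * D.L ^ (d - 1) * D.h P) := by gcongr
    _ = _ := by ring

/-- The cell integrals of the kernel and its periodized averages differ by `O(h)`. -/
lemma Data.Admissible.exists_sum_abs_sub_wPad_le (hd : 1 ≤ d) (hD : D.Admissible) :
    ∃ C : ℝ, 0 ≤ C ∧ ∀ P : Params, 1 ≤ P.m →
      ∑ l ∈ grid d (D.ext.halfPeriod P.m),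
        |(∫ z in cell (D.h P) l, D.wExt z) - D.h P ^ d * D.wPad P l| ≤ C * D.h P := by
  have hL := D.L
  have hgrid : ∀ P : Params, 1 ≤ P.m → ∑ l ∈ grid d (D.ext.halfPeriod P.m),
        |(∫ z in cell (D.h P) l, D.wExt z) - D.h P ^ d * D.wPad P l| =
      ∑ l ∈ grid d P.m, D.h P ^ d * |cellAvg (D.h P) D.w l - D.wh P l| := by
    intro P hm
    have hh := D.h_pos hD.L_pos hm
    rw [← Finset.sum_subset (grid_mono (D.ext.le_halfPeriod P.m))]
    · refine Finset.sum_congr rfl fun l hl => ?_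
      have h1 : ∫ z in cell (D.h P) l, D.wExt z = ∫ z in cell (D.h P) l, D.w z :=
        setIntegral_congr_fun (measurableSet_cell _ _) fun z hz =>
          D.wExt_of_mem hD.L_pos (D.cell_subset_Ω hD.L_pos hm hl hz)
      rw [h1, ← cellAvg_mul hh, Data.wPad, if_pos hl, ← mul_sub, abs_mul,
        abs_of_pos (by positivity : 0 < D.h P ^ d)]
    -- Beyond the cube both terms vanish: the mesh kernel by padding, the kernel by its extension by
    -- zero. In the periodic case there are no such cells.
    · intro l hl hl'
      rw [Data.wPad, if_neg hl', mul_zero, sub_zero, abs_eq_zero]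
      cases he : D.ext with
      | periodic => rw [he] at hl; exact absurd hl hl'
      | zero =>
        refine (setIntegral_congr_fun (g := fun _ => (0 : ℝ)) (measurableSet_cell _ _)
          fun z hz => ?_).trans (by simp)
        simp only [Data.wExt, he]
        refine indicator_of_notMem (fun hzΩ => hl' ?_) _
        rw [D.Ω_eq hm] at hzΩ
        exact ceil_of_mem_cell hh hz ▸ ceil_mem_grid hh hzΩ
  have hint : ∀ P : Params, 1 ≤ P.m → ∀ l ∈ grid d P.m, ¬ IsBdry P.m l →
      D.h P ^ d * |cellAvg (D.h P) D.w l - D.wh P l| = 0 := fun P hm l hl hb => by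
    rw [Data.wh, periodize_of_not_isBdry hl hb, sub_self, abs_zero, mul_zero]
  cases he : D.ext with
  | periodic =>
    rw [he] at hgrid
    obtain ⟨M, hM⟩ := hD.w_bounded he
    have hL0 := hD.L_pos
    refine ⟨2 * d * D.L ^ (d - 1) * (2 * max M 0), by positivity, fun P hm => ?_⟩
    have hh := D.h_pos hD.L_pos hm
    rw [hgrid P hm]
    refine D.sum_bdry_le hd hD.L_pos hm (by positivity) (hint P hm) fun l hl => ?_
    have h1 : ∀ k ∈ grid d P.m, |cellAvg (D.h P) D.w k| ≤ max M 0 := fun k hk => by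
      refine abs_cellAvg_le hh ?_
      filter_upwards [ae_restrict_of_ae_restrict_of_subset (D.cell_subset_Ω hD.L_pos hm hk) hM]
        with x hx using hx.trans (le_max_left _ _)
    have h2 := abs_periodize_le_of_forall h1 hl
    rw [mul_comm]
    gcongr
    refine (abs_sub _ _).trans ?_
    have := h1 l hl
    rw [Data.wh]
    linarith
  | zero =>
    rw [he] at hgrid
    obtain ⟨δ, hδ, K, hK0, hKΩ, hKv⟩ := hD.exists_margin he
    set I := ∫ z in D.Ω, |D.w z| with hI
    have hI0 : 0 ≤ I := integral_nonneg fun _ => abs_nonneg _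
    refine ⟨2 * I / δ, by positivity, fun P hm => ?_⟩
    have hh := D.h_pos hD.L_pos hm
    rw [hgrid P hm]
    rcases le_or_gt (D.h P) δ with hδh | hδh
    -- When `h ≤ δ` the boundary cells do not meet the support: a shift by `h` across the adjacent
    -- face would leave the cube. Opposed cells of boundary cells are boundary cells, so
    -- periodization changes nothing.
    · refine le_of_eq_of_le (Finset.sum_eq_zero fun l hl => ?_) (by positivity)
      by_cases hb : IsBdry P.m l
      · have h0 : ∀ k ∈ grid d P.m, IsBdry P.m k → cellAvg (D.h P) D.w k = 0 := by
          intro k hk hkb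
          have hz : ∀ z ∈ cell (D.h P) k, z ∉ K := by
            intro z hz hzK
            obtain ⟨i, hi⟩ := hkb
            obtain ⟨h1, h2⟩ := mem_cell.1 hz i
            have h3 := D.two_mul_h hm
            have hnorm : ∀ s : ℝ, |s| ≤ D.h P → ‖(Pi.single i s : Fin d → ℝ)‖ ≤ δ := by
              intro s hs
              refine ((pi_norm_le_iff_of_nonneg hh.le).2 fun i' => ?_).trans hδh
              rcases eq_or_ne i' i with rfl | hne
              · simpa using hs
              · simpa [hne] using hh.le
            rcases hi with hi | hi
            · have h4 := (hKv z (Pi.single i (-D.h P)) hzK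
                (hnorm _ (by rw [abs_neg, abs_of_pos hh])) i).1
              simp only [Pi.add_apply, Pi.single_eq_same] at h4
              rw [hi] at h2
              push_cast at h2
              linarith
            · have h4 := (hKv z (Pi.single i (D.h P)) hzK
                (hnorm _ (by rw [abs_of_pos hh])) i).2
              simp only [Pi.add_apply, Pi.single_eq_same] at h4
              rw [hi] at h1
              push_cast at h1
              linarith
          rw [cellAvg, setIntegral_congr_ae (g := fun _ => (0 : ℝ)) (measurableSet_cell _ _)]
          · simp
          · filter_upwards [hK0] with z hz0 hzc
            by_contra hne
            rw [← D.wExt_of_mem hD.L_pos (D.cell_subset_Ω hD.L_pos hm hk hzc)] at hne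
            exact hz z hzc (hz0 hne)
        have h1 : D.wh P l = 0 := by
          rw [Data.wh, periodize, Finset.sum_eq_zero, zero_div]
          exact fun k hk => h0 k (mem_opposed.1 hk).1 (isBdry_of_mem_opposed hk hb)
        rw [h0 l hl hb, h1, sub_zero, abs_zero, mul_zero]
      · exact hint P hm l hl hb
    · have h1 : I + I ≤ 2 * I / δ * D.h P := by
        rw [div_mul_eq_mul_div, le_div_iff₀ hδ]
        nlinarith
      refine le_trans ?_ h1
      refine le_trans ?_ (add_le_add (D.h_pow_mul_sum_abs_cellAvg_le hD hm)
        (D.h_pow_mul_sum_abs_wh_le hD hm))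
      rw [Finset.mul_sum, Finset.mul_sum, ← Finset.sum_add_distrib]
      refine Finset.sum_le_sum fun l _ => ?_
      rw [← mul_add]
      gcongr
      exact abs_sub _ _

/-- The grid of half-width `p ≥ m` contains one representative of each residue. Together with
`sum_comp_le_of_injOn` this bounds a nonnegative sum over wrapped differences by the sum over the
full period. -/
lemma wrapIdx_sub_injOn {m p : ℕ} (hmp : m ≤ p) (k : Fin d → ℤ) :
    Set.InjOn (fun j => wrapIdx p (j - k)) (grid d m) := by
  intro j hj j' hj' h
  have hj := grid_mono hmp hj
  have hj' := grid_mono hmp hj'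
  funext i
  refine eq_of_dvd_sub (mem_grid.1 hj i) (mem_grid.1 hj' i) ?_
  have h1 := dvd_sub_wrap p ((j - k) i)
  have h2 := dvd_sub_wrap p ((j' - k) i)
  have h3 : wrap p ((j - k) i) = wrap p ((j' - k) i) := congrFun h i
  rw [h3] at h1
  have := dvd_sub h1 h2
  rw [sub_sub_sub_cancel_right] at this
  simpa using this

lemma sub_wrapIdx_injOn {m p : ℕ} (hmp : m ≤ p) (j : Fin d → ℤ) :
    Set.InjOn (fun k => wrapIdx p (j - k)) (grid d m) := by
  intro k hk k' hk' h
  have hk := grid_mono hmp hk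
  have hk' := grid_mono hmp hk'
  funext i
  refine eq_of_dvd_sub (mem_grid.1 hk i) (mem_grid.1 hk' i) ?_
  have h1 := dvd_sub_wrap p ((j - k) i)
  have h2 := dvd_sub_wrap p ((j - k') i)
  have h3 : wrap p ((j - k) i) = wrap p ((j - k') i) := congrFun h i
  rw [h3] at h1
  have := dvd_sub h2 h1
  rw [sub_sub_sub_cancel_right] at this
  simpa using this

lemma sum_comp_le_of_injOn {α β : Type*} [DecidableEq β] {s : Finset α} {t : Finset β}
    {φ : α → β} (hφ : Set.InjOn φ s) (hst : ∀ a ∈ s, φ a ∈ t) {f : β → ℝ} (hf : ∀ b, 0 ≤ f b) :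
    ∑ a ∈ s, f (φ a) ≤ ∑ b ∈ t, f b := by
  rw [← Finset.sum_image (f := f) hφ]
  exact Finset.sum_le_sum_of_subset_of_nonneg (Finset.image_subset_iff.2 hst) fun b _ _ => hf b

lemma Data.sum_abs_wPad_le (hD : D.Admissible) {P : Params} (hm : 1 ≤ P.m) (j : Fin d → ℤ) :
    D.h P ^ d * ∑ k ∈ grid d P.m, |D.wPad P (wrapIdx (D.ext.halfPeriod P.m) (j - k))| ≤
      ∫ x in D.Ω, |D.w x| := by
  refine le_trans ?_ (D.h_pow_mul_sum_abs_wh_le hD hm)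
  have hh := D.h_pos hD.L_pos hm
  have hle := D.ext.le_halfPeriod P.m
  gcongr ?_ * ?_
  refine (sum_comp_le_of_injOn (f := fun l => |D.wPad P l|) (sub_wrapIdx_injOn hle j)
    (fun k _ => wrapIdx_mem (hm.trans hle) _) fun _ => abs_nonneg _).trans ?_
  rw [← Finset.sum_subset (grid_mono hle)]
  · refine Finset.sum_le_sum fun l hl => ?_
    rw [Data.wPad, if_pos hl]
  · intro l _ hl
    rw [Data.wPad, if_neg hl, abs_zero]

/-- Wrapping changes `j - k` by multiples of `2p`. In the periodic case `2ph = L` is a period of the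
kernel; in the other case `p = 2m` and `|j i - k i| < 2m`, so that no wrapping takes place. -/
lemma Data.setIntegral_wExt_sub (hD : D.Admissible) {P : Params} (hm : 1 ≤ P.m)
    {j k : Fin d → ℤ} (hj : j ∈ grid d P.m) (hk : k ∈ grid d P.m) (y : Fin d → ℝ) :
    ∫ x in cell (D.h P) j, D.wExt (x - y) =
      ∫ z in cell (D.h P) (wrapIdx (D.ext.halfPeriod P.m) (j - k)),
        D.wExt (z + fun i => k i * D.h P - y i) := by
  rw [setIntegral_cell_translate (D.h P) j (wrapIdx (D.ext.halfPeriod P.m) (j - k))]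
  congr 1
  funext z
  have hdvd : ∀ i, ∃ n : ℤ, j i - k i - wrapIdx (D.ext.halfPeriod P.m) (j - k) i =
      2 * D.ext.halfPeriod P.m * n := fun i => dvd_sub_wrap _ ((j - k) i)
  choose n hn using hdvd
  have hn' : ∀ i, (j i : ℝ) - k i - wrapIdx (D.ext.halfPeriod P.m) (j - k) i =
      2 * D.ext.halfPeriod P.m * n i := fun i => by exact_mod_cast hn i
  have h1 : (z + fun i => ((j i : ℝ) - wrapIdx (D.ext.halfPeriod P.m) (j - k) i) * D.h P) - y =
      (z + fun i => k i * D.h P - y i) +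
        fun i => 2 * D.ext.halfPeriod P.m * n i * D.h P := by
    funext i
    simp only [Pi.sub_apply, Pi.add_apply, ← hn' i]
    ring
  rw [h1]
  cases he : D.ext with
  | periodic =>
    have h2 : (fun i => 2 * (Extension.periodic.halfPeriod P.m : ℝ) * n i * D.h P) =
        fun i => (n i : ℝ) * D.L := by
      funext i
      rw [← D.two_mul_h hm, Extension.halfPeriod]
      ring
    rw [h2, D.wExt_add_period hD.L_pos he]
  | zero =>
    have h2 : ∀ i, n i = 0 := fun i => by
      have h3 : wrapIdx (D.ext.halfPeriod P.m) (j - k) i = j i - k i := by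
        have h4 := mem_grid.1 hj i
        have h5 := mem_grid.1 hk i
        rw [Finset.mem_Ioc] at h4 h5
        refine ((eq_wrap_iff (hm.trans (D.ext.le_halfPeriod P.m)) ?_).2 ?_).symm
        · rw [he, Extension.halfPeriod, Finset.mem_Ioc]
          push_cast
          constructor <;> lia
        · simp
      have h6 := hn i
      rw [h3, sub_self, he, Extension.halfPeriod] at h6
      have h7 : (2 * ((2 * P.m : ℕ) : ℤ)) ≠ 0 := by lia
      exact (mul_eq_zero.1 h6.symm).resolve_left h7
    simp only [h2, Int.cast_zero, mul_zero, zero_mul]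
    congr 1
    funext i
    simp

/-- Consistency of the discrete kernel. -/
lemma Data.Admissible.exists_sum_abs_setIntegral_sub_wPad_le (hd : 1 ≤ d) (hD : D.Admissible) :
    ∃ C : ℝ, 0 ≤ C ∧ ∀ P : Params, 1 ≤ P.m → ∀ k ∈ grid d P.m, ∀ y ∈ cell (D.h P) k,
      ∑ j ∈ grid d P.m, |(∫ x in cell (D.h P) j, D.wExt (x - y)) -
        D.h P ^ d * D.wPad P (wrapIdx (D.ext.halfPeriod P.m) (j - k))| ≤ C * D.h P := by
  obtain ⟨C₁, hC₁, h₁⟩ := hD.exists_sum_lintegral_wExt_translate_le hd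
  obtain ⟨C₂, hC₂, h₂⟩ := hD.exists_sum_abs_sub_wPad_le hd
  refine ⟨C₁ + C₂, by positivity, fun P hm k hk y hy => ?_⟩
  have hh := D.h_pos hD.L_pos hm
  have hle := D.ext.le_halfPeriod P.m
  set p := D.ext.halfPeriod P.m with hp
  -- The offset of `y` from the upper corner of its cell has coordinates in `[0, h]`. It is the only
  -- discrepancy between `x - y` and the mesh, and the translation estimate absorbs it.
  set v : Fin d → ℝ := fun i => k i * D.h P - y i with hv
  have hvn : ‖v‖ ≤ D.h P := by
    refine (pi_norm_le_iff_of_nonneg hh.le).2 fun i => ?_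
    obtain ⟨h3, h4⟩ := mem_cell.1 hy i
    rw [Real.norm_eq_abs, abs_le, hv]
    constructor <;> linarith
  have hi : ∀ l a, IntegrableOn (fun z => D.wExt (z + a)) (cell (D.h P) l) := fun l a =>
    hD.integrableOn_wExt_add a (volume_cell_lt_top hh l)
  have hi0 : ∀ l, IntegrableOn (fun z => D.wExt z) (cell (D.h P) l) := fun l => by
    simpa using hi l 0
  have hA : ∑ l ∈ grid d p, |∫ z in cell (D.h P) l, (D.wExt (z + v) - D.wExt z)| ≤
      C₁ * D.h P := by
    rw [← ENNReal.ofReal_le_ofReal_iff (by positivity),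
      ENNReal.ofReal_sum_of_nonneg fun _ _ => abs_nonneg _]
    refine le_trans (Finset.sum_le_sum fun l _ => ?_) (h₁ P hm v hvn)
    rw [← Real.enorm_eq_ofReal_abs]
    exact enorm_integral_le_lintegral_enorm _
  set F : (Fin d → ℤ) → ℝ := fun l =>
    |(∫ z in cell (D.h P) l, (D.wExt (z + v) - D.wExt z))| +
      |(∫ z in cell (D.h P) l, D.wExt z) - D.h P ^ d * D.wPad P l| with hF
  have hF0 : ∀ l, 0 ≤ F l := fun l => add_nonneg (abs_nonneg _) (abs_nonneg _)
  have h3 : ∀ j ∈ grid d P.m, |(∫ x in cell (D.h P) j, D.wExt (x - y)) -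
      D.h P ^ d * D.wPad P (wrapIdx p (j - k))| ≤ F (wrapIdx p (j - k)) := fun j hj => by
    rw [D.setIntegral_wExt_sub hD hm hj hk y, hF]
    simp only
    rw [integral_sub (hi _ v) (hi0 _)]
    refine le_trans (le_of_eq ?_) (abs_add_le _ _)
    congr 1
    ring
  refine (Finset.sum_le_sum h3).trans ((sum_comp_le_of_injOn (wrapIdx_sub_injOn hle k)
    (fun j _ => wrapIdx_mem (hm.trans hle) _) hF0).trans ?_)
  rw [hF, Finset.sum_add_distrib, add_mul]
  exact add_le_add hA (h₂ P hm)

end DiscreteKernel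

/-! ### Consistency of the nonlocal operator -/

section Nonlocal

variable {d : ℕ} {D : Data d}

/-- The index of the cell that contains `x`. -/
def cellIdx (h : ℝ) (x : Fin d → ℝ) : Fin d → ℤ := fun i => ⌈x i / h⌉

lemma measurable_comp_cellIdx {α : Type*} [MeasurableSpace α] (h : ℝ) (U : (Fin d → ℤ) → α) :
    Measurable fun x : Fin d → ℝ => U (cellIdx h x) := by
  have : Measurable (cellIdx h : (Fin d → ℝ) → Fin d → ℤ) :=
    measurable_pi_lambda _ fun i => by
      have h1 : Measurable fun x : Fin d → ℝ => x i := measurable_pi_apply i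
      exact (h1.div_const h).ceil
  exact (Measurable.of_discrete (f := U)).comp this

lemma cellIdx_of_mem {h : ℝ} (hh : 0 < h) {j : Fin d → ℤ} {x : Fin d → ℝ} (hx : x ∈ cell h j) :
    cellIdx h x = j := ceil_of_mem_cell hh hx

lemma Data.cellIdx_mem (hL : 0 < D.L) {P : Params} (hm : 1 ≤ P.m) {x : Fin d → ℝ} (hx : x ∈ D.Ω) :
    cellIdx (D.h P) x ∈ grid d P.m := by
  rw [D.Ω_eq hm] at hx
  exact ceil_mem_grid (D.h_pos hL hm) hx

instance (D : Data d) : IsFiniteMeasure (volume.restrict D.Ω) :=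
  isFiniteMeasure_restrict.2 D.volume_Ω_lt_top.ne

lemma Data.Admissible.aestronglyMeasurable_wExt_sub (hD : D.Admissible) :
    AEStronglyMeasurable (fun p : (Fin d → ℝ) × (Fin d → ℝ) => D.wExt (p.1 - p.2))
      ((volume.restrict D.Ω).prod (volume.restrict D.Ω)) := by
  have h := hD.aestronglyMeasurable_wExt.comp_quasiMeasurePreserving
    (quasiMeasurePreserving_sub volume volume)
  rw [Measure.prod_restrict]
  exact h.restrict

lemma Data.Admissible.integrable_wExt_sub (hD : D.Admissible) :
    Integrable (fun p : (Fin d → ℝ) × (Fin d → ℝ) => D.wExt (p.1 - p.2))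
      ((volume.restrict D.Ω).prod (volume.restrict D.Ω)) := by
  obtain ⟨W, hW, h1, h2⟩ := hD.exists_lintegral_wExt_le
  have hm := hD.aestronglyMeasurable_wExt_sub
  refine ⟨hm, ?_⟩
  rw [HasFiniteIntegral, lintegral_prod _ hm.enorm]
  refine (lintegral_mono fun x => h1 x).trans_lt ?_
  rw [setLIntegral_const]
  exact ENNReal.mul_lt_top ENNReal.ofReal_lt_top D.volume_Ω_lt_top

/-- This is Tonelli's theorem in the manner of a Schur test: the term in `y` is integrated first in
`x`, the term in `x` first in `y`, and each time the kernel contributes at most `W`. -/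
lemma Data.Admissible.lintegral_wExt_mul_le (hD : D.Admissible) {W : ℝ}
    (h1 : ∀ x, ∫⁻ y in D.Ω, ‖D.wExt (x - y)‖ₑ ≤ ENNReal.ofReal W)
    (h2 : ∀ y, ∫⁻ x in D.Ω, ‖D.wExt (x - y)‖ₑ ≤ ENNReal.ofReal W) {g₁ g₂ : (Fin d → ℝ) → ENNReal}
    (hg₁ : AEMeasurable g₁ (volume.restrict D.Ω)) (hg₂ : AEMeasurable g₂ (volume.restrict D.Ω)) :
    ∫⁻ x in D.Ω, ∫⁻ y in D.Ω, ‖D.wExt (x - y)‖ₑ * (g₁ y + g₂ x) ≤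
      ENNReal.ofReal W * ((∫⁻ x in D.Ω, g₁ x) + ∫⁻ x in D.Ω, g₂ x) := by
  have hm := hD.aestronglyMeasurable_wExt_sub.enorm
  have hm1 : AEMeasurable (fun p : (Fin d → ℝ) × (Fin d → ℝ) => ‖D.wExt (p.1 - p.2)‖ₑ * g₁ p.2)
      ((volume.restrict D.Ω).prod (volume.restrict D.Ω)) :=
    hm.mul (hg₁.comp_quasiMeasurePreserving Measure.quasiMeasurePreserving_snd)
  have hm2 : AEMeasurable (fun p : (Fin d → ℝ) × (Fin d → ℝ) => ‖D.wExt (p.1 - p.2)‖ₑ * g₂ p.1)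
      ((volume.restrict D.Ω).prod (volume.restrict D.Ω)) :=
    hm.mul (hg₂.comp_quasiMeasurePreserving Measure.quasiMeasurePreserving_fst)
  have e1 : ∫⁻ x in D.Ω, ∫⁻ y in D.Ω, ‖D.wExt (x - y)‖ₑ * g₁ y ≤
      ENNReal.ofReal W * ∫⁻ x in D.Ω, g₁ x := by
    rw [lintegral_lintegral_swap hm1, ← lintegral_const_mul'' _ hg₁]
    refine lintegral_mono fun y => ?_
    have hmy : AEMeasurable (fun x => ‖D.wExt (x - y)‖ₑ) (volume.restrict D.Ω) :=
      (hD.aestronglyMeasurable_wExt.comp_measurePreserving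
        (measurePreserving_sub_right volume y)).restrict.enorm
    simp only
    rw [lintegral_mul_const'' _ hmy]
    gcongr
    exact h2 y
  have e2 : ∫⁻ x in D.Ω, ∫⁻ y in D.Ω, ‖D.wExt (x - y)‖ₑ * g₂ x ≤
      ENNReal.ofReal W * ∫⁻ x in D.Ω, g₂ x := by
    rw [← lintegral_const_mul'' _ hg₂]
    refine lintegral_mono fun x => ?_
    have hmx : AEMeasurable (fun y => ‖D.wExt (x - y)‖ₑ) (volume.restrict D.Ω) :=
      (hD.aestronglyMeasurable_wExt.comp_measurePreserving
        (Measure.measurePreserving_sub_left volume x)).restrict.enorm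
    simp only
    rw [lintegral_mul_const'' _ hmx]
    gcongr
    exact h1 x
  rw [mul_add]
  refine le_trans (le_of_eq ?_) (add_le_add e1 e2)
  rw [← lintegral_prod _ hm1, ← lintegral_prod _ hm2, ← lintegral_add_left' hm1, lintegral_prod]
  · simp only [mul_add]
  · exact (hm1.add hm2)

lemma Data.sum_setIntegral_cell (hL : 0 < D.L) {P : Params} (hm : 1 ≤ P.m)
    {g : (Fin d → ℝ) → ℝ} (hg : IntegrableOn g D.Ω) :
    ∑ j ∈ grid d P.m, ∫ x in cell (D.h P) j, g x = ∫ x in D.Ω, g x := by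
  rw [D.Ω_eq hm] at hg ⊢
  exact (setIntegral_cube (D.h_pos hL hm) P.m hg).symm

lemma Data.h_pow_mul_card (D : Data d) {P : Params} (hm : 1 ≤ P.m) :
    ((grid d P.m).card : ℝ) * D.h P ^ d = D.L ^ d := by
  rw [card_grid]
  push_cast
  rw [← mul_pow, D.two_mul_h hm]

/-- The nonlocal operator of a piecewise constant integrand. -/
lemma Data.sum_abs_nonlocal_const_sub_le (hD : D.Admissible) {P : Params} (hm : 1 ≤ P.m) {C : ℝ}
    (hC : ∀ k ∈ grid d P.m, ∀ y ∈ cell (D.h P) k,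
      ∑ j ∈ grid d P.m, |(∫ x in cell (D.h P) j, D.wExt (x - y)) -
        D.h P ^ d * D.wPad P (wrapIdx (D.ext.halfPeriod P.m) (j - k))| ≤ C * D.h P)
    {β : (Fin d → ℤ) → (Fin d → ℤ) → ℝ} {R : ℝ} (hR : 0 ≤ R)
    (hβ : ∀ j ∈ grid d P.m, ∀ k ∈ grid d P.m, |β j k| ≤ R) :
    ∑ j ∈ grid d P.m, |(∫ x in cell (D.h P) j, ∫ y in D.Ω,
        D.wExt (x - y) * β (cellIdx (D.h P) x) (cellIdx (D.h P) y)) -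
      D.h P ^ d * (D.h P ^ d * ∑ k ∈ grid d P.m,
        D.wPad P (wrapIdx (D.ext.halfPeriod P.m) (j - k)) * β j k)| ≤
      R * C * D.L ^ d * D.h P := by
  have hh := D.h_pos hD.L_pos hm
  have hint := hD.integrable_wExt_sub
  set W : (Fin d → ℤ) → (Fin d → ℤ) → ℝ := fun j k =>
    D.wPad P (wrapIdx (D.ext.halfPeriod P.m) (j - k)) with hW
  have hsub := fun j (hj : j ∈ grid d P.m) => D.cell_subset_Ω hD.L_pos hm hj
  have hrestr : ∀ j ∈ grid d P.m, ∀ k ∈ grid d P.m,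
      Integrable (fun p : (Fin d → ℝ) × (Fin d → ℝ) => D.wExt (p.1 - p.2))
        ((volume.restrict (cell (D.h P) j)).prod (volume.restrict (cell (D.h P) k))) := by
    intro j hj k hk
    rw [Measure.prod_restrict] at hint ⊢
    exact IntegrableOn.mono_set hint (prod_mono (hsub j hj) (hsub k hk))
  have hy : ∀ x, IntegrableOn (fun y => D.wExt (x - y)) D.Ω := fun x => by
    obtain ⟨W, hW, h1, -⟩ := hD.exists_lintegral_wExt_le
    exact ⟨(hD.aestronglyMeasurable_wExt.comp_measurePreserving
        (Measure.measurePreserving_sub_left volume x)).restrict,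
      (h1 x).trans_lt ENNReal.ofReal_lt_top⟩
  -- On a product of two cells `β` is constant. The integration over `x` is moved inside, because
  -- the consistency hypothesis `hC` is stated for fixed `y`.
  have hstep : ∀ j ∈ grid d P.m, (∫ x in cell (D.h P) j, ∫ y in D.Ω,
        D.wExt (x - y) * β (cellIdx (D.h P) x) (cellIdx (D.h P) y)) =
      ∑ k ∈ grid d P.m, β j k * ∫ y in cell (D.h P) k, ∫ x in cell (D.h P) j, D.wExt (x - y) := by
    intro j hj
    have h1 : ∀ x ∈ cell (D.h P) j, ∫ y in D.Ω,
        D.wExt (x - y) * β (cellIdx (D.h P) x) (cellIdx (D.h P) y) =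
        ∑ k ∈ grid d P.m, β j k * ∫ y in cell (D.h P) k, D.wExt (x - y) := by
      intro x hx
      rw [cellIdx_of_mem hh hx, ← D.sum_setIntegral_cell hD.L_pos hm]
      · refine Finset.sum_congr rfl fun k _ => ?_
        rw [← integral_const_mul]
        refine setIntegral_congr_fun (measurableSet_cell _ _) fun y hy => ?_
        simp only [cellIdx_of_mem hh hy]
        ring
      · refine Integrable.mul_bdd (c := R) (hy x)
          (measurable_comp_cellIdx _ fun k => β j k).aestronglyMeasurable ?_
        exact (ae_restrict_iff' D.measurableSet_Ω).2 (Filter.Eventually.of_forall fun y hy =>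
          hβ j hj _ (D.cellIdx_mem hD.L_pos hm hy))
    rw [setIntegral_congr_fun (measurableSet_cell _ _) h1, integral_finsetSum]
    · refine Finset.sum_congr rfl fun k hk => ?_
      rw [integral_const_mul, integral_integral_swap (hrestr j hj k hk)]
    · exact fun k hk => (hrestr j hj k hk).integral_prod_left.const_mul _
  have hkint : ∀ j ∈ grid d P.m, ∀ k ∈ grid d P.m,
      IntegrableOn (fun y => (∫ x in cell (D.h P) j, D.wExt (x - y)) - D.h P ^ d * W j k)
        (cell (D.h P) k) := fun j hj k hk =>
    (hrestr j hj k hk).integral_prod_right.sub (integrableOn_const (volume_cell_lt_top hh k).ne)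
  have hdiff : ∀ j ∈ grid d P.m, |(∫ x in cell (D.h P) j, ∫ y in D.Ω,
        D.wExt (x - y) * β (cellIdx (D.h P) x) (cellIdx (D.h P) y)) -
      D.h P ^ d * (D.h P ^ d * ∑ k ∈ grid d P.m, W j k * β j k)| ≤
      ∑ k ∈ grid d P.m, R * ∫ y in cell (D.h P) k,
        |(∫ x in cell (D.h P) j, D.wExt (x - y)) - D.h P ^ d * W j k| := by
    intro j hj
    rw [hstep j hj, Finset.mul_sum, Finset.mul_sum, ← Finset.sum_sub_distrib]
    refine (Finset.abs_sum_le_sum_abs _ _).trans (Finset.sum_le_sum fun k hk => ?_)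
    have h1 : β j k * (∫ y in cell (D.h P) k, ∫ x in cell (D.h P) j, D.wExt (x - y)) -
        D.h P ^ d * (D.h P ^ d * (W j k * β j k)) =
        β j k * ∫ y in cell (D.h P) k,
          ((∫ x in cell (D.h P) j, D.wExt (x - y)) - D.h P ^ d * W j k) := by
      rw [integral_sub (hrestr j hj k hk).integral_prod_right
        (integrableOn_const (volume_cell_lt_top hh k).ne), setIntegral_const,
        volume_real_cell hh, smul_eq_mul]
      ring
    rw [h1, abs_mul]
    exact mul_le_mul (hβ j hj k hk) abs_integral_le_integral_abs (abs_nonneg _) hR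
  refine (Finset.sum_le_sum hdiff).trans ?_
  rw [Finset.sum_comm]
  -- Summing over `j` under the integral in `y` makes `hC` applicable pointwise; each cell `k`
  -- contributes `R h^d (C h)`, and the cell volumes add up to `L^d`.
  have hk : ∀ k ∈ grid d P.m, ∑ j ∈ grid d P.m, R * ∫ y in cell (D.h P) k,
      |(∫ x in cell (D.h P) j, D.wExt (x - y)) - D.h P ^ d * W j k| ≤
      R * (D.h P ^ d * (C * D.h P)) := by
    intro k hk
    rw [← Finset.mul_sum, ← integral_finsetSum _ fun j hj => (hkint j hj k hk).abs]
    gcongr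
    refine (setIntegral_mono_on (integrable_finsetSum _ fun j hj => (hkint j hj k hk).abs)
      (integrableOn_const (volume_cell_lt_top hh k).ne) (measurableSet_cell _ _)
      fun y hy => hC k hk y hy).trans ?_
    rw [setIntegral_const, volume_real_cell hh, smul_eq_mul]
  refine (Finset.sum_le_card_nsmul _ _ _ hk).trans (le_of_eq ?_)
  rw [nsmul_eq_mul, ← D.h_pow_mul_card hm]
  ring

/-- Consistency of the nonlocal operator at a fixed time. -/
lemma Data.sum_abs_nonlocal_sub_le (hD : D.Admissible) {P : Params} (hm : 1 ≤ P.m) {C W : ℝ}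
    (hC : ∀ k ∈ grid d P.m, ∀ y ∈ cell (D.h P) k,
      ∑ j ∈ grid d P.m, |(∫ x in cell (D.h P) j, D.wExt (x - y)) -
        D.h P ^ d * D.wPad P (wrapIdx (D.ext.halfPeriod P.m) (j - k))| ≤ C * D.h P)
    (hW : 0 ≤ W)
    (h1 : ∀ x, ∫⁻ y in D.Ω, ‖D.wExt (x - y)‖ₑ ≤ ENNReal.ofReal W)
    (h2 : ∀ y, ∫⁻ x in D.Ω, ‖D.wExt (x - y)‖ₑ ≤ ENNReal.ofReal W)
    {B : ℝ → ℝ} (hB : Continuous B) {S R Λ : ℝ} (hR : 0 ≤ R) (hΛ : 0 ≤ Λ)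
    (hBR : ∀ s, |s| ≤ S → |B s| ≤ R)
    (hBΛ : ∀ s s', |s| ≤ S → |s'| ≤ S → |B s - B s'| ≤ Λ * |s - s'|)
    {v : (Fin d → ℝ) → ℝ} (hv : AEStronglyMeasurable v (volume.restrict D.Ω))
    (hvS : ∀ᵐ x ∂volume.restrict D.Ω, |v x| ≤ S / 2)
    {U q : (Fin d → ℤ) → ℝ}
    (hUq : ∀ j ∈ grid d P.m, ∀ k ∈ grid d P.m, |U k - q j| ≤ S) :
    ∑ j ∈ grid d P.m, |(∫ x in cell (D.h P) j, ∫ y in D.Ω, D.wExt (x - y) * B (v y - v x)) -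
      D.h P ^ d * (D.h P ^ d * ∑ k ∈ grid d P.m,
        D.wPad P (wrapIdx (D.ext.halfPeriod P.m) (j - k)) * B (U k - q j))| ≤
      Λ * W * (2 * (∫ x in D.Ω, |v x - U (cellIdx (D.h P) x)|) +
        D.h P ^ d * ∑ j ∈ grid d P.m, |U j - q j|) + R * C * D.L ^ d * D.h P := by
  have hh := D.h_pos hD.L_pos hm
  set μ := volume.restrict D.Ω with hμ
  set J := cellIdx (d := d) (D.h P) with hJ
  have hint := hD.integrable_wExt_sub
  have hJΩ : ∀ᵐ x ∂μ, J x ∈ grid d P.m := (ae_restrict_iff' D.measurableSet_Ω).2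
    (Filter.Eventually.of_forall fun x hx => D.cellIdx_mem hD.L_pos hm hx)
  have hfst : ∀ {p : (Fin d → ℝ) → Prop}, (∀ᵐ x ∂μ, p x) → ∀ᵐ z ∂μ.prod μ, p z.1 := fun hp =>
    Measure.quasiMeasurePreserving_fst.ae hp
  have hsnd : ∀ {p : (Fin d → ℝ) → Prop}, (∀ᵐ x ∂μ, p x) → ∀ᵐ z ∂μ.prod μ, p z.2 := fun hp =>
    Measure.quasiMeasurePreserving_snd.ae hp
  have hb1 : ∀ᵐ z ∂μ.prod μ, |v z.2 - v z.1| ≤ S := by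
    filter_upwards [hfst hvS, hsnd hvS] with z hz1 hz2
    exact (abs_sub _ _).trans (by linarith)
  have hb2 : ∀ᵐ z ∂μ.prod μ, |U (J z.2) - q (J z.1)| ≤ S := by
    filter_upwards [hfst hJΩ, hsnd hJΩ] with z hz1 hz2 using hUq _ hz1 _ hz2
  have hmv : AEStronglyMeasurable (fun z : (Fin d → ℝ) × (Fin d → ℝ) => B (v z.2 - v z.1))
      (μ.prod μ) := hB.comp_aestronglyMeasurable (hv.comp_snd.sub hv.comp_fst)
  have hmU : AEStronglyMeasurable (fun z : (Fin d → ℝ) × (Fin d → ℝ) => B (U (J z.2) - q (J z.1)))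
      (μ.prod μ) := (hB.measurable.comp (((measurable_comp_cellIdx _ U).comp measurable_snd).sub
        ((measurable_comp_cellIdx _ q).comp measurable_fst))).aestronglyMeasurable
  have hi1 : Integrable (fun z : (Fin d → ℝ) × (Fin d → ℝ) =>
      D.wExt (z.1 - z.2) * B (v z.2 - v z.1)) (μ.prod μ) :=
    hint.mul_bdd (c := R) hmv (hb1.mono fun z hz => hBR _ hz)
  have hi2 : Integrable (fun z : (Fin d → ℝ) × (Fin d → ℝ) =>
      D.wExt (z.1 - z.2) * B (U (J z.2) - q (J z.1))) (μ.prod μ) :=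
    hint.mul_bdd (c := R) hmU (hb2.mono fun z hz => hBR _ hz)
  set F : (Fin d → ℝ) → ℝ := fun x => ∫ y in D.Ω, D.wExt (x - y) * B (v y - v x) with hF
  set G : (Fin d → ℝ) → ℝ := fun x => ∫ y in D.Ω, D.wExt (x - y) * B (U (J y) - q (J x)) with hG
  have hFi : IntegrableOn F D.Ω := hi1.integral_prod_left
  have hGi : IntegrableOn G D.Ω := hi2.integral_prod_left
  have hsub := fun j (hj : j ∈ grid d P.m) => D.cell_subset_Ω hD.L_pos hm hj
  have hFGi : IntegrableOn (fun x => |F x - G x|) D.Ω := (hFi.sub hGi).abs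
  have hUb : ∃ Z, ∀ᵐ x ∂μ, |U (J x)| ≤ Z := by
    refine ⟨∑ j ∈ grid d P.m, |U j|, hJΩ.mono fun x hx => ?_⟩
    exact Finset.single_le_sum (f := fun j => |U j|) (fun _ _ => abs_nonneg _) hx
  have hqb : ∃ Z, ∀ᵐ x ∂μ, |q (J x)| ≤ Z := by
    refine ⟨∑ j ∈ grid d P.m, |q j|, hJΩ.mono fun x hx => ?_⟩
    exact Finset.single_le_sum (f := fun j => |q j|) (fun _ _ => abs_nonneg _) hx
  have hvi : Integrable v μ := Integrable.of_bound hv (S / 2) hvS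
  have hUi : Integrable (fun x => U (J x)) μ := by
    obtain ⟨Z, hZ⟩ := hUb
    exact Integrable.of_bound (measurable_comp_cellIdx _ U).aestronglyMeasurable Z hZ
  have hqi : Integrable (fun x => q (J x)) μ := by
    obtain ⟨Z, hZ⟩ := hqb
    exact Integrable.of_bound (measurable_comp_cellIdx _ q).aestronglyMeasurable Z hZ
  have hvUi : Integrable (fun x => |v x - U (J x)|) μ := (hvi.sub hUi).abs
  have hUqi : Integrable (fun x => |U (J x) - q (J x)|) μ := (hUi.sub hqi).abs
  -- The arguments of `B` in `F` and `G` differ by at most `|v - U|` at `y`, `|v - U|` at `x` and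
  -- `|U - q|` at `x`. This explains the factor two and the single quantization term.
  have hFG : ∫ x in D.Ω, |F x - G x| ≤ Λ * W * (2 * (∫ x in D.Ω, |v x - U (J x)|) +
      ∫ x in D.Ω, |U (J x) - q (J x)|) := by
    have hrhs : 0 ≤ Λ * W * (2 * (∫ x in D.Ω, |v x - U (J x)|) +
        ∫ x in D.Ω, |U (J x) - q (J x)|) := by
      have e1 : 0 ≤ ∫ x in D.Ω, |v x - U (J x)| := integral_nonneg fun _ => abs_nonneg _
      have e2 : 0 ≤ ∫ x in D.Ω, |U (J x) - q (J x)| := integral_nonneg fun _ => abs_nonneg _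
      positivity
    rw [← ENNReal.ofReal_le_ofReal_iff hrhs, ofReal_integral_eq_lintegral_ofReal hFGi
      (Filter.Eventually.of_forall fun x => abs_nonneg _)]
    have hpt : ∀ᵐ x ∂μ, ENNReal.ofReal |F x - G x| ≤ ∫⁻ y in D.Ω, ‖D.wExt (x - y)‖ₑ *
        (ENNReal.ofReal (Λ * |v y - U (J y)|) +
          ENNReal.ofReal (Λ * (|v x - U (J x)| + |U (J x) - q (J x)|))) := by
      filter_upwards [hi1.prod_right_ae, hi2.prod_right_ae, Measure.ae_ae_of_ae_prod hb1,
        Measure.ae_ae_of_ae_prod hb2] with x hx1 hx2 hx3 hx4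
      rw [hF, hG]
      simp only
      rw [← integral_sub hx1 hx2, ← Real.enorm_eq_ofReal_abs]
      refine (enorm_integral_le_lintegral_enorm _).trans (lintegral_mono_ae ?_)
      filter_upwards [hx3, hx4] with y hy3 hy4
      rw [← mul_sub, enorm_mul, ← ENNReal.ofReal_add (by positivity) (by positivity),
        Real.enorm_eq_ofReal_abs (B _ - B _)]
      gcongr
      refine (hBΛ _ _ hy3 hy4).trans ?_
      rw [← mul_add]
      gcongr
      have e : v y - v x - (U (J y) - q (J x)) =
          (v y - U (J y)) + (-(v x - U (J x)) + -(U (J x) - q (J x))) := by ring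
      rw [e]
      refine (abs_add_le _ _).trans (add_le_add le_rfl ((abs_add_le _ _).trans ?_))
      rw [abs_neg, abs_neg]
    refine (lintegral_mono_ae hpt).trans ?_
    have hA1 : Integrable (fun x => Λ * |v x - U (J x)|) μ := hvUi.const_mul Λ
    have hA2 : Integrable (fun x => Λ * (|v x - U (J x)| + |U (J x) - q (J x)|)) μ :=
      (hvUi.add hUqi).const_mul Λ
    refine (hD.lintegral_wExt_mul_le h1 h2 hA1.aestronglyMeasurable.aemeasurable.ennreal_ofReal
      hA2.aestronglyMeasurable.aemeasurable.ennreal_ofReal).trans (le_of_eq ?_)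
    rw [← ofReal_integral_eq_lintegral_ofReal hA1
        (Filter.Eventually.of_forall fun x => by positivity),
      ← ofReal_integral_eq_lintegral_ofReal hA2
        (Filter.Eventually.of_forall fun x => by positivity),
      ← ENNReal.ofReal_add (integral_nonneg fun x => by positivity)
        (integral_nonneg fun x => by positivity), ← ENNReal.ofReal_mul hW,
      integral_const_mul, integral_const_mul, integral_add hvUi hUqi]
    congr 1
    ring
  have hUq' : ∫ x in D.Ω, |U (J x) - q (J x)| = D.h P ^ d * ∑ j ∈ grid d P.m, |U j - q j| := by
    rw [← D.sum_setIntegral_cell hD.L_pos hm hUqi, Finset.mul_sum]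
    refine Finset.sum_congr rfl fun j _ => ?_
    rw [setIntegral_congr_fun (g := fun _ => |U j - q j|) (measurableSet_cell _ _) fun x hx => by
      simp only [hJ, cellIdx_of_mem hh hx], setIntegral_const, volume_real_cell hh, smul_eq_mul]
  have hG' := D.sum_abs_nonlocal_const_sub_le hD hm hC (β := fun j k => B (U k - q j)) hR
    fun j hj k hk => hBR _ (hUq j hj k hk)
  have hj : ∀ j ∈ grid d P.m, |(∫ x in cell (D.h P) j, F x) -
      D.h P ^ d * (D.h P ^ d * ∑ k ∈ grid d P.m,
        D.wPad P (wrapIdx (D.ext.halfPeriod P.m) (j - k)) * B (U k - q j))| ≤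
      (∫ x in cell (D.h P) j, |F x - G x|) + |(∫ x in cell (D.h P) j, G x) -
      D.h P ^ d * (D.h P ^ d * ∑ k ∈ grid d P.m,
        D.wPad P (wrapIdx (D.ext.halfPeriod P.m) (j - k)) * B (U k - q j))| := fun j hj => by
    have e : ∫ x in cell (D.h P) j, F x = (∫ x in cell (D.h P) j, (F x - G x)) +
        ∫ x in cell (D.h P) j, G x := by
      rw [integral_sub (hFi.mono_set (hsub j hj)) (hGi.mono_set (hsub j hj))]
      ring
    rw [e, add_sub_assoc]
    exact (abs_add_le _ _).trans (add_le_add abs_integral_le_integral_abs le_rfl)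
  refine (Finset.sum_le_sum hj).trans ?_
  rw [Finset.sum_add_distrib, D.sum_setIntegral_cell hD.L_pos hm hFGi, ← hUq']
  exact add_le_add hFG hG'

end Nonlocal

/-! ### The equation integrated in time -/

/-- Composition of a Carathéodory function with a measurable function. -/
lemma aestronglyMeasurable_caratheodory {α : Type*} [MeasurableSpace α] {μ : Measure α}
    {g : α → ℝ → ℝ} (hg : ∀ s, AEStronglyMeasurable (fun z => g z s) μ)
    (hc : ∀ᵐ z ∂μ, Continuous (g z)) {v : α → ℝ} (hv : AEMeasurable v μ) :
    AEStronglyMeasurable (fun z => g z (v z)) μ := by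
  wlog hm : Measurable v generalizing v
  · refine (this hv.measurable_mk.aemeasurable hv.measurable_mk).congr ?_
    filter_upwards [hv.ae_eq_mk] with z hz using by rw [hz]
  -- `v` is rounded down to multiples of `1 / (n + 1)`. The composition is then measurable on each
  -- of countably many level sets, and continuity in the second variable allows the passage to the
  -- limit.
  refine aestronglyMeasurable_of_tendsto_ae Filter.atTop
    (f := fun (n : ℕ) z => g z (⌊v z * (n + 1)⌋ / (n + 1))) (fun n => ?_) ?_
  · have hmf : Measurable fun z => ⌊v z * (n + 1)⌋ := (hm.mul_const _).floor
    have hU : ⋃ k : ℤ, (fun z => ⌊v z * (n + 1)⌋) ⁻¹' {k} = univ := by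
      ext z; simp
    rw [← Measure.restrict_univ (μ := μ), ← hU, aestronglyMeasurable_iUnion_iff]
    intro k
    refine (hg (k / (n + 1))).restrict.congr ?_
    refine (ae_restrict_iff' (hmf (measurableSet_singleton k))).2
      (Filter.Eventually.of_forall fun z hz => ?_)
    simp only [mem_preimage, mem_singleton_iff] at hz
    simp only [hz]
  · filter_upwards [hc] with z hz
    refine (hz.tendsto (v z)).comp ?_
    have h1 : Filter.Tendsto (fun n : ℕ => (1 : ℝ) / (n + 1)) Filter.atTop (nhds 0) :=
      tendsto_one_div_add_atTop_nhds_zero_nat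
    refine tendsto_of_tendsto_of_tendsto_of_le_of_le (g := fun n : ℕ => v z - 1 / ((n : ℝ) + 1))
      (h := fun _ => v z) ?_ tendsto_const_nhds (fun n => ?_) fun n => ?_
    · simpa using h1.const_sub (v z)
    · have hn : (0 : ℝ) < n + 1 := by positivity
      simp only
      rw [le_div_iff₀ hn, sub_mul, div_mul_cancel₀ _ hn.ne']
      linarith [Int.lt_floor_add_one (v z * (n + 1))]
    · have hn : (0 : ℝ) < n + 1 := by positivity
      simp only
      rw [div_le_iff₀ hn]
      exact Int.floor_le _

lemma quasiMeasurePreserving_prodMap_id {α β γ : Type*} [MeasurableSpace α] [MeasurableSpace β]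
    [MeasurableSpace γ] {μ : Measure α} {ν : Measure β} {ρ : Measure γ} [SFinite μ] [SFinite ν]
    [SFinite ρ] {φ : α → β} (hφ : Measure.QuasiMeasurePreserving φ μ ν) :
    Measure.QuasiMeasurePreserving (fun p : α × γ => (φ p.1, p.2)) (μ.prod ρ) (ν.prod ρ) := by
  refine ⟨(hφ.measurable.comp measurable_fst).prodMk measurable_snd, ?_⟩
  have : Measure.map (fun p : α × γ => (φ p.1, p.2)) (μ.prod ρ) = (Measure.map φ μ).prod ρ := by
    have h := Measure.map_prod_map μ ρ hφ.measurable measurable_id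
    rw [Measure.map_id] at h
    exact h.symm
  rw [this]
  exact hφ.absolutelyContinuous.prod Measure.AbsolutelyContinuous.rfl

section Evolution

variable {d : ℕ} {D : Data d}

lemma Data.restrict_QT (D : Data d) : (volume : Measure (ℝ × (Fin d → ℝ))).restrict D.QT =
    (volume.restrict (Ioo 0 D.T)).prod (volume.restrict D.Ω) := by
  rw [Measure.prod_restrict, ← Measure.volume_eq_prod]
  rfl

lemma Data.Admissible.ae_continuous_f (hD : D.Admissible) :
    ∀ᵐ z ∂volume.restrict D.QT, Continuous (D.f z.1 z.2) := by
  have h : ∀ᵐ z ∂volume.restrict D.QT, ∀ n : ℕ, ∃ K : ℝ, ∀ s s' : ℝ, |s| ≤ n → |s'| ≤ n →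
      |D.f z.1 z.2 s - D.f z.1 z.2 s'| ≤ K * |s - s'| := by
    rw [ae_all_iff]
    intro n
    obtain ⟨K, hK⟩ := hD.f_lip n
    exact hK.mono fun z hz => ⟨K, hz⟩
  filter_upwards [h] with z hz
  rw [continuous_iff_continuousAt]
  intro s
  obtain ⟨n, hn⟩ := exists_nat_gt (|s| + 1)
  obtain ⟨K, hK⟩ := hz n
  have hL : LipschitzOnWith (Real.toNNReal K) (D.f z.1 z.2) (Icc (-(n : ℝ)) n) := by
    refine LipschitzOnWith.of_dist_le_mul fun x hx y hy => ?_
    rw [Real.dist_eq, Real.dist_eq]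
    refine (hK x y (abs_le.2 hx) (abs_le.2 hy)).trans ?_
    gcongr
    exact Real.le_coe_toNNReal K
  refine hL.continuousOn.continuousAt (Icc_mem_nhds ?_ ?_)
  · linarith [neg_abs_le s]
  · linarith [le_abs_self s]

/-- On bounded sets the reaction is bounded. -/
lemma Data.Admissible.exists_f_bound (hD : D.Admissible) (R : ℝ) : ∃ F : ℝ, 0 ≤ F ∧
    ∀ᵐ z ∂volume.restrict D.QT, ∀ s, |s| ≤ R → |D.f z.1 z.2 s| ≤ F := by
  obtain ⟨K, hK⟩ := hD.f_lip |R|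
  obtain ⟨Cf, hCf, hf⟩ := hD.f_growth
  refine ⟨Cf + |K| * |R|, by positivity, ?_⟩
  filter_upwards [hK, hf 0] with z hz1 hz2 s hs
  have h1 := hz1 s 0 (hs.trans (le_abs_self R)) (by simp)
  have h2 : |D.f z.1 z.2 s| ≤ |D.f z.1 z.2 s - D.f z.1 z.2 0| + |D.f z.1 z.2 0| := by
    have := abs_add_le (D.f z.1 z.2 s - D.f z.1 z.2 0) (D.f z.1 z.2 0)
    simpa using this
  have h3 : K * |s - 0| ≤ |K| * |R| := by
    rw [sub_zero]
    exact mul_le_mul (le_abs_self K) (hs.trans (le_abs_self R)) (abs_nonneg _) (abs_nonneg _)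
  simp only [abs_zero, add_zero, mul_one] at hz2
  linarith

variable {u : ℝ → (Fin d → ℝ) → ℝ}

lemma Data.IsSolution.aestronglyMeasurable (hu : D.IsSolution u) {t : ℝ} (ht : t ∈ Icc 0 D.T) :
    AEStronglyMeasurable (u t) (volume.restrict D.Ω) := by
  obtain ⟨M, hM⟩ := hu.bv
  exact (hM t ht).1.aestronglyMeasurable

lemma Data.ae_QT (D : Data d) {p : ℝ → (Fin d → ℝ) → Prop}
    (h : ∀ᵐ x ∂volume.restrict D.Ω, ∀ t ∈ Icc 0 D.T, p t x) :
    ∀ᵐ z ∂volume.restrict D.QT, p z.1 z.2 := by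
  rw [D.restrict_QT]
  have h1 := Measure.quasiMeasurePreserving_snd (μ := volume.restrict (Ioo 0 D.T)).ae h
  have h2 : ∀ᵐ t ∂volume.restrict (Ioo 0 D.T), t ∈ Ioo 0 D.T :=
    ae_restrict_mem measurableSet_Ioo
  have h3 := Measure.quasiMeasurePreserving_fst (ν := volume.restrict D.Ω).ae h2
  filter_upwards [h1, h3] with z hz1 hz2 using hz1 z.1 (Ioo_subset_Icc_self hz2)

lemma Data.Admissible.continuous_A (hD : D.Admissible) : Continuous D.A := hD.A_lip.continuous

lemma Data.aestronglyMeasurable_nonlocalIntegrand (hD : D.Admissible) (hu : D.IsSolution u) :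
    AEStronglyMeasurable (fun p : (ℝ × (Fin d → ℝ)) × (Fin d → ℝ) =>
      D.wExt (p.1.2 - p.2) * D.A (u p.1.1 p.2 - u p.1.1 p.1.2))
      (((volume.restrict (Ioo 0 D.T)).prod (volume.restrict D.Ω)).prod (volume.restrict D.Ω)) := by
  have hum := hu.measurable
  rw [D.restrict_QT] at hum
  have h1 : Measure.QuasiMeasurePreserving
      (fun p : (ℝ × (Fin d → ℝ)) × (Fin d → ℝ) => (p.1.2, p.2))
      (((volume.restrict (Ioo 0 D.T)).prod (volume.restrict D.Ω)).prod (volume.restrict D.Ω))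
      ((volume.restrict D.Ω).prod (volume.restrict D.Ω)) :=
    quasiMeasurePreserving_prodMap_id Measure.quasiMeasurePreserving_snd
  have h2 : Measure.QuasiMeasurePreserving
      (fun p : (ℝ × (Fin d → ℝ)) × (Fin d → ℝ) => (p.1.1, p.2))
      (((volume.restrict (Ioo 0 D.T)).prod (volume.restrict D.Ω)).prod (volume.restrict D.Ω))
      ((volume.restrict (Ioo 0 D.T)).prod (volume.restrict D.Ω)) :=
    quasiMeasurePreserving_prodMap_id Measure.quasiMeasurePreserving_fst
  have e1 := hD.aestronglyMeasurable_wExt_sub.comp_quasiMeasurePreserving h1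
  have e2 := hum.comp_quasiMeasurePreserving h2
  have e3 := hum.comp_fst (ν := volume.restrict D.Ω)
  exact e1.mul (hD.continuous_A.comp_aestronglyMeasurable (e2.sub e3))

/-- The nonlocal term is integrable on the space-time cylinder. -/
lemma Data.integrable_nonlocalOp (hD : D.Admissible) (hu : D.IsSolution u) :
    IntegrableOn (fun z : ℝ × (Fin d → ℝ) => D.nonlocalOp (u z.1) z.2) D.QT := by
  obtain ⟨K, hK⟩ := hu.bounded_lip
  obtain ⟨W, hW, hW1, -⟩ := hD.exists_lintegral_wExt_le
  obtain ⟨R, hR⟩ := (isCompact_Icc (a := -(2 * K : ℝ)) (b := 2 * K)).exists_bound_of_continuousOn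
    hD.continuous_A.continuousOn
  have hb := D.ae_QT (hK.mono fun x hx => hx.1)
  have hfin : volume D.QT < ⊤ := by
    rw [Data.QT, Measure.volume_eq_prod, Measure.prod_prod, Real.volume_Ioo]
    exact ENNReal.mul_lt_top ENNReal.ofReal_lt_top D.volume_Ω_lt_top
  have hfm := isFiniteMeasure_restrict.2 hfin.ne
  refine Integrable.of_bound (C := W * |R|) ?_ ?_
  · rw [D.restrict_QT]
    exact (D.aestronglyMeasurable_nonlocalIntegrand hD hu).integral_prod_right'
  · have hx : ∀ᵐ z ∂volume.restrict D.QT, ∀ᵐ y ∂volume.restrict D.Ω,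
        |D.A (u z.1 y - u z.1 z.2)| ≤ |R| := by
      have h0 : ∀ᵐ z ∂volume.restrict D.QT, z.1 ∈ Icc 0 D.T :=
        D.ae_QT (p := fun t _ => t ∈ Icc 0 D.T) (Filter.Eventually.of_forall fun _ _ h => h)
      filter_upwards [hb, h0] with z hz hz0
      filter_upwards [hK] with y hy
      refine (hR _ ?_).trans (le_abs_self R)
      have h1 := abs_le.1 hz
      have h2 := abs_le.1 (hy.1 z.1 hz0)
      constructor <;> linarith
    filter_upwards [hx] with z hz
    rw [← ENNReal.ofReal_le_ofReal_iff (by positivity), ofReal_norm]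
    refine (enorm_integral_le_lintegral_enorm _).trans ?_
    calc _ ≤ ∫⁻ y in D.Ω, ‖D.wExt (z.2 - y)‖ₑ * ENNReal.ofReal |R| := by
          refine lintegral_mono_ae ?_
          filter_upwards [hz] with y hy
          rw [enorm_mul, Real.enorm_eq_ofReal_abs (D.A _)]
          gcongr
      _ = (∫⁻ y in D.Ω, ‖D.wExt (z.2 - y)‖ₑ) * ENNReal.ofReal |R| :=
          lintegral_mul_const' _ _ ENNReal.ofReal_ne_top
      _ ≤ _ := by
          rw [ENNReal.ofReal_mul hW]
          gcongr
          exact hW1 _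

/-- The reaction along a bounded measurable function is integrable on the space-time cylinder. -/
lemma Data.integrable_f_comp (hD : D.Admissible) {v : ℝ × (Fin d → ℝ) → ℝ}
    (hv : AEStronglyMeasurable v (volume.restrict D.QT)) {R : ℝ}
    (hR : ∀ᵐ z ∂volume.restrict D.QT, |v z| ≤ R) :
    IntegrableOn (fun z => D.f z.1 z.2 (v z)) D.QT := by
  obtain ⟨F, hF0, hF⟩ := hD.exists_f_bound R
  have hfin : volume D.QT < ⊤ := by
    rw [Data.QT, Measure.volume_eq_prod, Measure.prod_prod, Real.volume_Ioo]
    exact ENNReal.mul_lt_top ENNReal.ofReal_lt_top D.volume_Ω_lt_top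
  have hfm := isFiniteMeasure_restrict.2 hfin.ne
  refine Integrable.of_bound (C := F) (aestronglyMeasurable_caratheodory
    (fun s => (hD.f_bv s).1.aestronglyMeasurable) hD.ae_continuous_f hv.aemeasurable) ?_
  filter_upwards [hF, hR] with z hz1 hz2 using hz1 _ hz2

lemma Data.integrable_f_u (hD : D.Admissible) (hu : D.IsSolution u) :
    IntegrableOn (fun z : ℝ × (Fin d → ℝ) => D.f z.1 z.2 (u z.1 z.2)) D.QT := by
  obtain ⟨K, hK⟩ := hu.bounded_lip
  exact D.integrable_f_comp hD hu.measurable (D.ae_QT (hK.mono fun x hx => hx.1))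

/-- A half-open time step may contain the time `0`, excluded from the open cylinder, but this is a
null set; almost everywhere statements on the cylinder thus hold on every step. -/
lemma Ico_ae_le_Ioo {T t₁ t₂ : ℝ} (h1 : 0 ≤ t₁) (h2 : t₂ ≤ T) :
    volume.restrict (Ico t₁ t₂) ≤ volume.restrict (Ioo 0 T) :=
  Measure.restrict_mono' (Ioo_ae_eq_Ico.symm.le.trans
    (LE.le.eventuallyLE (Ioo_subset_Ioo h1 h2))) le_rfl

lemma Data.restrict_Ico_prod_le (D : Data d) {t₁ t₂ : ℝ} (h1 : 0 ≤ t₁) (h2 : t₂ ≤ D.T)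
    {S : Set (Fin d → ℝ)} (hS : S ⊆ D.Ω) :
    (volume : Measure (ℝ × (Fin d → ℝ))).restrict (Ico t₁ t₂ ×ˢ S) ≤ volume.restrict D.QT := by
  rw [D.restrict_QT, Measure.volume_eq_prod, ← Measure.prod_restrict]
  exact Measure.prod_mono (Ico_ae_le_Ioo h1 h2) (Measure.restrict_mono hS le_rfl)

/-- The equation integrated in time. -/
lemma Data.IsSolution.sub_eq_integral (hu : D.IsSolution u) :
    ∀ᵐ x ∂volume.restrict D.Ω, ∀ t₁ t₂, 0 ≤ t₁ → t₁ ≤ t₂ → t₂ ≤ D.T →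
      u t₂ x - u t₁ x = ∫ t in Ico t₁ t₂, (D.nonlocalOp (u t) x + D.f t x (u t x)) := by
  obtain ⟨K, hK⟩ := hu.bounded_lip
  filter_upwards [hK, hu.equation] with x hx1 hx2 t₁ t₂ h1 h12 h2
  have hsub : uIcc t₁ t₂ ⊆ Icc 0 D.T := by
    rw [uIcc_of_le h12]; exact Icc_subset_Icc h1 h2
  -- The equation holds only for almost every time. Lipschitz continuity gives absolute continuity,
  -- and hence the fundamental theorem of calculus.
  have hac := (hx1.2.mono hsub).absolutelyContinuousOnInterval
  rw [← hac.integral_deriv_eq_sub, intervalIntegral.integral_of_le h12,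
    ← setIntegral_congr_set Ico_ae_eq_Ioc]
  have hd : ∀ᵐ t ∂volume.restrict (Ico t₁ t₂), HasDerivAt (fun s => u s x)
      (D.nonlocalOp (u t) x + D.f t x (u t x)) t := ae_mono (Ico_ae_le_Ioo h1 h2) hx2
  exact integral_congr_ae (hd.mono fun t ht => ht.deriv)

/-- The equation integrated over a subset of the space-time cylinder. -/
lemma Data.IsSolution.setIntegral_sub_eq (hD : D.Admissible) (hu : D.IsSolution u)
    {t₁ t₂ : ℝ} (h1 : 0 ≤ t₁) (h12 : t₁ ≤ t₂) (h2 : t₂ ≤ D.T)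
    {S : Set (Fin d → ℝ)} (hS : S ⊆ D.Ω) :
    ∫ x in S, (u t₂ x - u t₁ x) = (∫ t in Ico t₁ t₂, ∫ x in S, D.nonlocalOp (u t) x) +
      ∫ z in Ico t₁ t₂ ×ˢ S, D.f z.1 z.2 (u z.1 z.2) := by
  have hle := D.restrict_Ico_prod_le h1 h2 hS
  have hN := Integrable.mono_measure (D.integrable_nonlocalOp hD hu) hle
  have hf := Integrable.mono_measure (D.integrable_f_u hD hu) hle
  have hNf := hN.add hf
  rw [Measure.volume_eq_prod, ← Measure.prod_restrict] at hN hf hNf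
  have e : ∀ᵐ x ∂volume.restrict S, u t₂ x - u t₁ x =
      ∫ t in Ico t₁ t₂, (D.nonlocalOp (u t) x + D.f t x (u t x)) :=
    ae_mono (Measure.restrict_mono hS le_rfl)
      ((hu.sub_eq_integral).mono fun x hx => hx t₁ t₂ h1 h12 h2)
  rw [integral_congr_ae e]
  rw [← integral_integral_swap (f := fun t x => D.nonlocalOp (u t) x + D.f t x (u t x)) hNf,
    integral_integral hNf]
  rw [Measure.volume_eq_prod, ← Measure.prod_restrict]
  rw [integral_add hN hf, integral_prod _ hN]

end Evolution

/-! ### The scheme -/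

section Scheme

variable {d : ℕ} {D : Data d}

/-- A discrete Gronwall inequality. -/
lemma discrete_gronwall {x : ℕ → ℝ} {N : ℕ} {τ a c : ℝ} (hτ : 0 ≤ τ) (ha : 0 ≤ a) (hc : 0 ≤ c)
    (hx : 0 ≤ x 0) (h : ∀ n < N, x (n + 1) ≤ x n + τ * (a * x n + c)) :
    ∀ n ≤ N, x n ≤ Real.exp (a * (N * τ)) * (x 0 + N * τ * c) := by
  -- The induction is run with `n τ` in both factors and the bound is enlarged to `N τ` only
  -- afterwards.
  have key : ∀ n ≤ N, x n ≤ Real.exp (a * (n * τ)) * (x 0 + n * τ * c) := by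
    intro n
    induction n with
    | zero => simp
    | succ n ih =>
      intro hn
      have h1 := ih (by lia)
      have h2 := h n (by lia)
      have h3 : 1 + τ * a ≤ Real.exp (a * τ) := by linarith [Real.add_one_le_exp (a * τ)]
      have h4 : Real.exp (a * ((n + 1 : ℕ) * τ)) = Real.exp (a * τ) * Real.exp (a * (n * τ)) := by
        rw [← Real.exp_add]; congr 1; push_cast; ring
      have h5 : 1 ≤ Real.exp (a * τ) * Real.exp (a * (n * τ)) := by
        rw [← Real.exp_add]; exact Real.one_le_exp (by positivity)
      calc x (n + 1) ≤ (1 + τ * a) * x n + τ * c := by linarith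
        _ ≤ (1 + τ * a) * (Real.exp (a * (n * τ)) * (x 0 + n * τ * c)) + τ * c := by gcongr
        _ ≤ Real.exp (a * τ) * (Real.exp (a * (n * τ)) * (x 0 + n * τ * c)) +
            (Real.exp (a * τ) * Real.exp (a * (n * τ))) * (τ * c) := by
          exact add_le_add (by gcongr) (le_mul_of_one_le_left (by positivity) h5)
        _ = _ := by rw [h4]; push_cast; ring
  intro n hn
  refine (key n hn).trans ?_
  have : (n : ℝ) ≤ N := by exact_mod_cast hn
  gcongr

/-- Rounding `(Cmax - c) / q` to an integer gives the index of a suitable level. The case `q = 0`,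
in which the interval is a single point, has to be treated apart. -/
lemma Params.exists_level_near (P : Params) (hLq : 1 ≤ P.Lq) {c : ℝ}
    (hc : c ∈ Icc P.Cmin P.Cmax) : ∃ i ≤ P.Lq, |c - P.level i| ≤ P.q / 2 := by
  have hLq' : (0 : ℝ) < P.Lq := by exact_mod_cast hLq
  have hq : 0 ≤ P.q := div_nonneg (by linarith [hc.1, hc.2]) hLq'.le
  have hLqq : P.Lq * P.q = P.Cmax - P.Cmin := by rw [Params.q]; field_simp
  rcases hq.eq_or_lt with h0 | hpos
  · refine ⟨0, Nat.zero_le _, ?_⟩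
    rw [← h0, mul_zero] at hLqq
    rw [← h0, Params.level]
    have : c = P.Cmax := by linarith [hc.1, hc.2]
    simp [this]
  · have h1 := abs_le.1 (abs_sub_round ((P.Cmax - c) / P.q))
    set r := round ((P.Cmax - c) / P.q) with hr
    have hy : (P.Cmax - c) / P.q * P.q = P.Cmax - c := by field_simp
    have hy0 : 0 ≤ (P.Cmax - c) / P.q := div_nonneg (by linarith [hc.2]) hpos.le
    have hy1 : (P.Cmax - c) / P.q ≤ P.Lq := by
      rw [div_le_iff₀ hpos]; linarith [hc.1]
    have hr0 : 0 ≤ r := by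
      have : (-1 : ℝ) < r := by linarith [h1.2]
      have : (-1 : ℤ) < r := by exact_mod_cast this
      lia
    have hr1 : r ≤ P.Lq := by
      have : (r : ℝ) < P.Lq + 1 := by linarith [h1.1]
      have : r < P.Lq + 1 := by exact_mod_cast this
      lia
    refine ⟨r.toNat, by lia, ?_⟩
    have hrn : ((r.toNat : ℕ) : ℝ) = r := by exact_mod_cast Int.toNat_of_nonneg hr0
    have e : c - P.level r.toNat = -(((P.Cmax - c) / P.q - r) * P.q) := by
      rw [Params.level, hrn, sub_mul, hy]; ring
    rw [e, abs_neg, abs_mul, abs_of_pos hpos]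
    have := abs_sub_round ((P.Cmax - c) / P.q)
    nlinarith

/-- Comparison with a level near `c` yields the bound. Since `ρ` is arbitrary, the discrete solution
need not stay in the range interval; a nearby admissible value `c` is enough. -/
lemma Params.IsNearest.abs_sub_level_le {P : Params} {ι : ℝ → ℕ} (hι : P.IsNearest ι)
    (hLq : 1 ≤ P.Lq) {c : ℝ} (hc : c ∈ Icc P.Cmin P.Cmax) (ρ : ℝ) :
    |ρ - P.level (ι ρ)| ≤ |ρ - c| + P.q / 2 := by
  obtain ⟨i, hi, hci⟩ := P.exists_level_near hLq hc
  refine ((hι ρ).2 i hi).trans ((abs_sub_le ρ c _).trans ?_)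
  gcongr

lemma Data.τ_pos (hT : 0 < D.T) {P : Params} (hN : 1 ≤ P.N) : 0 < D.τ P := by
  have : (0 : ℝ) < P.N := by exact_mod_cast hN
  rw [Data.τ]; positivity

lemma Data.N_mul_τ (D : Data d) {P : Params} (hN : 1 ≤ P.N) : P.N * D.τ P = D.T := by
  have : (P.N : ℝ) ≠ 0 := by exact_mod_cast (by lia : P.N ≠ 0)
  rw [Data.τ]; field_simp

lemma Data.succ_mul_τ_le (hT : 0 < D.T) {P : Params} (hN : 1 ≤ P.N) {n : ℕ} (hn : n < P.N) :
    ((n : ℝ) + 1) * D.τ P ≤ D.T := by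
  have h1 : (n : ℝ) + 1 ≤ P.N := by exact_mod_cast hn
  have := D.τ_pos hT hN
  calc _ ≤ P.N * D.τ P := by gcongr
    _ = _ := D.N_mul_τ hN

lemma Data.volume_real_Ico_mul_cell (hL : 0 < D.L) {P : Params} (hm : 1 ≤ P.m)
    (hτ : 0 ≤ D.τ P) (n : ℕ) (k : Fin d → ℤ) :
    (volume : Measure (ℝ × (Fin d → ℝ))).real
      (Ico (n * D.τ P) ((n + 1) * D.τ P) ×ˢ cell (D.h P) k) = D.τ P * D.h P ^ d := by
  have hh := D.h_pos hL hm
  rw [Measure.volume_eq_prod, measureReal_prod_prod, volume_real_cell hh, Real.volume_real_Ico]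
  congr 1
  rw [max_eq_left] <;> linarith

lemma Data.abs_setIntegral_f_le (hD : D.Admissible) {P : Params} (hN : 1 ≤ P.N) (hm : 1 ≤ P.m)
    {n : ℕ} (hn : n < P.N) {k : Fin d → ℤ} (hk : k ∈ grid d P.m) {s F : ℝ}
    (hF : ∀ᵐ z ∂volume.restrict D.QT, |D.f z.1 z.2 s| ≤ F) :
    |∫ z in Ico (n * D.τ P) ((n + 1) * D.τ P) ×ˢ cell (D.h P) k, D.f z.1 z.2 s| ≤
      F * (D.τ P * D.h P ^ d) := by
  have hτ := D.τ_pos hD.T_pos hN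
  have hle := D.restrict_Ico_prod_le (t₁ := n * D.τ P) (by positivity)
    (D.succ_mul_τ_le hD.T_pos hN hn) (D.cell_subset_Ω hD.L_pos hm hk)
  have hfin : volume (Ico (n * D.τ P) ((n + 1) * D.τ P) ×ˢ cell (D.h P) k) < ⊤ := by
    rw [Measure.volume_eq_prod, Measure.prod_prod, Real.volume_Ico]
    exact ENNReal.mul_lt_top ENNReal.ofReal_lt_top
      (volume_cell_lt_top (D.h_pos hD.L_pos hm) k)
  have := norm_setIntegral_le_of_norm_le_const_ae (f := fun z : ℝ × (Fin d → ℝ) => D.f z.1 z.2 s)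
    (C := F) hfin (ae_mono hle hF)
  rwa [D.volume_real_Ico_mul_cell hD.L_pos hm hτ.le] at this

lemma Data.abs_fh_le (hD : D.Admissible) {P : Params} (hN : 1 ≤ P.N) (hm : 1 ≤ P.m)
    {n : ℕ} (hn : n < P.N) {j : Fin d → ℤ} (hj : j ∈ grid d P.m) {s F : ℝ}
    (hF : ∀ᵐ z ∂volume.restrict D.QT, |D.f z.1 z.2 s| ≤ F) : |D.fh P n j s| ≤ F := by
  have hτ := D.τ_pos hD.T_pos hN
  have hh := D.h_pos hD.L_pos hm
  refine abs_periodize_le_of_forall (fun k hk => ?_) hj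
  have hpos : 0 < D.τ P * D.h P ^ d := by positivity
  rw [abs_mul, abs_of_pos (by positivity : 0 < 1 / (D.τ P * D.h P ^ d)), one_div,
    inv_mul_le_iff₀ hpos, mul_comm _ F]
  exact D.abs_setIntegral_f_le hD hN hm hn hk hF

/-- A bound for the scheme, affine in the range step. -/
lemma Data.Admissible.exists_scheme_bound (hD : D.Admissible) {B : ℝ → ℝ} {CA : ℝ}
    (hB : ∀ s, |B s| ≤ CA * |s|) (K : ℝ) (hK : 0 ≤ K) : ∃ X : ℝ, 0 ≤ X ∧
    ∀ P : Params, 1 ≤ P.N → 1 ≤ P.m → 1 ≤ P.Lq → (∃ c ∈ Icc P.Cmin P.Cmax, |c| ≤ K) →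
    ∀ ι : ℝ → ℕ, P.IsNearest ι → ∀ n ≤ P.N, ∀ j ∈ grid d P.m,
      |D.scheme B P ι n j| ≤ X * (1 + P.q) := by
  obtain ⟨M, hM⟩ := hD.u₀_bounded
  obtain ⟨Cf, hCf, hf⟩ := hD.f_growth
  have hCA : 0 ≤ CA := by
    have := (abs_nonneg _).trans (hB 1)
    simpa using this
  set I := ∫ x in D.Ω, |D.w x| with hI
  have hI0 : 0 ≤ I := integral_nonneg fun _ => abs_nonneg _
  have hT := hD.T_pos
  -- With `x n` the maximum of the discrete values, `v k - v j` contributes `2 x n` and the distance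
  -- of `v j` to its level at most `x n + K + q / 2`: hence the factor three, with `b` collecting
  -- the rest.
  set a := I * CA * 3 + Cf with ha
  set b := I * CA * (K + 1) + Cf with hb
  have ha0 : 0 ≤ a := by positivity
  have hb0 : 0 ≤ b := by positivity
  refine ⟨Real.exp (a * D.T) * (max M 0 + D.T * b), by positivity, ?_⟩
  rintro P hN hm hLq ⟨c, hc, hcK⟩ ι hι
  have hτ := D.τ_pos hT hN
  have hh := D.h_pos hD.L_pos hm
  have hq : 0 ≤ P.q := div_nonneg (by linarith [hc.1, hc.2]) (Nat.cast_nonneg _)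
  have hne : (grid d P.m).Nonempty := by
    rw [← Finset.card_pos, card_grid]; positivity
  set x : ℕ → ℝ := fun n => (grid d P.m).sup' hne fun j => |D.scheme B P ι n j| with hx
  have hxle : ∀ n, ∀ j ∈ grid d P.m, |D.scheme B P ι n j| ≤ x n := fun n j hj =>
    Finset.le_sup' (fun j => |D.scheme B P ι n j|) hj
  have hx0 : ∀ n, 0 ≤ x n := fun n => by
    obtain ⟨j, hj⟩ := hne
    exact (abs_nonneg _).trans (hxle n j hj)
  have hx00 : x 0 ≤ max M 0 := by
    refine Finset.sup'_le _ _ fun j hj => abs_periodize_le_of_forall (fun k hk => ?_) hj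
    refine abs_cellAvg_le hh ?_
    filter_upwards [ae_restrict_of_ae_restrict_of_subset (D.cell_subset_Ω hD.L_pos hm hk) hM]
      with y hy using hy.trans (le_max_left _ _)
  have hstep : ∀ n < P.N, x (n + 1) ≤ x n + D.τ P * (a * x n + b * (1 + P.q)) := by
    intro n hn
    refine Finset.sup'_le _ _ fun j hj => ?_
    rw [Data.scheme]
    simp only
    set v := D.scheme B P ι n with hv
    have h1 : |v j - P.level (ι (v j))| ≤ x n + K + P.q / 2 := by
      refine (hι.abs_sub_level_le hLq hc (v j)).trans ?_
      have := abs_sub (v j) c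
      have := hxle n j hj
      linarith
    have h2 : ∀ k ∈ grid d P.m, |B (v k - P.level (ι (v j)))| ≤ CA * (3 * x n + K + P.q / 2) := by
      intro k hk
      refine (hB _).trans (mul_le_mul_of_nonneg_left ?_ hCA)
      have e : v k - P.level (ι (v j)) = (v k - v j) + (v j - P.level (ι (v j))) := by ring
      rw [e]
      refine (abs_add_le _ _).trans ?_
      have := abs_sub (v k) (v j)
      have := hxle n j hj
      have := hxle n k hk
      linarith
    have h3 : |D.slice B P (ι (v j)) v j| ≤ I * (CA * (3 * x n + K + P.q / 2)) := by
      have hpos : 0 ≤ CA * (3 * x n + K + P.q / 2) := by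
        have := hx0 n
        positivity
      rw [D.slice_eq B hm, abs_mul, abs_of_pos (by positivity : 0 < D.h P ^ d)]
      refine le_trans ?_ (mul_le_mul_of_nonneg_right (D.sum_abs_wPad_le hD hm j) hpos)
      rw [mul_assoc, Finset.sum_mul]
      gcongr
      refine (Finset.abs_sum_le_sum_abs _ _).trans (Finset.sum_le_sum fun k hk => ?_)
      rw [abs_mul]
      gcongr
      exact h2 k hk
    have h4 : |D.fh P n j (v j)| ≤ Cf * (1 + x n) := by
      refine (D.abs_fh_le hD hN hm hn hj (hf (v j))).trans ?_
      gcongr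
      exact hxle n j hj
    have h5 : I * (CA * (3 * x n + K + P.q / 2)) + Cf * (1 + x n) ≤
        a * x n + b * (1 + P.q) := by
      have e : a * x n + b * (1 + P.q) - (I * (CA * (3 * x n + K + P.q / 2)) + Cf * (1 + x n)) =
          I * CA * (1 + K * P.q + P.q / 2) + Cf * P.q := by rw [ha, hb]; ring
      have : 0 ≤ I * CA * (1 + K * P.q + P.q / 2) + Cf * P.q := by positivity
      linarith
    calc |v j + D.τ P * (D.slice B P (ι (v j)) v j + D.fh P n j (v j))|
        ≤ |v j| + D.τ P * |D.slice B P (ι (v j)) v j + D.fh P n j (v j)| := by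
          refine (abs_add_le _ _).trans (le_of_eq ?_)
          rw [abs_mul, abs_of_pos hτ]
      _ ≤ x n + D.τ P * (a * x n + b * (1 + P.q)) := by
          gcongr
          · exact hxle n j hj
          · exact (abs_add_le _ _).trans ((add_le_add h3 h4).trans h5)
  intro n hn j hj
  refine (hxle n j hj).trans ((discrete_gronwall hτ.le ha0 (by positivity) (hx0 0) hstep n
    hn).trans ?_)
  rw [D.N_mul_τ hN, mul_assoc]
  gcongr
  have : 0 ≤ max M 0 * P.q := by positivity
  nlinarith

end Scheme

/-! ### One step of the scheme -/

section Step

variable {d : ℕ} {D : Data d}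

lemma Data.integrable_comp_cellIdx (hL : 0 < D.L) {P : Params} (hm : 1 ≤ P.m)
    (U : (Fin d → ℤ) → ℝ) : IntegrableOn (fun x => U (cellIdx (D.h P) x)) D.Ω := by
  refine Integrable.of_bound (measurable_comp_cellIdx _ U).aestronglyMeasurable
    (∑ j ∈ grid d P.m, |U j|) ((ae_restrict_iff' D.measurableSet_Ω).2
      (Filter.Eventually.of_forall fun x hx => ?_))
  exact Finset.single_le_sum (f := fun j => |U j|) (fun _ _ => abs_nonneg _)
    (D.cellIdx_mem hL hm hx)

variable {u : ℝ → (Fin d → ℝ) → ℝ}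

lemma Data.IsSolution.integrableOn (hu : D.IsSolution u) {t : ℝ} (ht : t ∈ Icc 0 D.T) :
    IntegrableOn (u t) D.Ω := by
  obtain ⟨M, hM⟩ := hu.bv
  exact (hM t ht).1

/-- Consistency of the reaction term. -/
lemma Data.sum_abs_reaction_sub_le (hd : 1 ≤ d) (hD : D.Admissible) (hu : D.IsSolution u)
    {P : Params} (hN : 1 ≤ P.N) (hm : 1 ≤ P.m) {n : ℕ} (hn : n < P.N) {R Λ F : ℝ} (hΛ : 0 ≤ Λ)
    (hF0 : 0 ≤ F)
    (huR : ∀ᵐ x ∂volume.restrict D.Ω, ∀ t ∈ Icc 0 D.T, |u t x| ≤ R)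
    (hF : ∀ᵐ z ∂volume.restrict D.QT, ∀ s, |s| ≤ R → |D.f z.1 z.2 s| ≤ F)
    (hΛf : ∀ᵐ z ∂volume.restrict D.QT, ∀ s s' : ℝ, |s| ≤ R → |s'| ≤ R →
      |D.f z.1 z.2 s - D.f z.1 z.2 s'| ≤ Λ * |s - s'|)
    {U : (Fin d → ℤ) → ℝ} (hU : ∀ j ∈ grid d P.m, |U j| ≤ R) {ε : ℝ}
    (hε : ∀ t ∈ Ico (n * D.τ P) ((n + 1) * D.τ P),
      ∫ x in D.Ω, |u t x - U (cellIdx (D.h P) x)| ≤ ε) :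
    ∑ j ∈ grid d P.m,
      |(∫ z in Ico (n * D.τ P) ((n + 1) * D.τ P) ×ˢ cell (D.h P) j, D.f z.1 z.2 (u z.1 z.2)) -
        D.τ P * D.h P ^ d * D.fh P n j (U j)| ≤
      D.τ P * (Λ * ε + 2 * d * D.L ^ (d - 1) * (2 * F) * D.h P) := by
  have hτ := D.τ_pos hD.T_pos hN
  have hh := D.h_pos hD.L_pos hm
  have hpos : 0 < D.τ P * D.h P ^ d := by positivity
  have ht2 := D.succ_mul_τ_le hD.T_pos hN hn
  have ht1 : (0 : ℝ) ≤ n * D.τ P := by positivity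
  set I := Ico (n * D.τ P) ((n + 1) * D.τ P) with hI
  have hIcc : ∀ t ∈ I, t ∈ Icc 0 D.T := fun t ht => ⟨ht1.trans ht.1, ht.2.le.trans ht2⟩
  have hle := fun j (hj : j ∈ grid d P.m) => D.restrict_Ico_prod_le (t₁ := n * D.τ P) ht1 ht2
    (D.cell_subset_Ω hD.L_pos hm hj)
  have hfin : ∀ k : Fin d → ℤ, volume (I ×ˢ cell (D.h P) k) < ⊤ := fun k => by
    rw [Measure.volume_eq_prod, Measure.prod_prod, Real.volume_Ico]
    exact ENNReal.mul_lt_top ENNReal.ofReal_lt_top (volume_cell_lt_top hh k)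
  have huQ := D.ae_QT huR
  have hFs : ∀ s, |s| ≤ R → ∀ᵐ z ∂volume.restrict D.QT, |D.f z.1 z.2 s| ≤ F := fun s hs =>
    hF.mono fun z hz => hz s hs
  have hfu := D.integrable_f_u hD hu
  have hfU : ∀ s, IntegrableOn (fun z : ℝ × (Fin d → ℝ) => D.f z.1 z.2 s) D.QT := fun s =>
    (hD.f_bv s).1
  -- the difference of the values of the reaction
  have huU : ∀ j ∈ grid d P.m, IntegrableOn (fun z : ℝ × (Fin d → ℝ) => |u z.1 z.2 - U j|)
      (I ×ˢ cell (D.h P) j) := fun j hj => by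
    have := isFiniteMeasure_restrict.2 (hfin j).ne
    refine Integrable.abs (Integrable.sub ?_ (integrable_const _))
    exact Integrable.of_bound (hu.measurable.mono_measure (hle j hj)) R (ae_mono (hle j hj) huQ)
  have hA : ∀ j ∈ grid d P.m,
      |(∫ z in I ×ˢ cell (D.h P) j, D.f z.1 z.2 (u z.1 z.2)) -
        ∫ z in I ×ˢ cell (D.h P) j, D.f z.1 z.2 (U j)| ≤
      Λ * ∫ t in I, ∫ x in cell (D.h P) j, |u t x - U j| := by
    intro j hj
    have h1 := Integrable.mono_measure hfu (hle j hj)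
    have h2 := Integrable.mono_measure (hfU (U j)) (hle j hj)
    have h3 := huU j hj
    rw [← integral_sub h1 h2]
    refine abs_integral_le_integral_abs.trans ?_
    have h4 : ∫ t in I, ∫ x in cell (D.h P) j, |u t x - U j| =
        ∫ z in I ×ˢ cell (D.h P) j, |u z.1 z.2 - U j| := by
      rw [Measure.volume_eq_prod, setIntegral_prod]
      exact h3
    rw [h4, ← integral_const_mul]
    refine integral_mono_ae (h1.sub h2).abs (h3.const_mul Λ) ?_
    filter_upwards [ae_mono (hle j hj) hΛf, ae_mono (hle j hj) huQ] with z hz1 hz2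
    exact hz1 _ _ hz2 (hU j hj)
  have hAsum : ∑ j ∈ grid d P.m, Λ * ∫ t in I, ∫ x in cell (D.h P) j, |u t x - U j| ≤
      D.τ P * (Λ * ε) := by
    have hi : ∀ j ∈ grid d P.m,
        IntegrableOn (fun t => ∫ x in cell (D.h P) j, |u t x - U j|) I := fun j hj => by
      have := huU j hj
      rw [IntegrableOn, Measure.volume_eq_prod, ← Measure.prod_restrict] at this
      exact this.integral_prod_left
    rw [← Finset.mul_sum, ← integral_finsetSum _ hi]
    have h5 : ∫ t in I, ∑ j ∈ grid d P.m, ∫ x in cell (D.h P) j, |u t x - U j| ≤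
        ∫ _ in I, ε := by
      refine setIntegral_mono_on (integrable_finsetSum _ hi)
        (integrableOn_const (by simp [hI])) measurableSet_Ico fun t ht => ?_
      refine le_of_eq_of_le ?_ (hε t ht)
      have h6 : IntegrableOn (fun x => |u t x - U (cellIdx (D.h P) x)|) D.Ω :=
        ((hu.integrableOn (hIcc t ht)).sub (D.integrable_comp_cellIdx hD.L_pos hm U)).abs
      rw [← D.sum_setIntegral_cell hD.L_pos hm h6]
      refine Finset.sum_congr rfl fun j _ => ?_
      refine setIntegral_congr_fun (measurableSet_cell _ _) fun x hx => ?_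
      simp only [cellIdx_of_mem hh hx]
    have h7 : ∫ _ in I, ε = D.τ P * ε := by
      rw [setIntegral_const, hI, Real.volume_real_Ico, max_eq_left (by linarith), smul_eq_mul]
      ring
    rw [h7] at h5
    calc _ ≤ Λ * (D.τ P * ε) := by gcongr
      _ = _ := by ring
  -- the periodization
  have hBdry : ∑ j ∈ grid d P.m, |(∫ z in I ×ˢ cell (D.h P) j, D.f z.1 z.2 (U j)) -
      D.τ P * D.h P ^ d * D.fh P n j (U j)| ≤
      2 * d * D.L ^ (d - 1) * (2 * F * D.τ P) * D.h P := by
    refine D.sum_bdry_le hd hD.L_pos hm (by positivity) (fun j hj hb => ?_) fun j hj => ?_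
    · rw [Data.fh, periodize_of_not_isBdry hj hb, abs_eq_zero, ← mul_assoc,
        mul_one_div_cancel hpos.ne', one_mul, sub_self]
    · refine (abs_sub _ _).trans ?_
      rw [abs_mul, abs_of_pos hpos]
      have h1 := D.abs_setIntegral_f_le hD hN hm hn hj (hFs _ (hU j hj))
      have h2 := D.abs_fh_le hD hN hm hn hj (hFs _ (hU j hj))
      have h3 := mul_le_mul_of_nonneg_left h2 hpos.le
      linarith
  refine (Finset.sum_le_sum fun j hj => (abs_sub_le _
    (∫ z in I ×ˢ cell (D.h P) j, D.f z.1 z.2 (U j)) _).trans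
      (add_le_add (hA j hj) le_rfl)).trans ?_
  rw [Finset.sum_add_distrib]
  refine (add_le_add hAsum hBdry).trans (le_of_eq ?_)
  ring

/-- Consistency of the nonlocal term over a time step. -/
lemma Data.sum_abs_nonlocalOp_sub_le (hD : D.Admissible) (hu : D.IsSolution u) {B : ℝ → ℝ}
    (hB : D.IsSchemeKernel u B) {P : Params} (hN : 1 ≤ P.N) (hm : 1 ≤ P.m) {C W : ℝ}
    (hC : ∀ k ∈ grid d P.m, ∀ y ∈ cell (D.h P) k,
      ∑ j ∈ grid d P.m, |(∫ x in cell (D.h P) j, D.wExt (x - y)) -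
        D.h P ^ d * D.wPad P (wrapIdx (D.ext.halfPeriod P.m) (j - k))| ≤ C * D.h P)
    (hW : 0 ≤ W)
    (h1 : ∀ x, ∫⁻ y in D.Ω, ‖D.wExt (x - y)‖ₑ ≤ ENNReal.ofReal W)
    (h2 : ∀ y, ∫⁻ x in D.Ω, ‖D.wExt (x - y)‖ₑ ≤ ENNReal.ofReal W)
    {S R Λ : ℝ} (hR : 0 ≤ R) (hΛ : 0 ≤ Λ)
    (hBR : ∀ s, |s| ≤ S → |B s| ≤ R)
    (hBΛ : ∀ s s', |s| ≤ S → |s'| ≤ S → |B s - B s'| ≤ Λ * |s - s'|)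
    (huS : ∀ᵐ x ∂volume.restrict D.Ω, ∀ t ∈ Icc 0 D.T, |u t x| ≤ S / 2)
    {n : ℕ} (hn : n < P.N) {ι : ℝ → ℕ} {U : (Fin d → ℤ) → ℝ}
    (hUq : ∀ j ∈ grid d P.m, ∀ k ∈ grid d P.m, |U k - P.level (ι (U j))| ≤ S) {ε η : ℝ}
    (hε : ∀ t ∈ Ico (n * D.τ P) ((n + 1) * D.τ P),
      ∫ x in D.Ω, |u t x - U (cellIdx (D.h P) x)| ≤ ε)
    (hη : D.h P ^ d * ∑ j ∈ grid d P.m, |U j - P.level (ι (U j))| ≤ η) :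
    ∑ j ∈ grid d P.m, |(∫ t in Ico (n * D.τ P) ((n + 1) * D.τ P),
        ∫ x in cell (D.h P) j, D.nonlocalOp (u t) x) -
        D.τ P * (D.h P ^ d * D.slice B P (ι (U j)) U j)| ≤
      D.τ P * (Λ * W * (2 * ε + η) + R * C * D.L ^ d * D.h P) := by
  have hτ := D.τ_pos hD.T_pos hN
  have hh := D.h_pos hD.L_pos hm
  have ht2 := D.succ_mul_τ_le hD.T_pos hN hn
  have ht1 : (0 : ℝ) ≤ n * D.τ P := by positivity
  set I := Ico (n * D.τ P) ((n + 1) * D.τ P) with hI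
  have hIcc : ∀ t ∈ I, t ∈ Icc 0 D.T := fun t ht => ⟨ht1.trans ht.1, ht.2.le.trans ht2⟩
  have hIτ : volume.real I = D.τ P := by
    rw [hI, Real.volume_real_Ico, max_eq_left (by linarith)]
    ring
  have hNi : ∀ j ∈ grid d P.m,
      IntegrableOn (fun t => ∫ x in cell (D.h P) j, D.nonlocalOp (u t) x) I := fun j hj => by
    have := Integrable.mono_measure (D.integrable_nonlocalOp hD hu)
      (D.restrict_Ico_prod_le (t₁ := n * D.τ P) ht1 ht2 (D.cell_subset_Ω hD.L_pos hm hj))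
    rw [Measure.volume_eq_prod, ← Measure.prod_restrict] at this
    exact this.integral_prod_left
  have hci : ∀ c : ℝ, IntegrableOn (fun _ => c) I := fun c => integrableOn_const (by simp [hI])
  obtain ⟨a, b, hab, hBA⟩ := hB.agrees
  have hpt : ∀ t ∈ I, ∑ j ∈ grid d P.m, |(∫ x in cell (D.h P) j, D.nonlocalOp (u t) x) -
      D.h P ^ d * D.slice B P (ι (U j)) U j| ≤
      Λ * W * (2 * ε + η) + R * C * D.L ^ d * D.h P := by
    intro t ht
    -- Almost all values of `u t` lie in `[a, b]`, so their differences stay where `B` and `A`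
    -- coincide.
    have hop : ∀ j ∈ grid d P.m, ∫ x in cell (D.h P) j, D.nonlocalOp (u t) x =
        ∫ x in cell (D.h P) j, ∫ y in D.Ω, D.wExt (x - y) * B (u t y - u t x) := by
      intro j hj
      refine integral_congr_ae ?_
      filter_upwards [ae_restrict_of_ae_restrict_of_subset (D.cell_subset_Ω hD.L_pos hm hj)
        (hab t (hIcc t ht))] with x hx
      refine integral_congr_ae ?_
      filter_upwards [hab t (hIcc t ht)] with y hy
      rw [hBA]
      rw [abs_le]
      constructor <;> linarith [hx.1, hx.2, hy.1, hy.2]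
    have := D.sum_abs_nonlocal_sub_le hD hm hC hW h1 h2 hB.lip.continuous hR hΛ hBR hBΛ
      (hu.aestronglyMeasurable (hIcc t ht)) (huS.mono fun x hx => hx t (hIcc t ht)) (U := U)
      (q := fun j => P.level (ι (U j))) hUq
    refine le_trans (le_of_eq (Finset.sum_congr rfl fun j hj => ?_)) (this.trans ?_)
    · rw [hop j hj, D.slice_eq B hm]
    · gcongr
      exact hε t ht
  have hj : ∀ j ∈ grid d P.m, |(∫ t in I, ∫ x in cell (D.h P) j, D.nonlocalOp (u t) x) -
        D.τ P * (D.h P ^ d * D.slice B P (ι (U j)) U j)| ≤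
      ∫ t in I, |(∫ x in cell (D.h P) j, D.nonlocalOp (u t) x) -
        D.h P ^ d * D.slice B P (ι (U j)) U j| := fun j hj => by
    have e : D.τ P * (D.h P ^ d * D.slice B P (ι (U j)) U j) =
        ∫ _ in I, D.h P ^ d * D.slice B P (ι (U j)) U j := by
      rw [setIntegral_const, hIτ, smul_eq_mul]
    rw [e, ← integral_sub (hNi j hj) (hci _)]
    exact abs_integral_le_integral_abs
  refine (Finset.sum_le_sum hj).trans ?_
  have hi : ∀ j ∈ grid d P.m, IntegrableOn (fun t =>
      |(∫ x in cell (D.h P) j, D.nonlocalOp (u t) x) -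
        D.h P ^ d * D.slice B P (ι (U j)) U j|) I := fun j hj => ((hNi j hj).sub (hci _)).abs
  rw [← integral_finsetSum _ hi]
  refine (setIntegral_mono_on (integrable_finsetSum _ hi) (hci _) measurableSet_Ico hpt).trans
    (le_of_eq ?_)
  rw [setIntegral_const, hIτ, smul_eq_mul]

end Step

/-! ### Propagation of the error -/

section Error

variable {d : ℕ} {D : Data d} {u : ℝ → (Fin d → ℝ) → ℝ}

lemma Data.volume_real_Ω (hL : 0 < D.L) : volume.real D.Ω = D.L ^ d := by
  rw [Measure.real, Data.Ω, volume_cube, ← ENNReal.ofReal_pow hL.le,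
    ENNReal.toReal_ofReal (by positivity)]

/-- The error of the scheme at the time `t_n`, measured by cell integrals. -/
def Data.meshError (D : Data d) (u : ℝ → (Fin d → ℝ) → ℝ) (P : Params) (n : ℕ)
    (U : (Fin d → ℤ) → ℝ) : ℝ :=
  ∑ j ∈ grid d P.m, |(∫ x in cell (D.h P) j, u (n * D.τ P) x) - D.h P ^ d * U j|

lemma Data.meshError_nonneg (P : Params) (n : ℕ) (U : (Fin d → ℤ) → ℝ) :
    0 ≤ D.meshError u P n U := Finset.sum_nonneg fun _ _ => abs_nonneg _

/-- The `L¹`-distance to a mesh function is controlled by the mesh error. -/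
lemma Data.IsSolution.integral_abs_sub_le (hd : 1 ≤ d) (hL : 0 < D.L) (hu : D.IsSolution u)
    {K : NNReal} (hK : ∀ᵐ x ∂volume.restrict D.Ω, LipschitzOnWith K (fun t => u t x) (Icc 0 D.T))
    {M : ℝ} (hM : ∀ t ∈ Icc 0 D.T, VariationLE D.Ω (u t) M)
    {P : Params} (hm : 1 ≤ P.m) {n : ℕ} (hn : (n : ℝ) * D.τ P ∈ Icc 0 D.T)
    {t : ℝ} (ht : t ∈ Icc 0 D.T) (htn : |t - n * D.τ P| ≤ D.τ P) (U : (Fin d → ℤ) → ℝ) :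
    ∫ x in D.Ω, |u t x - U (cellIdx (D.h P) x)| ≤
      D.L ^ d * K * D.τ P + 2 ^ d * M * D.h P + D.meshError u P n U := by
  have hh := D.h_pos hL hm
  set s := (n : ℝ) * D.τ P with hs
  have hut := hu.integrableOn ht
  have hus := hu.integrableOn hn
  have hU := D.integrable_comp_cellIdx hL hm U
  have hsub := fun j (hj : j ∈ grid d P.m) => D.cell_subset_Ω hL hm hj
  have i1 : IntegrableOn (fun x => |u t x - u s x|) D.Ω := (hut.sub hus).abs
  have i2 : IntegrableOn (fun x => |u s x - U (cellIdx (D.h P) x)|) D.Ω := (hus.sub hU).abs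
  have i3 : IntegrableOn (fun x => |u t x - U (cellIdx (D.h P) x)|) D.Ω := (hut.sub hU).abs
  have h1 : ∫ x in D.Ω, |u t x - u s x| ≤ D.L ^ d * K * D.τ P := by
    have : ∫ x in D.Ω, |u t x - u s x| ≤ ∫ _ in D.Ω, K * D.τ P := by
      refine integral_mono_ae i1 (integrable_const _) ?_
      filter_upwards [hK] with x hx
      have := hx.dist_le_mul t ht s hn
      rw [Real.dist_eq, Real.dist_eq] at this
      exact this.trans (by gcongr)
    refine this.trans (le_of_eq ?_)
    rw [setIntegral_const, D.volume_real_Ω hL, smul_eq_mul]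
    ring
  have h2 : ∫ x in D.Ω, |u s x - U (cellIdx (D.h P) x)| ≤
      2 ^ d * M * D.h P + D.meshError u P n U := by
    have hv := hM s hn
    have hus' := hus
    rw [D.Ω_eq hm] at hv hus'
    refine le_trans ?_ (add_le_add (hv.sum_integral_sub_cellAvg_le hd hh P.m hus') le_rfl)
    rw [← D.sum_setIntegral_cell hL hm i2, Data.meshError, ← Finset.sum_add_distrib]
    refine Finset.sum_le_sum fun j hj => ?_
    have hc : ∀ c : ℝ, IntegrableOn (fun _ => c) (cell (D.h P) j) := fun c =>
      integrableOn_const (volume_cell_lt_top hh j).ne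
    have huj := hus.mono_set (hsub j hj)
    -- The mesh error on a cell is the integral of the constant distance between the cell mean and
    -- `U j`; the triangle inequality through the cell mean can then be applied pointwise.
    have e : |(∫ x in cell (D.h P) j, u s x) - D.h P ^ d * U j| =
        ∫ _ in cell (D.h P) j, |cellAvg (D.h P) (u s) j - U j| := by
      rw [setIntegral_const, volume_real_cell hh, smul_eq_mul, ← cellAvg_mul hh, ← mul_sub,
        abs_mul, abs_of_pos (by positivity : 0 < D.h P ^ d)]
    have j1 : IntegrableOn (fun x => |u s x - cellAvg (D.h P) (u s) j|) (cell (D.h P) j) :=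
      (huj.sub (hc _)).abs
    rw [e, ← integral_add j1 (hc _)]
    refine setIntegral_mono_on (i2.mono_set (hsub j hj)) (j1.add (hc _))
      (measurableSet_cell _ _) fun x hx => ?_
    rw [cellIdx_of_mem hh hx]
    exact abs_sub_le _ _ _
  calc _ ≤ ∫ x in D.Ω, (|u t x - u s x| + |u s x - U (cellIdx (D.h P) x)|) :=
        integral_mono i3 (i1.add i2) fun x => abs_sub_le _ _ _
    _ = _ := integral_add i1 i2
    _ ≤ _ := by linarith

/-- The distance of the mesh function to the quantization levels. -/
lemma Data.IsSolution.sum_abs_sub_level_le (hL : 0 < D.L) (hu : D.IsSolution u) {P : Params}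
    (hm : 1 ≤ P.m) (hLq : 1 ≤ P.Lq) {ι : ℝ → ℕ} (hι : P.IsNearest ι)
    (hrange : ∀ t ∈ Icc 0 D.T, ∀ᵐ x ∂volume.restrict D.Ω, u t x ∈ Icc P.Cmin P.Cmax)
    {n : ℕ} (hn : (n : ℝ) * D.τ P ∈ Icc 0 D.T) (U : (Fin d → ℤ) → ℝ) :
    D.h P ^ d * ∑ j ∈ grid d P.m, |U j - P.level (ι (U j))| ≤
      D.meshError u P n U + D.L ^ d * P.q := by
  have hh := D.h_pos hL hm
  have hpos : 0 < D.h P ^ d := by positivity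
  set s := (n : ℝ) * D.τ P with hs
  have hc : ∀ (j : Fin d → ℤ) (c : ℝ), IntegrableOn (fun _ => c) (cell (D.h P) j) := fun j c =>
    integrableOn_const (volume_cell_lt_top hh j).ne
  -- The cell means of `u` inherit the range of `u`, and serve as the admissible comparison values
  -- for the nearest levels.
  have hmean : ∀ j ∈ grid d P.m, cellAvg (D.h P) (u s) j ∈ Icc P.Cmin P.Cmax := by
    intro j hj
    have hr := ae_restrict_of_ae_restrict_of_subset (D.cell_subset_Ω hL hm hj) (hrange s hn)
    have hi := (hu.integrableOn hn).mono_set (D.cell_subset_Ω hL hm hj)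
    have e : ∀ c : ℝ, ∫ _ in cell (D.h P) j, c = D.h P ^ d * c := fun c => by
      rw [setIntegral_const, volume_real_cell hh, smul_eq_mul]
    constructor
    · refine le_of_mul_le_mul_left ?_ hpos
      rw [cellAvg_mul hh, ← e]
      exact integral_mono_ae (hc j _) hi (hr.mono fun x hx => hx.1)
    · refine le_of_mul_le_mul_left ?_ hpos
      rw [cellAvg_mul hh, ← e]
      exact integral_mono_ae hi (hc j _) (hr.mono fun x hx => hx.2)
  have hq : 0 ≤ P.q := by
    obtain ⟨j, hj⟩ : (grid d P.m).Nonempty := by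
      rw [← Finset.card_pos, card_grid]; positivity
    exact div_nonneg (by linarith [(hmean j hj).1, (hmean j hj).2]) (Nat.cast_nonneg _)
  have hsum : D.L ^ d * P.q = ∑ _j ∈ grid d P.m, D.h P ^ d * P.q := by
    rw [Finset.sum_const, nsmul_eq_mul, ← D.h_pow_mul_card hm, mul_assoc]
  rw [Finset.mul_sum, Data.meshError, hsum, ← Finset.sum_add_distrib]
  refine Finset.sum_le_sum fun j hj => ?_
  have h1 := hι.abs_sub_level_le hLq (hmean j hj) (U j)
  rw [← hs, ← cellAvg_mul hh, ← mul_sub, abs_mul, abs_of_pos hpos, ← mul_add]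
  refine mul_le_mul_of_nonneg_left ?_ hpos.le
  rw [abs_sub_comm (cellAvg _ _ _)]
  linarith

/-- The mesh error of the initial datum. -/
lemma Data.IsSolution.exists_meshError_zero_le (hd : 1 ≤ d) (hD : D.Admissible)
    (hu : D.IsSolution u) : ∃ G : ℝ, 0 ≤ G ∧ ∀ P : Params, 1 ≤ P.m →
      D.meshError u P 0 (D.u₀h P) ≤ G * D.h P := by
  obtain ⟨M, hM⟩ := hD.u₀_bounded
  have hL := hD.L_pos
  refine ⟨2 * d * D.L ^ (d - 1) * (2 * max M 0), by positivity, fun P hm => ?_⟩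
  have hh := D.h_pos hL hm
  have hpos : 0 < D.h P ^ d := by positivity
  have havg : ∀ j ∈ grid d P.m, ∫ x in cell (D.h P) j, u ((0 : ℕ) * D.τ P) x =
      D.h P ^ d * cellAvg (D.h P) D.u₀ j := fun j hj => by
    rw [cellAvg_mul hh, Nat.cast_zero, zero_mul]
    exact integral_congr_ae
      (ae_restrict_of_ae_restrict_of_subset (D.cell_subset_Ω hL hm hj) hu.initial)
  have hb : ∀ j ∈ grid d P.m, |cellAvg (D.h P) D.u₀ j| ≤ max M 0 := fun j hj => by
    refine abs_cellAvg_le hh ?_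
    filter_upwards [ae_restrict_of_ae_restrict_of_subset (D.cell_subset_Ω hL hm hj) hM]
      with x hx using hx.trans (le_max_left _ _)
  -- On interior cells the initial discrete value is the exact cell mean, so only the boundary layer
  -- contributes.
  refine D.sum_bdry_le hd hL hm (by positivity) (fun j hj hbd => ?_) fun j hj => ?_
  · rw [havg j hj, Data.u₀h, periodize_of_not_isBdry hj hbd, sub_self, abs_zero]
  · rw [havg j hj, ← mul_sub, abs_mul, abs_of_pos hpos, mul_comm]
    gcongr
    refine (abs_sub _ _).trans ?_
    have h1 := hb j hj
    have h2 := abs_periodize_le_of_forall hb hj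
    rw [Data.u₀h]
    linarith

lemma exists_lipschitz_const {B : ℝ → ℝ} (hB : LocallyLipschitz B) (S : ℝ) :
    ∃ Λ : ℝ, 0 ≤ Λ ∧ ∀ s s', |s| ≤ S → |s'| ≤ S → |B s - B s'| ≤ Λ * |s - s'| := by
  obtain ⟨Λ, hΛ⟩ := LocallyLipschitzOn.exists_lipschitzOnWith_of_compact
    (isCompact_Icc (a := -S) (b := S)) (hB.locallyLipschitzOn)
  refine ⟨Λ, Λ.2, fun s s' hs hs' => ?_⟩
  have := hΛ.dist_le_mul s (abs_le.1 hs) s' (abs_le.1 hs')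
  rwa [Real.dist_eq, Real.dist_eq] at this

/-- The recursion for the mesh error. -/
lemma Data.IsSolution.exists_meshError_succ_le (hd : 1 ≤ d) (hD : D.Admissible)
    (hu : D.IsSolution u) {B : ℝ → ℝ} (hB : D.IsSchemeKernel u B) (X : ℝ) :
    ∃ a c : ℝ, 0 ≤ a ∧ 0 ≤ c ∧ ∀ P : Params, 1 ≤ P.N → 1 ≤ P.m → 1 ≤ P.Lq → 0 ≤ P.q → P.q ≤ 1 →
      (∀ t ∈ Icc 0 D.T, ∀ᵐ x ∂volume.restrict D.Ω, u t x ∈ Icc P.Cmin P.Cmax) →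
      (∃ y ∈ Icc P.Cmin P.Cmax, |y| ≤ X) →
      ∀ ι : ℝ → ℕ, P.IsNearest ι → ∀ n < P.N,
      (∀ j ∈ grid d P.m, |D.scheme B P ι n j| ≤ X) →
      D.meshError u P (n + 1) (D.scheme B P ι (n + 1)) ≤
        D.meshError u P n (D.scheme B P ι n) +
          D.τ P * (a * D.meshError u P n (D.scheme B P ι n) + c * (D.τ P + D.h P + P.q)) := by
  obtain ⟨K, hK⟩ := hu.bounded_lip
  obtain ⟨M, hM⟩ := hu.bv
  have hT := hD.T_pos
  have hL := hD.L_pos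
  have hM0 : 0 ≤ M := (hM 0 ⟨le_rfl, hT.le⟩).2.nonneg
  obtain ⟨W, hW, hW1, hW2⟩ := hD.exists_lintegral_wExt_le
  obtain ⟨C, hC0, hC⟩ := hD.exists_sum_abs_setIntegral_sub_wPad_le hd
  obtain ⟨CA, hCA⟩ := hB.growth
  have hCA0 : 0 ≤ CA := by
    have := (abs_nonneg _).trans (hCA 1)
    simpa using this
  set R : ℝ := max K X with hR
  have hKR : (K : ℝ) ≤ R := le_max_left _ _
  have hXR : X ≤ R := le_max_right _ _
  have hR0 : 0 ≤ R := K.2.trans hKR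
  -- For `q ≤ 1` the distance of `U k` to the level of `U j` is at most `2R + 2R + 1/2`, and
  -- differences of values of `u` are at most `2R`; both fit into `[-S, S]`.
  set S : ℝ := 5 * R + 1 with hS
  have hS0 : 0 ≤ S := by positivity
  obtain ⟨Λ, hΛ, hBΛ⟩ := exists_lipschitz_const hB.lip S
  obtain ⟨F, hF0, hF⟩ := hD.exists_f_bound R
  obtain ⟨Λ', hΛ'⟩ := hD.f_lip R
  set Λf := max Λ' 0 with hΛf
  have hΛf0 : 0 ≤ Λf := le_max_right _ _
  have hflip : ∀ᵐ z ∂volume.restrict D.QT, ∀ s s' : ℝ, |s| ≤ R → |s'| ≤ R →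
      |D.f z.1 z.2 s - D.f z.1 z.2 s'| ≤ Λf * |s - s'| := by
    filter_upwards [hΛ'] with z hz s s' hs hs'
    exact (hz s s' hs hs').trans (mul_le_mul_of_nonneg_right (le_max_left _ _) (abs_nonneg _))
  have huK : ∀ᵐ x ∂volume.restrict D.Ω, ∀ t ∈ Icc 0 D.T, |u t x| ≤ R :=
    hK.mono fun x hx t ht => (hx.1 t ht).trans hKR
  have huS : ∀ᵐ x ∂volume.restrict D.Ω, ∀ t ∈ Icc 0 D.T, |u t x| ≤ S / 2 :=
    huK.mono fun x hx t ht => (hx t ht).trans (by rw [hS]; linarith)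
  have hBR : ∀ s, |s| ≤ S → |B s| ≤ CA * S := fun s hs => (hCA s).trans (by gcongr)
  set G := 2 * d * D.L ^ (d - 1) * (2 * F) with hG
  have hG0 : 0 ≤ G := by positivity
  set A := (2 * (Λ * W) + Λf) * (D.L ^ d * K + 2 ^ d * M) + Λ * W * D.L ^ d +
    CA * S * C * D.L ^ d + G with hA
  -- The mesh error enters the nonlocal term three times, twice through `ε` and once through the
  -- distance to the levels, and the reaction once. All other terms are collected in `A`.
  refine ⟨3 * (Λ * W) + Λf, A, by positivity, by positivity, ?_⟩
  rintro P hN hm hLq hq0 hq1 hrange ⟨y, hy, hyX⟩ ι hι n hn hUX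
  have hτ := D.τ_pos hT hN
  have hh := D.h_pos hL hm
  have ht2 := D.succ_mul_τ_le hT hN hn
  have ht1 : (0 : ℝ) ≤ n * D.τ P := by positivity
  have hnT : (n : ℝ) * D.τ P ∈ Icc 0 D.T := ⟨ht1, by linarith⟩
  set U := D.scheme B P ι n with hU
  set E := D.meshError u P n U with hE
  have hE0 : 0 ≤ E := D.meshError_nonneg P n U
  set ε := D.L ^ d * K * D.τ P + 2 ^ d * M * D.h P + E with hεdef
  have hε : ∀ t ∈ Ico (n * D.τ P) ((n + 1) * D.τ P),
      ∫ x in D.Ω, |u t x - U (cellIdx (D.h P) x)| ≤ ε := fun t ht =>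
    hu.integral_abs_sub_le hd hL (hK.mono fun x hx => hx.2) (fun t ht => (hM t ht).2) hm hnT
      ⟨ht1.trans ht.1, ht.2.le.trans ht2⟩
      (by rw [abs_of_nonneg (by linarith [ht.1])]; linarith [ht.2]) U
  have hη := hu.sum_abs_sub_level_le hL hm hLq hι hrange hnT U
  have hUq : ∀ j ∈ grid d P.m, ∀ k ∈ grid d P.m, |U k - P.level (ι (U j))| ≤ S := by
    intro j hj k hk
    have h1 := hι.abs_sub_level_le hLq hy (U j)
    have h2 := abs_sub (U j) y
    have h3 := abs_sub (U k) (U j)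
    have h4 := abs_sub_le (U k) (U j) (P.level (ι (U j)))
    have h5 := hUX j hj
    have h6 := hUX k hk
    rw [hS]
    linarith
  have hNon := D.sum_abs_nonlocalOp_sub_le hD hu hB hN hm (hC P hm) hW hW1 hW2
    (mul_nonneg hCA0 hS0) hΛ hBR hBΛ huS hn hUq hε hη
  have hRea := D.sum_abs_reaction_sub_le hd hD hu hN hm hn hΛf0 hF0 huK hF hflip
    (fun j hj => (hUX j hj).trans hXR) hε
  have hstep : D.meshError u P (n + 1) (D.scheme B P ι (n + 1)) ≤ E +
      (∑ j ∈ grid d P.m, |(∫ t in Ico (n * D.τ P) ((n + 1) * D.τ P),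
        ∫ x in cell (D.h P) j, D.nonlocalOp (u t) x) -
        D.τ P * (D.h P ^ d * D.slice B P (ι (U j)) U j)| +
      ∑ j ∈ grid d P.m,
        |(∫ z in Ico (n * D.τ P) ((n + 1) * D.τ P) ×ˢ cell (D.h P) j, D.f z.1 z.2 (u z.1 z.2)) -
        D.τ P * D.h P ^ d * D.fh P n j (U j)|) := by
    rw [hE, Data.meshError, Data.meshError, ← Finset.sum_add_distrib, ← Finset.sum_add_distrib]
    refine Finset.sum_le_sum fun j hj => ?_
    have hsub := D.cell_subset_Ω hL hm hj
    have h1 := hu.setIntegral_sub_eq hD (t₁ := n * D.τ P) (t₂ := (n + 1) * D.τ P) ht1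
      (by linarith) ht2 hsub
    rw [integral_sub ((hu.integrableOn ⟨by linarith, ht2⟩).mono_set hsub)
      ((hu.integrableOn hnT).mono_set hsub)] at h1
    have h2 : D.scheme B P ι (n + 1) j =
        U j + D.τ P * (D.slice B P (ι (U j)) U j + D.fh P n j (U j)) := rfl
    rw [h2]
    push_cast
    -- The integrated equation `h1` minus the scheme splits into the old error, the nonlocal
    -- discrepancy and the reaction discrepancy.
    refine le_trans (le_of_eq ?_) ((abs_add_le _ _).trans (add_le_add le_rfl (abs_add_le _ _)))
    congr 1
    linear_combination h1
  refine hstep.trans ?_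
  have hfinal : (Λ * W * (2 * ε + (E + D.L ^ d * P.q)) + CA * S * C * D.L ^ d * D.h P) +
      (Λf * ε + G * D.h P) ≤
      (3 * (Λ * W) + Λf) * E + A * (D.τ P + D.h P + P.q) := by
    have e : (3 * (Λ * W) + Λf) * E + A * (D.τ P + D.h P + P.q) -
        ((Λ * W * (2 * ε + (E + D.L ^ d * P.q)) + CA * S * C * D.L ^ d * D.h P) +
          (Λf * ε + G * D.h P)) =
        (2 * (Λ * W) + Λf) * (D.L ^ d * K * (D.h P + P.q) + 2 ^ d * M * (D.τ P + P.q)) +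
        Λ * W * D.L ^ d * (D.τ P + D.h P) + (CA * S * C * D.L ^ d + G) * (D.τ P + P.q) := by
      rw [hA, hεdef]; ring
    have : 0 ≤ (2 * (Λ * W) + Λf) * (D.L ^ d * K * (D.h P + P.q) + 2 ^ d * M * (D.τ P + P.q)) +
        Λ * W * D.L ^ d * (D.τ P + D.h P) + (CA * S * C * D.L ^ d + G) * (D.τ P + P.q) := by
      positivity
    linarith
  have hmul := mul_le_mul_of_nonneg_left hfinal hτ.le
  rw [mul_add] at hmul
  linarith

end Error

end

end NonlocalFFT

/-! ### The error estimate -/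

open NonlocalFFT in
theorem mainTheorem3 {d : ℕ} (hd : 1 ≤ d) (D : Data d) (hD : D.Admissible)
    (u : ℝ → (Fin d → ℝ) → ℝ) (hu : D.IsSolution u)
    (B : ℝ → ℝ) (hB : D.IsSchemeKernel u B) :
    ∃ C : ℝ, 0 < C ∧
      ∀ (P : Params), 1 ≤ P.N → 1 ≤ P.m → 1 ≤ P.Lq →
        (∀ t ∈ Set.Icc 0 D.T, ∀ᵐ x ∂MeasureTheory.volume.restrict D.Ω,
          u t x ∈ Set.Icc P.Cmin P.Cmax) →
        ∀ ι : ℝ → ℕ, P.IsNearest ι →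
          ∀ t ∈ Set.Ico 0 D.T,
            MeasureTheory.IntegrableOn (fun x => u t x - D.approx B P ι t x) D.Ω ∧
            ∫ x in D.Ω, |u t x - D.approx B P ι t x| ≤ C * (D.τ P + D.h P + P.q) := by
  have hT := hD.T_pos
  have hL := hD.L_pos
  obtain ⟨K, hK⟩ := hu.bounded_lip
  obtain ⟨M, hM⟩ := hu.bv
  have hM0 : 0 ≤ M := (hM 0 ⟨le_rfl, hT.le⟩).2.nonneg
  obtain ⟨CA, hCA⟩ := hB.growth
  obtain ⟨X, hX0, hX⟩ := hD.exists_scheme_bound hCA K K.2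
  obtain ⟨G, hG0, hG⟩ := hu.exists_meshError_zero_le hd hD
  -- For `q ≤ 1` the bound `X (1 + q)` is at most `2 X`; the maximum with `K` also admits a value of
  -- `u` as a point of the range interval.
  obtain ⟨a, c, ha, hc, hrec⟩ := hu.exists_meshError_succ_le hd hD hB (max (2 * X) K)
  -- `C₁` serves the regime `q ≤ 1`, through Gronwall; `C₂` serves `q > 1`, through the size of both
  -- functions.
  set C₁ := D.L ^ d * K + 2 ^ d * M + Real.exp (a * D.T) * (G + D.T * c) with hC₁
  set C₂ := D.L ^ d * (K + 2 * X) with hC₂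
  have hC₁0 : 0 ≤ C₁ := by positivity
  have hC₂0 : 0 ≤ C₂ := by positivity
  refine ⟨C₁ + C₂ + 1, by positivity, ?_⟩
  intro P hN hm hLq hrange ι hι t ht
  have hτ := D.τ_pos hT hN
  have hh := D.h_pos hL hm
  have htT : t ∈ Icc 0 D.T := Ico_subset_Icc_self ht
  have happ : ∀ x, D.approx B P ι t x = D.scheme B P ι ⌊t / D.τ P⌋₊ (cellIdx (D.h P) x) :=
    fun _ => rfl
  simp only [happ]
  set n := ⌊t / D.τ P⌋₊ with hn
  have hint : IntegrableOn (fun x => u t x - D.scheme B P ι n (cellIdx (D.h P) x)) D.Ω :=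
    (hu.integrableOn htT).sub (D.integrable_comp_cellIdx hL hm _)
  refine ⟨hint, ?_⟩
  have hn1 : (n : ℝ) * D.τ P ≤ t := by
    rw [← le_div_iff₀ hτ]
    exact Nat.floor_le (div_nonneg ht.1 hτ.le)
  have hn2 : t < (n + 1) * D.τ P := by
    rw [← div_lt_iff₀ hτ]
    exact Nat.lt_floor_add_one _
  have hnN : n < P.N := by
    have h1 : (n : ℝ) * D.τ P < P.N * D.τ P := by
      rw [D.N_mul_τ hN]; exact hn1.trans_lt ht.2
    exact_mod_cast lt_of_mul_lt_mul_right h1 hτ.le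
  -- The cube has positive measure, so some value of `u 0` is both in the range interval and bounded
  -- by `K`. This anchors `[Cmin, Cmax]`, whose ends are otherwise arbitrary.
  have hy : ∃ y ∈ Icc P.Cmin P.Cmax, |y| ≤ K := by
    have hne : NeZero (volume.restrict D.Ω) := ⟨by
      rw [Ne, Measure.restrict_eq_zero, Data.Ω, volume_cube]
      exact pow_ne_zero _ (by simpa using hL)⟩
    obtain ⟨x, hx1, hx2⟩ := ((hrange 0 ⟨le_rfl, hT.le⟩).and hK).exists
    exact ⟨u 0 x, hx1, hx2.1 0 ⟨le_rfl, hT.le⟩⟩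
  have hq0 : 0 ≤ P.q := by
    obtain ⟨y, hy, -⟩ := hy
    exact div_nonneg (by linarith [hy.1, hy.2]) (Nat.cast_nonneg _)
  have hbound := hX P hN hm hLq hy ι hι
  have hsum0 : 0 ≤ D.τ P + D.h P + P.q := by positivity
  -- For large `q` the discrete values are not confined to a fixed compact set and the Lipschitz
  -- constants are lost, but the error is then at most `K + X (1 + q) ≤ (K + 2 X) q` pointwise.
  rcases le_or_gt P.q 1 with hq1 | hq1
  · have hb : ∀ k ≤ P.N, ∀ j ∈ grid d P.m, |D.scheme B P ι k j| ≤ max (2 * X) K := by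
      intro k hk j hj
      refine (hbound k hk j hj).trans (le_trans ?_ (le_max_left _ _))
      nlinarith
    have hE := discrete_gronwall (x := fun k => D.meshError u P k (D.scheme B P ι k)) hτ.le ha
      (mul_nonneg hc hsum0) (D.meshError_nonneg P 0 _) (fun k hk => hrec P hN hm hLq hq0 hq1 hrange
        (hy.imp fun y hy => ⟨hy.1, hy.2.trans (le_max_right _ _)⟩) ι hι k hk
        (hb k hk.le)) n hnN.le
    simp only [D.N_mul_τ hN] at hE
    have hdist := hu.integral_abs_sub_le hd hL (hK.mono fun x hx => hx.2)
      (fun t ht => (hM t ht).2) hm (n := n) ⟨by positivity, hn1.trans htT.2⟩ htT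
      (by rw [abs_of_nonneg (by linarith)]; linarith) (D.scheme B P ι n)
    have h0 : D.meshError u P 0 (D.scheme B P ι 0) ≤ G * (D.τ P + D.h P + P.q) :=
      (hG P hm).trans (by gcongr; linarith)
    have hE' : D.meshError u P n (D.scheme B P ι n) ≤
        Real.exp (a * D.T) * (G + D.T * c) * (D.τ P + D.h P + P.q) := by
      refine hE.trans ?_
      rw [mul_assoc]
      gcongr
      linarith
    have h1 : D.L ^ d * K * D.τ P ≤ D.L ^ d * K * (D.τ P + D.h P + P.q) := by
      gcongr; linarith
    have h2 : 2 ^ d * M * D.h P ≤ 2 ^ d * M * (D.τ P + D.h P + P.q) := by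
      gcongr; linarith
    calc _ ≤ C₁ * (D.τ P + D.h P + P.q) := by rw [hC₁, add_mul, add_mul]; linarith
      _ ≤ _ := by gcongr; linarith
  · have h1 : ∫ x in D.Ω, |u t x - D.scheme B P ι n (cellIdx (D.h P) x)| ≤
        ∫ _ in D.Ω, (K + 2 * X) * P.q := by
      refine integral_mono_ae hint.abs (integrable_const _) ?_
      filter_upwards [hK, ae_restrict_mem D.measurableSet_Ω] with x hx hxΩ
      refine (abs_sub _ _).trans ?_
      have h2 := hx.1 t htT
      have h3 := hbound n hnN.le _ (D.cellIdx_mem hL hm hxΩ)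
      have h4 : (K : ℝ) ≤ K * P.q := le_mul_of_one_le_right K.2 hq1.le
      have h5 : X * (1 + P.q) ≤ 2 * X * P.q := by nlinarith
      linarith
    rw [setIntegral_const, D.volume_real_Ω hL, smul_eq_mul, ← mul_assoc] at h1
    calc _ ≤ C₂ * P.q := h1
      _ ≤ (C₁ + C₂ + 1) * (D.τ P + D.h P + P.q) := by
        gcongr
        · linarith
        · linarith
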